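/- **Setting.** Let $M$ be a connected oriented $3$-manifold with boundary $\partial M=T_1\sqcup\dots\sqcup T_k$ a union of tori (for instance a hyperbolic one), and let $\boldsymbol\alpha=(\alpha_1,\dots,\alpha_k)$ be a system of nontrivial simple closed curves $\alpha_i\subset T_i$. Let $\mathcal T=\{\Delta_1,\dots,\Delta_n\}$ be an ideal triangulation of $M$; it has $n$ edges. Choose a pair of opposite edges in each $\Delta_j$, give them the shape $z_j\in\mathbb C\setminus\{0,1\}$, and give the other two pairs, in the cyclic order determined by the orientation, the shapes $z_j'=\frac1{1-z_j}$ and $z_j''=1-\frac1{z_j}$. Let $E_{ij},E_{ij}',E_{ij}''$ be the numbers of edges of $\Delta_j$ with shape $z_j,z_j',z_j''$ that are incident to the edge $e_i$ of $\mathcal T$. For a simple closed curve on $\partial M$, normal with respect to the induced triangulation of $\partial M$, let $C_j,C_j',C_j''$ be the numbers of edges (corners of boundary triangles) with shape $z_j,z_j',z_j''$ that it cuts off on its left minus those on its right. The gluing variety $\mathcal V_{\mathcal T}$ consists of all $\mathbf z\in(\mathbb C\setminus\{0,1\})^n$ with $\prod_j z_j^{E_{ij}}(z_j')^{E_{ij}'}(z_j'')^{E_{ij}''}=1$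 for every edge $e_i$. Let $G,G',G''$ be the $n\times n$ matrices whose rows are those of $E,E',E''$ for $n-k$ linearly independent edges, followed by those of $C,C',C''$ for $\alpha_1,\dots,\alpha_k$; here linear independence of a set of edges refers to the integral rows $(E_{ij}-E'_{ij},E''_{ij}-E'_{ij})_j$. A strong combinatorial flattening consists of $\mathbf f,\mathbf f',\mathbf f''\in\mathbb Z^n$ with $f_j+f_j'+f_j''=1$ for all $j$, with $\sum_j(E_{ij}f_j+E_{ij}'f_j'+E_{ij}''f_j'')=2$ for every edge $e_i$, and with $\sum_j(C_jf_j+C_j'f_j'+C_j''f_j'')=0$ for every nontrivial simple closed curve on $\partial M$. For $\mathbf z\in\mathcal V_{\mathcal T}$ the 1-loop invariant is, up to sign, $$\tau(M,\boldsymbol\alpha,\mathbf z,\mathcal T)=\pm\tfrac12\det\big((G-G')\Delta_{\mathbf z''}+(G''-G')\Delta_{\mathbf z}^{-1}\big)\prod_{j=1}^n z_j^{f_j''}(z_j'')^{-f_j},$$ where $\Delta_{\mathbf z}=\operatorname{diag}(z_1,\dots,z_n)$ and $\Delta_{\mathbf z''}=\operatorname{diag}(z_1'',\dots,z_n'')$.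 A 0-2 move opens $\mathcal T$ along two distinct faces $ABC$ and $ABD$ that share an edge $AB$, and fills the resulting pillow with two tetrahedra $ABCD$ glued to each other along the faces $ACD$ and $BCD$. The result is an ideal triangulation $\mathcal T'$ of $M$ with $n+2$ tetrahedra. **Proposition.** Let $\mathcal T'$ be obtained from $\mathcal T$ by a 0-2 move. Let $\mathbf z\in\mathcal V_{\mathcal T}$ and $\mathbf z'\in\mathcal V_{\mathcal T'}$ be such that $\mathbf z$ is obtained from $\mathbf z'$ by deleting the shapes of the two new tetrahedra. Then $$\tau(M,\boldsymbol\alpha,\mathbf z,\mathcal T)=\pm\,\tau(M,\boldsymbol\alpha,\mathbf z',\mathcal T')$$ for all strong combinatorial flattenings of $\mathcal T$ and of $\mathcal T'$ and all normal representatives of the isotopy classes of the curves $\alpha_i$ in both boundary triangulations, and for all choices of linearly independent edges $B$ of $\mathcal T$ and $B'$ of $\mathcal T'$ ($n-k$ and $n+2-k$ edges) such that either (a) in each of $\mathcal T$ and $\mathcal T'$ the remaining edge equations are formal consequences of the chosen ones, that is, their rows are integral linear combinations of the chosen rows; or (b) the same $k$ edges are omitted in $\mathcal T$ and in $\mathcal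 T'$, that is, each edge outside $B$ is matched bijectively with an edge outside $B'$ that arises from it. -/

import Mathlib

open scoped BigOperators

noncomputable section

/-- Finitely many tetrahedra, indexed by `ι` and each with vertices labelled by `Fin 4`, whose faces
are glued in pairs.  The face `f` of `t` is the one opposite to the vertex `f`; it is glued to a face
of `nbr t f`, the vertices `v ≠ f` of the face going to `perm t f v`, and the face `f` going to the
face `perm t f f`.  Every tetrahedron carries the orientation given by its labelling, and the gluing
maps reverse the induced orientations of the faces (`perm_sign`), so that the quotient is oriented.
No face is glued to itself. -/
structure GluedTetrahedra (ι : Type*) where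
  nbr : ι → Fin 4 → ι
  perm : ι → Fin 4 → Equiv.Perm (Fin 4)
  nbr_nbr : ∀ t f, nbr (nbr t f) (perm t f f) = t
  perm_perm : ∀ t f, perm (nbr t f) (perm t f f) = (perm t f)⁻¹
  no_fold : ∀ t f, ¬ (nbr t f = t ∧ perm t f f = f)
  perm_sign : ∀ t f, Equiv.Perm.sign (perm t f) = -1

/-- The type of the pair of opposite edges of a tetrahedron that contains the edge `ab`: type `0` is
`{01, 23}`, type `1` is `{02, 13}`, type `2` is `{03, 12}` (the values at `a = b` are not used). -/
def quadType (a b : Fin 4) : Fin 3 :=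
  (![![0, 0, 1, 2], ![0, 0, 2, 1], ![1, 2, 0, 0], ![2, 1, 0, 0]] : Fin 4 → Fin 4 → Fin 3) a b

/-- The shape parameters `z`, `z' = 1 / (1 - z)`, `z'' = 1 - 1 / z` of the edges of type `0`, `1`, `2`
of a tetrahedron of shape `z`. -/
def shape (z : ℂ) : Fin 3 → ℂ := ![z, (1 - z)⁻¹, 1 - z⁻¹]

namespace GluedTetrahedra

variable {ι : Type*} (T : GluedTetrahedra ι)

/-! ### Cusps, edges, and vertices of the links -/

/-- Identification of tetrahedron vertices across a face. -/
inductive CuspStep : ι × Fin 4 → ι × Fin 4 → Prop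
  | glue (t : ι) (f v : Fin 4) (hv : v ≠ f) :
      CuspStep (t, v) (T.nbr t f, T.perm t f v)

/-- Identification of oriented tetrahedron edges across a face. -/
inductive LinkStep : ι × Fin 4 × Fin 4 → ι × Fin 4 × Fin 4 → Prop
  | glue (t : ι) (f v w : Fin 4) (hv : v ≠ f) (hw : w ≠ f) :
      LinkStep (t, v, w) (T.nbr t f, T.perm t f v, T.perm t f w)

/-- Identification of unoriented tetrahedron edges across a face. -/
inductive EdgeStep : ι × Fin 4 × Fin 4 → ι × Fin 4 × Fin 4 → Prop
  | flip (t : ι) (a b : Fin 4) : EdgeStep (t, a, b) (t, b, a)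
  | glue (t : ι) (f a b : Fin 4) (ha : a ≠ f) (hb : b ≠ f) :
      EdgeStep (t, a, b) (T.nbr t f, T.perm t f a, T.perm t f b)

/-- The ideal vertices, that is, the boundary components of the manifold. -/
def Cusp : Type _ := Quot T.CuspStep

/-- The ideal vertex at the vertex `v` of `t`. -/
def cusp (t : ι) (v : Fin 4) : T.Cusp := Quot.mk _ (t, v)

/-- Cutting off the vertex `v` of the tetrahedron `t` gives a triangle `(t, v)`; its sides lie on the
faces `f ≠ v`, its corners on the edges from `v` to `w ≠ v`.  These triangles form the link of the
ideal vertices, a triangulation of the boundary.  `linkVertex t v w` is the vertex of the link at the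
corner `w` of `(t, v)`. -/
def linkVertex (t : ι) (v w : Fin 4) : Quot T.LinkStep := Quot.mk _ (t, v, w)

/-- The class of the edge `ab` of `t`. -/
def edgeClass (t : ι) (a b : Fin 4) : Quot T.EdgeStep := Quot.mk _ (t, a, b)

/-- The edges of the triangulation. -/
def Edge : Type _ := {e : Quot T.EdgeStep // ∃ t a b, a ≠ b ∧ T.edgeClass t a b = e}

/-! ### Flags

A flag is a tetrahedron together with an ordering of its four vertices. -/

/-- The flag on the other side of the face opposite to the vertex number `k` of the flag `x`, its
vertices listed in the corresponding order. -/
def across (x : ι × Equiv.Perm (Fin 4)) (k : Fin 4) : ι × Equiv.Perm (Fin 4) :=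
  (T.nbr x.1 (x.2 k), T.perm x.1 (x.2 k) * x.2)

/-- Turning around the edge `ab` of the flag `x = (t; a, b, c, d)`: leave `t` through the face `abd`;
in the resulting flag the face just crossed is again the one spanned by the first three vertices. -/
def turn (x : ι × Equiv.Perm (Fin 4)) : ι × Equiv.Perm (Fin 4) :=
  ((T.across x 2).1, (T.across x 2).2 * Equiv.swap 2 3)

end GluedTetrahedra

/-- An (oriented) ideal triangulation of a connected 3-manifold all of whose boundary components are
tori.  The link of an ideal vertex is a connected closed oriented surface with `F` triangles,
`3 F / 2` sides and `V` vertices; it is a torus if and only if `V - 3 F / 2 + F = 0`. -/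
structure IdealTriangulation (ι : Type*) extends GluedTetrahedra ι where
  connected : ∀ s t : ι, Relation.ReflTransGen (fun s t => ∃ f, nbr s f = t) s t
  torus : ∀ c : toGluedTetrahedra.Cusp,
    2 * Nat.card {x : Quot toGluedTetrahedra.LinkStep // ∃ t v w, v ≠ w ∧
        toGluedTetrahedra.cusp t v = c ∧ toGluedTetrahedra.linkVertex t v w = x} =
      Nat.card {x : ι × Fin 4 // toGluedTetrahedra.cusp x.1 x.2 = c}

namespace IdealTriangulation

open Classical in
/-- The number of edges of type `q` of the tetrahedron `t` that are incident to `e`; for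
`q = 0, 1, 2` these are the numbers `E`, `E'`, `E''`. -/
def incidence {ι : Type*} (T : IdealTriangulation ι) (e : T.Edge) (t : ι) (q : Fin 3) : ℕ :=
  (Finset.univ.filter fun x : Fin 4 × Fin 4 =>
    x.1 < x.2 ∧ quadType x.1 x.2 = q ∧ T.edgeClass t x.1 x.2 = e.1).card

/-- The gluing variety: nondegenerate shapes that satisfy all edge equations. -/
def gluingVariety {ι : Type*} [Fintype ι] (T : IdealTriangulation ι) : Set (ι → ℂ) :=
  {z | (∀ t, z t ≠ 0 ∧ z t ≠ 1) ∧
    ∀ e : T.Edge, ∏ t, ∏ q, shape (z t) q ^ T.incidence e t q = 1}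

/-! ### Curves on the boundary -/

/-- An oriented closed curve in the link that is normal and piecewise linear, consisting of `m + 1`
arcs, indexed cyclically.  The arc `i` is described by a flag `(t; v, f, g, w)`: it is a segment in
the triangle `(t, v)` which enters through the side on `f`, leaves through the side on `g`, and so
cuts off the corner `w`.  `pt i` is its initial point, in barycentric coordinates of the triangle. -/
structure NormalCurve {ι : Type*} (T : IdealTriangulation ι) where
  m : ℕ
  arc : Fin (m + 1) → ι × Equiv.Perm (Fin 4)
  tet_succ : ∀ i, (arc (i + 1)).1 = (T.across (arc i) 2).1
  vertex_succ : ∀ i, (arc (i + 1)).2 0 = (T.across (arc i) 2).2 0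
  side_succ : ∀ i, (arc (i + 1)).2 1 = (T.across (arc i) 2).2 2
  pt : Fin (m + 1) → Fin 4 → ℝ
  pt_vertex : ∀ i, pt i ((arc i).2 0) = 0
  pt_side : ∀ i, pt i ((arc i).2 1) = 0
  pt_pos : ∀ i, 0 < pt i ((arc i).2 2) ∧ 0 < pt i ((arc i).2 3)
  pt_sum : ∀ i, ∑ w, pt i w = 1

namespace NormalCurve

variable {ι : Type*} {T : IdealTriangulation ι} (γ : NormalCurve T)

/-- The final point of the arc `i`, which is the initial point of the next arc seen from the triangle
of the arc `i`. -/
def exitPt (i : Fin (γ.m + 1)) : Fin 4 → ℝ :=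
  fun w => γ.pt (i + 1) (T.perm (γ.arc i).1 ((γ.arc i).2 2) w)

/-- The curve has no self-intersections. -/
def IsSimple : Prop :=
  ∀ i j, i ≠ j → (γ.arc i).1 = (γ.arc j).1 → (γ.arc i).2 0 = (γ.arc j).2 0 →
    Disjoint (segment ℝ (γ.pt i) (γ.exitPt i)) (segment ℝ (γ.pt j) (γ.exitPt j))

open Classical in
/-- The number of times the curve leaves the triangle `(t, v)` through the side on `f`, minus the
number of times it enters the triangle there. -/
def crossing (t : ι) (v f : Fin 4) : ℤ :=
  ∑ i, ((if (γ.arc i).1 = t ∧ (γ.arc i).2 0 = v ∧ (γ.arc i).2 2 = f then (1 : ℤ) else 0) -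
    (if (γ.arc i).1 = t ∧ (γ.arc i).2 0 = v ∧ (γ.arc i).2 1 = f then (1 : ℤ) else 0))

open Classical in
/-- The number of edges of type `q` of the tetrahedron `t` on one fixed side of the curve minus the
number of those on the other side; for `q = 0, 1, 2` these are the numbers `C`, `C'`, `C''`. -/
def turning (t : ι) (q : Fin 3) : ℤ :=
  ∑ i, if (γ.arc i).1 = t ∧ quadType ((γ.arc i).2 0) ((γ.arc i).2 3) = q then
    ((Equiv.Perm.sign (γ.arc i).2 : ℤˣ) : ℤ) else 0

end NormalCurve

/-- The crossing numbers of the boundary of a 2-chain: here the 2-chain is the combination with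
coefficients `p` of the cells dual to the vertices of the link.  The value at a flag `(t; v, f, w, u)`
refers to the side on `f` of the triangle `(t, v)`, whose end points are the corners `w` and `u`. -/
def boundaryCrossing {ι : Type*} (T : IdealTriangulation ι) (p : Quot T.LinkStep → ℤ)
    (x : ι × Equiv.Perm (Fin 4)) : ℤ :=
  p (T.linkVertex x.1 (x.2 0) (x.2 2)) - p (T.linkVertex x.1 (x.2 0) (x.2 3))

/-- The curve is homologous (equivalently, on a torus, homotopic) to zero. -/
def NormalCurve.IsTrivial {ι : Type*} {T : IdealTriangulation ι} (γ : NormalCurve T) : Prop :=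
  ∃ p : Quot T.LinkStep → ℤ, ∀ x : ι × Equiv.Perm (Fin 4), Equiv.Perm.sign x.2 = 1 →
    γ.crossing x.1 (x.2 0) (x.2 1) = T.boundaryCrossing p x

/-- A nontrivial simple closed curve on the boundary. -/
structure SimpleClosedCurve {ι : Type*} (T : IdealTriangulation ι) extends NormalCurve T where
  simple : toNormalCurve.IsSimple
  nontrivial : ¬ toNormalCurve.IsTrivial

/-- A system of simple closed curves, exactly one on every boundary component. -/
structure CurveSystem {ι : Type*} (T : IdealTriangulation ι) (κ : Type*) where
  curve : κ → SimpleClosedCurve T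
  bijective : Function.Bijective fun i =>
    T.cusp ((curve i).arc 0).1 (((curve i).arc 0).2 0)

/-! ### Strong combinatorial flattenings and the 1-loop invariant -/

/-- A strong combinatorial flattening; `f t 0`, `f t 1`, `f t 2` are the components `f`, `f'`, `f''`
at the tetrahedron `t`. -/
structure IsStrongFlattening {ι : Type*} [Fintype ι] (T : IdealTriangulation ι)
    (f : ι → Fin 3 → ℤ) : Prop where
  tet : ∀ t, ∑ q, f t q = 1
  edge : ∀ e : T.Edge, ∑ t, ∑ q, (T.incidence e t q : ℤ) * f t q = 2
  curve : ∀ γ : SimpleClosedCurve T, ∑ t, ∑ q, γ.turning t q * f t q = 0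

/-- The exponents of an edge equation in terms of `z` and `z''`, after elimination of `z'` by means of
`z z' z'' = -1`. -/
def edgeRow {ι : Type*} (T : IdealTriangulation ι) (e : T.Edge) : ι → ℤ × ℤ :=
  fun t => ((T.incidence e t 0 : ℤ) - T.incidence e t 1,
    (T.incidence e t 2 : ℤ) - T.incidence e t 1)

/-- All edge equations are formal consequences of those of the set `B`: each of them is a product of
integral powers of the latter. -/
def GeneratesEdgeEquations {ι : Type*} (T : IdealTriangulation ι) (B : Set T.Edge) : Prop :=
  ∀ e : T.Edge, T.edgeRow e ∈ Submodule.span ℤ (T.edgeRow '' B)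

/-- The choices in the definition of the 1-loop invariant: `n - k` linearly independent edges, an
order of the `n` rows (edges and curves) of the matrices, and a strong combinatorial flattening. -/
structure Choice {ι : Type*} [Fintype ι] (T : IdealTriangulation ι) (κ : Type*) where
  edges : Set T.Edge
  independent : LinearIndependent ℤ fun e : edges => T.edgeRow e
  row : ι ≃ edges ⊕ κ
  flat : ι → Fin 3 → ℤ
  isStrongFlattening : T.IsStrongFlattening flat

/-- For `q = 0, 1, 2`, the matrices `G`, `G'`, `G''`. -/
def gluingMatrix {ι : Type*} [Fintype ι] (T : IdealTriangulation ι) {κ : Type*}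
    (α : T.CurveSystem κ) (c : T.Choice κ) (q : Fin 3) : Matrix ι ι ℂ :=
  Matrix.of fun i t =>
    Sum.elim (fun e : c.edges => ((T.incidence e.1 t q : ℕ) : ℂ))
      (fun a : κ => (((α.curve a).turning t q : ℤ) : ℂ)) (c.row i)

/-- The 1-loop invariant, a number that is meant up to sign:
`1/2 * det ((G - G') Δ_{z''} + (G'' - G') Δ_z⁻¹) * ∏ z ^ f'' * z'' ^ (-f)`. -/
def oneLoop {ι : Type*} [Fintype ι] [DecidableEq ι] (T : IdealTriangulation ι) {κ : Type*}
    (α : T.CurveSystem κ) (c : T.Choice κ) (z : ι → ℂ) : ℂ :=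
  1 / 2 *
    ((T.gluingMatrix α c 0 - T.gluingMatrix α c 1) * Matrix.diagonal (fun t => shape (z t) 2) +
      (T.gluingMatrix α c 2 - T.gluingMatrix α c 1) * Matrix.diagonal (fun t => (z t)⁻¹)).det *
    ∏ t, (z t ^ c.flat t 2 * shape (z t) 2 ^ (-c.flat t 0))

/-! ### The 0-2 move -/

/-- `T'` is obtained from `T` by a 0-2 move.  The flag `x = (t; a, b, c, d)` gives an edge `ab` and a
face `F₁ = abc`; turning `steps` times around this edge, away from `F₁`, gives a flag
`y = (s; a, b, c', d')` and the second face `F₂ = abd'`, distinct from `F₁`.  The complex is opened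
along `F₁ ∪ F₂`, and the resulting pillow is filled with two new tetrahedra `ABCD`: the first one is
glued to `F₁` along `ABC` and to `F₂` along `ABD` on the side of `x` and `y`, the second one on the
other side, and the two are glued to each other along `BCD` and `ACD`.  The vertices `A, B, C, D` of
the new tetrahedron `j` have the labels `lab j 0, …, lab j 3`. -/
structure ZeroTwoMove {ι : Type*} (T : IdealTriangulation ι) (T' : IdealTriangulation (ι ⊕ Fin 2))
    where
  x : ι × Equiv.Perm (Fin 4)
  steps : ℕ
  y : ι × Equiv.Perm (Fin 4)
  y_eq : y = T.turn^[steps] x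
  faces_ne : (y.1, y.2 2) ≠ (x.1, x.2 3)
  faces_ne' : ((T.across y 2).1, (T.across y 2).2 2) ≠ (x.1, x.2 3)
  lab : Fin 2 → Equiv.Perm (Fin 4)
  first_face : T'.across (Sum.inl x.1, x.2) 3 = (Sum.inr 0, lab 0)
  second_face : T'.across (Sum.inl y.1, y.2) 2 = (Sum.inr 0, lab 0)
  first_face' : T'.across (Sum.inl (T.across x 3).1, (T.across x 3).2) 3 = (Sum.inr 1, lab 1)
  second_face' : T'.across (Sum.inl (T.across y 2).1, (T.across y 2).2) 2 = (Sum.inr 1, lab 1)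
  inner_BCD : T'.across (Sum.inr 0, lab 0) 0 = (Sum.inr 1, lab 1)
  inner_ACD : T'.across (Sum.inr 0, lab 0) 1 = (Sum.inr 1, lab 1)
  old_faces : ∀ t f, (t, f) ≠ (x.1, x.2 3) → (t, f) ≠ (y.1, y.2 2) →
    (t, f) ≠ ((T.across x 3).1, (T.across x 3).2 3) →
    (t, f) ≠ ((T.across y 2).1, (T.across y 2).2 2) →
    T'.nbr (Sum.inl t) f = Sum.inl (T.nbr t f) ∧ T'.perm (Sum.inl t) f = T.perm t f

/-- The same edges are omitted from `B` and from `B'`: every edge of `T` outside `B` is matched with an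
edge of `T'` outside `B'` that arises from it. -/
def SameOmittedEdges {ι : Type*} {T : IdealTriangulation ι} {T' : IdealTriangulation (ι ⊕ Fin 2)}
    (B : Set T.Edge) (B' : Set T'.Edge) : Prop :=
  ∃ φ : ↥(Bᶜ) ≃ ↥(B'ᶜ), ∀ e, ∃ t a b, a ≠ b ∧ T.edgeClass t a b = e.1.1 ∧
    T'.edgeClass (Sum.inl t) a b = (φ e).1.1

/-- A curve `γ` in the link of `T` and a curve `γ'` in the link of `T'` represent the same class on
the boundary of the manifold.  The link of `T'` arises from that of `T` by inserting disks, which are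
triangulated by the triangles of the two new tetrahedra.  The two curves correspond to each other if
`γ'` is homologous to a cycle that coincides with `γ` outside these disks. -/
def SameClass {ι : Type*} {T : IdealTriangulation ι} {T' : IdealTriangulation (ι ⊕ Fin 2)}
    (γ : NormalCurve T) (γ' : NormalCurve T') : Prop :=
  ∃ p : Quot T'.LinkStep → ℤ, ∀ x : ι × Equiv.Perm (Fin 4), Equiv.Perm.sign x.2 = 1 →
    γ'.crossing (Sum.inl x.1) (x.2 0) (x.2 1) =
      γ.crossing x.1 (x.2 0) (x.2 1) + T'.boundaryCrossing p (Sum.inl x.1, x.2)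

end IdealTriangulation

end

noncomputable section

/-! ### Types of edges -/

/-! The determinant and the monomial are compared separately, up to sign. The determinant of the new
triangulation acquires a factor `w₀ * w₁`, the weights of the edge `AB` in the two new tetrahedra,
and the new part of the monomial cancels this factor.

Determinant. By `oneLoop_eq` each entry is a count of edges or corners paired with the weights `(1 -
z⁻¹, -1, z⁻¹)`, whose sum is zero. The equation of the edge `CD` makes the shapes of the two new
tetrahedra at `AB` inverse to each other. As the two have opposite orientations, all their weights
are then proportional with a single ratio `l` (`exists_weight_ratio`). Subtracting `l` times one new
column from the other therefore leaves of an edge function only the difference of its values at the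
two edges into which `AB` is split. The row of `CD` lives on the new columns alone, so it and the
row of one edge `AB` suffice to eliminate both columns (`det_eq_mul_det_of_two_rows`). What remains
of an edge function agrees on both copies of `AB` and descends to an edge row of the old
triangulation. A curve row becomes the old curve row plus edge rows. These do not change the
determinant, because the chosen edges span all edge rows over `ℂ`: there are as many edges as
tetrahedra (`card_edge`), and every cusp gives an independent relation (`finrank_range_edgeRow`).

Edge choices. Matched omissions force the new set to consist of `CD`, one edge `AB` and lifts of the
old set. If the chosen edges generate integrally, both sets have the same integral span, because
relations between edge rows lift (`exists_rowOf_pullback_eq_zero`); an integral change of basis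
costs only a sign.

Monomial. Adding the symplectic dual of an edge row to a flattening changes the monomial only by a
sign, so the new flattening may be normalized to have sum zero over the two copies of the edge `AC`.
Its restriction to the old tetrahedra then satisfies the old edge equations. It is also orthogonal
to nontrivial simple curves, since these lift through the pillow to nontrivial simple curves. Its
difference `d` from the old flattening is orthogonal to all edges and to all closed curves that
visit each boundary triangle at most once. Such a `d` has a potential on the sides of the link,
whence `2 * d` is the dual of an edge function with even sums over faces; the edge equations and a
parity count give a monomial of square `1` (`prod_shapeMonomial_sq`). Finally `pillow_sq` evaluates
the new tetrahedra. -/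

theorem quadType_symm (a b : Fin 4) : quadType a b = quadType b a := by
  revert a b; decide

/-- The types at the other two corners of a vertex, in the order given by the orientation. -/
theorem quadType_perm (σ : Equiv.Perm (Fin 4)) :
    (Equiv.Perm.sign σ = 1 ∧ quadType (σ 0) (σ 1) = quadType (σ 0) (σ 3) + 1 ∧
      quadType (σ 0) (σ 2) = quadType (σ 0) (σ 3) + 2) ∨
    (Equiv.Perm.sign σ = -1 ∧ quadType (σ 0) (σ 1) = quadType (σ 0) (σ 3) + 2 ∧
      quadType (σ 0) (σ 2) = quadType (σ 0) (σ 3) + 1) := by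
  revert σ; decide

/-- A primitive of the weights `w` of the corners of a triangle, as a function of its sides. -/
def sideWeight {M : Type*} [AddCommGroup M] (w : Fin 3 → M) : Fin 3 → M := ![0, w 2, -w 1]

/-- The three corner weights around a triangle sum to zero, so going once around the triangle
produces no defect and the weights have a primitive on its sides. -/
theorem sideWeight_sub {M : Type*} [CommRing M] (w : Fin 3 → M) (hw : ∑ q, w q = 0)
    (σ : Equiv.Perm (Fin 4)) :
    sideWeight w (quadType (σ 0) (σ 2)) - sideWeight w (quadType (σ 0) (σ 1)) =
      ((Equiv.Perm.sign σ : ℤ) : M) * w (quadType (σ 0) (σ 3)) := by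
  rw [Fin.sum_univ_three] at hw
  rcases quadType_perm σ with ⟨h, h1, h2⟩ | ⟨h, h1, h2⟩ <;> rw [h, h1, h2] <;>
    generalize quadType (σ 0) (σ 3) = q <;> fin_cases q <;>
    simp [sideWeight] <;> first | linear_combination hw | linear_combination -hw

theorem exists_perm_pair {a b : Fin 4} (h : a ≠ b) (ε : ℤˣ) :
    ∃ σ : Equiv.Perm (Fin 4), σ 0 = a ∧ σ 1 = b ∧ Equiv.Perm.sign σ = ε := by
  rcases Int.units_eq_one_or ε with rfl | rfl <;> revert a b <;> decide

theorem exists_perm_triple {a b c : Fin 4} (hab : a ≠ b) (hac : a ≠ c) (hbc : b ≠ c) :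
    ∃ σ : Equiv.Perm (Fin 4), σ 0 = a ∧ σ 1 = b ∧ σ 2 = c := by
  revert a b c; decide

theorem perm_ext_of_sign {σ τ : Equiv.Perm (Fin 4)} (h0 : σ 0 = τ 0) (h1 : σ 1 = τ 1)
    (hs : Equiv.Perm.sign σ = Equiv.Perm.sign τ) : σ = τ := by
  have key : ∀ ρ : Equiv.Perm (Fin 4), ρ 0 = 0 → ρ 1 = 1 → Equiv.Perm.sign ρ = 1 → ρ = 1 := by
    decide
  have := key (τ⁻¹ * σ) (by simp [h0]) (by simp [h1]) (by simp [hs])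
  rwa [inv_mul_eq_one, eq_comm] at this

theorem card_perm_pair (a b : Fin 4) :
    (Finset.univ.filter fun σ : Equiv.Perm (Fin 4) => (σ 0, σ 1) = (a, b)).card =
      if a = b then 0 else 2 := by
  revert a b; decide

theorem sum_perm_eq {M : Type*} [AddCommMonoid M] (h : Fin 4 → Fin 4 → M)
    (hd : ∀ a, h a a = 0) :
    ∑ σ : Equiv.Perm (Fin 4), h (σ 0) (σ 1) = 2 • ∑ a, ∑ b, h a b := by
  have h1 : ∑ σ : Equiv.Perm (Fin 4), h (σ 0) (σ 1) =
      ∑ x : Fin 4 × Fin 4, ∑ σ ∈ Finset.univ.filter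
        (fun σ : Equiv.Perm (Fin 4) => (σ 0, σ 1) = x), h x.1 x.2 := by
    rw [← Finset.sum_fiberwise (s := Finset.univ) (g := fun σ : Equiv.Perm (Fin 4) => (σ 0, σ 1))]
    refine Finset.sum_congr rfl fun x _ => Finset.sum_congr rfl fun σ hσ => ?_
    rw [← (Finset.mem_filter.1 hσ).2]
  rw [h1, ← Finset.univ_product_univ, Finset.sum_product, Finset.smul_sum]
  refine Finset.sum_congr rfl fun a _ => ?_
  rw [Finset.smul_sum]
  refine Finset.sum_congr rfl fun b _ => ?_
  rw [Finset.sum_const, card_perm_pair]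
  split_ifs with hab
  · subst hab; simp [hd]
  · rfl

/-- The sum over the sides of a triangle of a conserved flow with the primitive of the weights. -/
theorem sum_flow_sideWeight {M : Type*} [CommRing M] (w : Fin 3 → M) (hw : ∑ q, w q = 0)
    (k : Fin 4 → M) (σ : Equiv.Perm (Fin 4)) (h0 : k (σ 0) = 0) (hk : ∑ f, k f = 0) :
    ∑ f, k f * sideWeight w (quadType (σ 0) f) =
      ((Equiv.Perm.sign σ : ℤ) : M) * (k (σ 2) * w (quadType (σ 0) (σ 3)) -
        k (σ 3) * w (quadType (σ 0) (σ 2))) := by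
  have h1 := sideWeight_sub w hw σ
  have h2 := sideWeight_sub w hw (σ * Equiv.swap 2 3)
  have e2 : (Equiv.swap 2 3 : Equiv.Perm (Fin 4)) 2 = 3 := by decide
  have e3 : (Equiv.swap 2 3 : Equiv.Perm (Fin 4)) 3 = 2 := by decide
  have e1 : (Equiv.swap 2 3 : Equiv.Perm (Fin 4)) 1 = 1 := by decide
  have e0 : (Equiv.swap 2 3 : Equiv.Perm (Fin 4)) 0 = 0 := by decide
  have e4 : Equiv.Perm.sign (Equiv.swap 2 3 : Equiv.Perm (Fin 4)) = -1 := by decide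
  simp only [Equiv.Perm.mul_apply, e0, e1, e2, e3, Equiv.Perm.sign_mul, e4] at h2
  push_cast at h2
  rw [← Equiv.sum_comp σ, Fin.sum_univ_four] at hk ⊢
  rw [h0] at hk ⊢
  linear_combination k (σ 2) * h1 + k (σ 3) * h2 + sideWeight w (quadType (σ 0) (σ 1)) * hk

/-- Summation by parts: the flow is the boundary of the function `P` of the corners. -/
theorem sum_boundary_sideWeight {M : Type*} [CommRing M] (w : Fin 3 → M) (hw : ∑ q, w q = 0)
    (k P : Fin 4 → Fin 4 → M) (h0 : ∀ v, k v v = 0)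
    (hk : ∀ σ : Equiv.Perm (Fin 4), Equiv.Perm.sign σ = 1 →
      k (σ 0) (σ 1) = P (σ 0) (σ 2) - P (σ 0) (σ 3)) (v : Fin 4) :
    ∑ f, k v f * sideWeight w (quadType v f) =
      ∑ f, if v = f then 0 else P v f * w (quadType v f) := by
  have key : ∀ v : Fin 4, ∃ σ : Equiv.Perm (Fin 4), Equiv.Perm.sign σ = 1 ∧ σ 0 = v ∧
      quadType v (σ 1) = 0 ∧ quadType v (σ 2) = 1 ∧ quadType v (σ 3) = 2 := by decide
  obtain ⟨σ, hσ, rfl, t1, t2, t3⟩ := key v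
  let c : Equiv.Perm (Fin 4) := Equiv.swap 1 2 * Equiv.swap 2 3
  have c0 : c 0 = 0 := by decide
  have c1 : c 1 = 2 := by decide
  have c2 : c 2 = 3 := by decide
  have c3 : c 3 = 1 := by decide
  have cs : Equiv.Perm.sign c = 1 := by decide
  have k1 := hk σ hσ
  have k2 := hk (σ * c) (by simp [hσ, cs])
  have k3 := hk (σ * c * c) (by simp [hσ, cs])
  simp only [Equiv.Perm.mul_apply, c0, c1, c2, c3] at k2 k3
  rw [← Equiv.sum_comp σ, ← Equiv.sum_comp σ (fun f => if σ 0 = f then 0 else _),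
    Fin.sum_univ_four, Fin.sum_univ_four]
  rw [Fin.sum_univ_three] at hw
  simp only [EmbeddingLike.apply_eq_iff_eq]
  rw [t1, t2, t3, h0, k1, k2, k3]
  simp [sideWeight]
  linear_combination -P (σ 0) (σ 1) * hw

theorem filter_quadType_eq (σ : Equiv.Perm (Fin 4)) :
    ∃ x y : Fin 4 × Fin 4, x ≠ y ∧ (x = (σ 0, σ 1) ∨ x = (σ 1, σ 0)) ∧
      (y = (σ 2, σ 3) ∨ y = (σ 3, σ 2)) ∧
      (Finset.univ.filter fun x : Fin 4 × Fin 4 =>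
        x.1 < x.2 ∧ quadType x.1 x.2 = quadType (σ 0) (σ 1)) = {x, y} := by
  revert σ; decide

/-! ### Sums of edge functions over pairs of opposite edges. -/

namespace GluedTetrahedra

variable {ι : Type*} (T : GluedTetrahedra ι)

theorem edgeClass_symm (t : ι) (a b : Fin 4) : T.edgeClass t a b = T.edgeClass t b a :=
  Quot.sound (EdgeStep.flip t a b)

/-- The sum of a function of the edges over the two edges of type `q` of the tetrahedron `t`. -/
def typeSum {M : Type*} [AddCommMonoid M] (c : Quot T.EdgeStep → M) (t : ι) (q : Fin 3) : M :=
  ∑ x ∈ Finset.univ.filter (fun x : Fin 4 × Fin 4 => x.1 < x.2 ∧ quadType x.1 x.2 = q),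
    c (T.edgeClass t x.1 x.2)

theorem typeSum_perm {M : Type*} [AddCommMonoid M] (c : Quot T.EdgeStep → M) (t : ι)
    (σ : Equiv.Perm (Fin 4)) :
    T.typeSum c t (quadType (σ 0) (σ 1)) =
      c (T.edgeClass t (σ 0) (σ 1)) + c (T.edgeClass t (σ 2) (σ 3)) := by
  obtain ⟨x, y, hxy, hx, hy, h⟩ := filter_quadType_eq σ
  rw [typeSum, h, Finset.sum_pair hxy]
  congr 1
  · rcases hx with rfl | rfl
    · rfl
    · simp only; rw [edgeClass_symm]
  · rcases hy with rfl | rfl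
    · rfl
    · simp only; rw [edgeClass_symm]

theorem typeSum_add {M : Type*} [AddCommMonoid M] (c d : Quot T.EdgeStep → M) (t : ι) (q : Fin 3) :
    T.typeSum (fun e => c e + d e) t q = T.typeSum c t q + T.typeSum d t q :=
  Finset.sum_add_distrib

theorem typeSum_mul {M : Type*} [CommRing M] (m : M) (c : Quot T.EdgeStep → M) (t : ι)
    (q : Fin 3) : T.typeSum (fun e => m * c e) t q = m * T.typeSum c t q :=
  (Finset.mul_sum _ _ _).symm

theorem typeSum_sum {M κ : Type*} [AddCommMonoid M] (s : Finset κ) (c : κ → Quot T.EdgeStep → M)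
    (t : ι) (q : Fin 3) :
    T.typeSum (fun e => ∑ i ∈ s, c i e) t q = ∑ i ∈ s, T.typeSum (c i) t q :=
  Finset.sum_comm

theorem typeSum_congr {M : Type*} [AddCommMonoid M] {c d : Quot T.EdgeStep → M}
    (h : ∀ e : T.Edge, c e.1 = d e.1) (t : ι) (q : Fin 3) : T.typeSum c t q = T.typeSum d t q := by
  refine Finset.sum_congr rfl fun x hx => h ⟨_, t, x.1, x.2, ?_, rfl⟩
  exact (Finset.mem_filter.1 hx).2.1.ne

theorem typeSum_zero {M : Type*} [AddCommMonoid M] (c : Quot T.EdgeStep → M) (t : ι) :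
    T.typeSum c t 0 = c (T.edgeClass t 0 1) + c (T.edgeClass t 2 3) :=
  T.typeSum_perm c t 1

theorem typeSum_one {M : Type*} [AddCommMonoid M] (c : Quot T.EdgeStep → M) (t : ι) :
    T.typeSum c t 1 = c (T.edgeClass t 0 2) + c (T.edgeClass t 1 3) :=
  T.typeSum_perm c t (Equiv.swap 1 2)

theorem typeSum_two {M : Type*} [AddCommMonoid M] (c : Quot T.EdgeStep → M) (t : ι) :
    T.typeSum c t 2 = c (T.edgeClass t 0 3) + c (T.edgeClass t 1 2) := by
  rw [T.edgeClass_symm t 1 2]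
  exact T.typeSum_perm c t (Equiv.swap 1 3)

/-- Passes from corners of the link triangles to edges: an edge is seen as a corner from each of its
two ends, and both corners carry the same weight. -/
theorem sum_pairs_mul {M : Type*} [CommRing M] (P : Fin 4 → Fin 4 → M) (w : Fin 3 → M)
    (c : Quot T.EdgeStep → M) (t : ι)
    (h : ∀ a b, c (T.edgeClass t a b) = P a b + P b a) :
    ∑ a, ∑ b, (if a = b then 0 else P a b * w (quadType a b)) = ∑ q, T.typeSum c t q * w q := by
  simp only [Fin.sum_univ_three, typeSum_zero, typeSum_one, typeSum_two, h]
  simp [Fin.sum_univ_four, quadType]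
  ring

end GluedTetrahedra

namespace IdealTriangulation

variable {ι : Type*} (T : IdealTriangulation ι)

open Classical in
theorem incidence_eq_typeSum {M : Type*} [AddCommMonoidWithOne M] (e : T.Edge) (t : ι)
    (q : Fin 3) :
    ((T.incidence e t q : ℕ) : M) = T.typeSum (fun x => if x = e.1 then 1 else 0) t q := by
  rw [incidence, GluedTetrahedra.typeSum, Finset.sum_boole, Finset.filter_filter]
  simp only [and_assoc]

theorem sum_mul_incidence {M : Type*} [CommRing M] [Fintype T.Edge] (c : T.Edge → M)
    (d : Quot T.EdgeStep → M) (h : ∀ e : T.Edge, d e.1 = c e) (t : ι) (q : Fin 3) :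
    ∑ e, c e * (T.incidence e t q : M) = T.typeSum d t q := by
  classical
  simp only [incidence_eq_typeSum, ← GluedTetrahedra.typeSum_mul, ← GluedTetrahedra.typeSum_sum]
  refine GluedTetrahedra.typeSum_congr _ (fun e => ?_) t q
  rw [h, Finset.sum_eq_single e]
  · simp
  · intro b _ hb
    rw [if_neg fun h => hb (Subtype.ext h.symm), mul_zero]
  · simp

end IdealTriangulation

theorem filter_side_eq (σ : Equiv.Perm (Fin 4)) :
    (Finset.univ.filter fun x : Fin 4 × Fin 4 =>
        x.1 < x.2 ∧ x.1 ≠ σ 0 ∧ x.1 ≠ σ 1 ∧ x.2 ≠ σ 0 ∧ x.2 ≠ σ 1) = {(σ 2, σ 3)} ∨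
    (Finset.univ.filter fun x : Fin 4 × Fin 4 =>
        x.1 < x.2 ∧ x.1 ≠ σ 0 ∧ x.1 ≠ σ 1 ∧ x.2 ≠ σ 0 ∧ x.2 ≠ σ 1) = {(σ 3, σ 2)} := by
  revert σ; decide

namespace GluedTetrahedra

variable {ι : Type*} (T : GluedTetrahedra ι)

/-! ### Flags and turning around edges -/

theorem across_across (x : ι × Equiv.Perm (Fin 4)) (k : Fin 4) : T.across (T.across x k) k = x := by
  simp only [across, Equiv.Perm.mul_apply, T.nbr_nbr, T.perm_perm, inv_mul_cancel_left]

theorem across_mul (t : ι) (σ τ : Equiv.Perm (Fin 4)) (k : Fin 4) :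
    T.across (t, σ * τ) k = ((T.across (t, σ) (τ k)).1, (T.across (t, σ) (τ k)).2 * τ) := by
  simp [across, mul_assoc]

theorem sign_across (x : ι × Equiv.Perm (Fin 4)) (k : Fin 4) :
    Equiv.Perm.sign (T.across x k).2 = -Equiv.Perm.sign x.2 := by
  simp [across, T.perm_sign]

theorem across_ne (x : ι × Equiv.Perm (Fin 4)) (k : Fin 4) :
    ((T.across x k).1, (T.across x k).2 k) ≠ (x.1, x.2 k) := by
  intro h
  rw [Prod.mk.injEq] at h
  exact T.no_fold x.1 (x.2 k) h

/-- Turning around the first edge of a flag, as a permutation of the flags. -/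
def turnEquiv : Equiv.Perm (ι × Equiv.Perm (Fin 4)) where
  toFun := T.turn
  invFun x := T.across (x.1, x.2 * Equiv.swap 2 3) 2
  left_inv x := by
    simp only [turn, mul_assoc, Equiv.swap_mul_self, mul_one]
    exact T.across_across x 2
  right_inv x := by
    simp only [turn, T.across_across, mul_assoc, Equiv.swap_mul_self, mul_one]

theorem turnEquiv_apply (x : ι × Equiv.Perm (Fin 4)) : T.turnEquiv x = T.turn x := rfl

theorem turn_snd (x : ι × Equiv.Perm (Fin 4)) :
    (T.turn x).2 0 = (T.across x 2).2 0 ∧ (T.turn x).2 1 = (T.across x 2).2 1 ∧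
      (T.turn x).2 2 = (T.across x 2).2 3 ∧ (T.turn x).2 3 = (T.across x 2).2 2 := by
  have e0 : (Equiv.swap 2 3 : Equiv.Perm (Fin 4)) 0 = 0 := by decide
  have e1 : (Equiv.swap 2 3 : Equiv.Perm (Fin 4)) 1 = 1 := by decide
  simp [turn, e0, e1]

theorem turnEquiv_symm_apply (x : ι × Equiv.Perm (Fin 4)) :
    T.turnEquiv⁻¹ x = ((T.across x 3).1, (T.across x 3).2 * Equiv.swap 2 3) := by
  show T.across (x.1, x.2 * Equiv.swap 2 3) 2 = _
  rw [across_mul]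
  simp

theorem sign_turn (x : ι × Equiv.Perm (Fin 4)) :
    Equiv.Perm.sign (T.turn x).2 = Equiv.Perm.sign x.2 := by
  have : Equiv.Perm.sign (Equiv.swap 2 3 : Equiv.Perm (Fin 4)) = -1 := by decide
  simp [turn, sign_across, this]

theorem sign_turnEquiv_zpow (x : ι × Equiv.Perm (Fin 4)) (m : ℤ) :
    Equiv.Perm.sign ((T.turnEquiv ^ m) x).2 = Equiv.Perm.sign x.2 := by
  induction m with
  | zero => rfl
  | succ m ih => rw [add_comm, zpow_add, zpow_one, Equiv.Perm.mul_apply, turnEquiv_apply, sign_turn, ih]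
  | pred m ih =>
    rw [← ih, ← T.sign_turn, ← turnEquiv_apply, ← Equiv.Perm.mul_apply, ← zpow_one_add]
    congr 4
    ring

/-- The same oriented tetrahedron, seen from the other end of the first edge. -/
def flagFlip (x : ι × Equiv.Perm (Fin 4)) : ι × Equiv.Perm (Fin 4) :=
  (x.1, x.2 * (Equiv.swap 0 1 * Equiv.swap 2 3))

/-- Seen from the other end of the edge, the rotation goes the opposite way: the flip conjugates
turning to its inverse. -/
theorem turn_flagFlip_turn (x : ι × Equiv.Perm (Fin 4)) :
    T.turn (flagFlip (T.turn x)) = flagFlip x := by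
  have h : (Equiv.swap 2 3 * (Equiv.swap 0 1 * Equiv.swap 2 3) : Equiv.Perm (Fin 4)) 2 = 2 := by
    decide
  have h' : (Equiv.swap 2 3 * (Equiv.swap 0 1 * Equiv.swap 2 3) * Equiv.swap 2 3 :
      Equiv.Perm (Fin 4)) = Equiv.swap 0 1 * Equiv.swap 2 3 := by decide
  have h1 : T.across (flagFlip (T.turn x)) 2 =
      (x.1, x.2 * (Equiv.swap 2 3 * (Equiv.swap 0 1 * Equiv.swap 2 3))) := by
    rw [flagFlip, turn]
    simp only [mul_assoc]
    rw [across_mul, h, Prod.mk.eta, T.across_across]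
  rw [turn, h1]
  simp only [mul_assoc] at h' ⊢
  rw [h', flagFlip]

theorem zpow_flagFlip (m : ℤ) (x : ι × Equiv.Perm (Fin 4)) :
    (T.turnEquiv ^ m) (flagFlip ((T.turnEquiv ^ m) x)) = flagFlip x := by
  induction m generalizing x with
  | zero => rfl
  | succ m ih =>
    rw [zpow_add_one, Equiv.Perm.mul_apply, ← zpow_add_one, add_comm (m : ℤ) 1, zpow_one_add,
      Equiv.Perm.mul_apply, turnEquiv_apply, turnEquiv_apply, turn_flagFlip_turn, ih]
  | pred m ih =>
    have h (u : ι × Equiv.Perm (Fin 4)) :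
        T.turnEquiv⁻¹ (flagFlip (T.turnEquiv⁻¹ u)) = flagFlip u := by
      rw [Equiv.Perm.inv_eq_iff_eq, turnEquiv_apply, ← T.turn_flagFlip_turn (T.turnEquiv⁻¹ u),
        ← turnEquiv_apply, ← turnEquiv_apply, ← Equiv.Perm.mul_apply T.turnEquiv, mul_inv_cancel,
        Equiv.Perm.one_apply, turnEquiv_apply]
    rw [zpow_sub_one, Equiv.Perm.mul_apply, ← zpow_sub_one, sub_eq_neg_add, zpow_add,
      zpow_neg_one, Equiv.Perm.mul_apply, h, ih]

/-- A flip in the cyclic orbit of turns would be a reflection of a cycle, which has a fixed point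
either at a flag (`m` even) or between two consecutive flags (`m` odd). The former is absurd; in the
latter a face would be glued to itself. -/
theorem turnEquiv_zpow_ne_flagFlip (m : ℤ) (x : ι × Equiv.Perm (Fin 4)) :
    (T.turnEquiv ^ m) x ≠ flagFlip x := by
  intro h
  rcases Int.even_or_odd' m with ⟨j, rfl | rfl⟩
  · have h1 := T.zpow_flagFlip j x
    rw [← h, two_mul, zpow_add, Equiv.Perm.mul_apply] at h1
    have h2 := congrArg Prod.snd ((T.turnEquiv ^ j).injective h1)
    rw [flagFlip] at h2
    simp only [mul_eq_left] at h2
    exact absurd h2 (by decide)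
  · have h1 := T.zpow_flagFlip j x
    rw [← h, two_mul, add_assoc, zpow_add, Equiv.Perm.mul_apply] at h1
    have h2 := (T.turnEquiv ^ j).injective h1
    rw [add_comm, zpow_add, zpow_one, Equiv.Perm.mul_apply, turnEquiv_apply] at h2
    set y := (T.turnEquiv ^ j) x
    refine T.across_ne y 2 (Prod.ext (congrArg Prod.fst h2).symm ?_)
    have h3 := congrArg (fun z => z.2 3) h2
    simp only [(T.turn_snd y).2.2.2] at h3
    rw [← h3]
    have : (Equiv.swap 0 1 * Equiv.swap 2 3 : Equiv.Perm (Fin 4)) 3 = 2 := by decide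
    simp only [flagFlip, Equiv.Perm.mul_apply y.2, this]

theorem LinkStep.symm {p q : ι × Fin 4 × Fin 4} (h : T.LinkStep p q) : T.LinkStep q p := by
  obtain ⟨t, f, v, w, hv, hw⟩ := h
  have := LinkStep.glue (T := T) (T.nbr t f) (T.perm t f f) (T.perm t f v) (T.perm t f w)
    (by simpa using hv) (by simpa using hw)
  simpa [T.nbr_nbr, T.perm_perm] using this

theorem LinkStep.exists_zpow {p q : ι × Fin 4 × Fin 4} (h : T.LinkStep p q)
    (x : ι × Equiv.Perm (Fin 4)) (hx : (x.1, x.2 0, x.2 1) = p) :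
    ∃ m : ℤ, (((T.turnEquiv ^ m) x).1, ((T.turnEquiv ^ m) x).2 0, ((T.turnEquiv ^ m) x).2 1) = q := by
  obtain ⟨t, f, v, w, hv, hw⟩ := h
  simp only [Prod.mk.injEq] at hx
  obtain ⟨rfl, rfl, rfl⟩ := hx
  -- Only two faces contain the edge; they are crossed by one turn and by one inverse turn
  -- respectively.
  have hf : f = x.2 2 ∨ f = x.2 3 := by
    obtain ⟨u, rfl⟩ := x.2.surjective f
    have h0 : u ≠ 0 := fun h => hv (by rw [h])
    have h1 : u ≠ 1 := fun h => hw (by rw [h])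
    have : u = 2 ∨ u = 3 := by omega
    rcases this with rfl | rfl <;> simp
  have e0 : (Equiv.swap 2 3 : Equiv.Perm (Fin 4)) 0 = 0 := by decide
  have e1 : (Equiv.swap 2 3 : Equiv.Perm (Fin 4)) 1 = 1 := by decide
  rcases hf with rfl | rfl
  · refine ⟨1, ?_⟩
    rw [zpow_one, turnEquiv_apply, (T.turn_snd x).1, (T.turn_snd x).2.1]
    rfl
  · refine ⟨-1, ?_⟩
    rw [zpow_neg_one, turnEquiv_symm_apply]
    simp [across, e0, e1]

/-- Equivalent corners are connected by turning, which preserves the sign of a flag. An edge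
identified with its own reverse would put the flip of a flag into its orbit. -/
theorem linkVertex_ne_symm (t : ι) {a b : Fin 4} (hab : a ≠ b) :
    T.linkVertex t a b ≠ T.linkVertex t b a := by
  intro h
  have key : ∀ p q, Relation.EqvGen T.LinkStep p q →
      (∀ x : ι × Equiv.Perm (Fin 4), (x.1, x.2 0, x.2 1) = p → ∃ m : ℤ, (((T.turnEquiv ^ m) x).1,
        ((T.turnEquiv ^ m) x).2 0, ((T.turnEquiv ^ m) x).2 1) = q) ∧
      (∀ x : ι × Equiv.Perm (Fin 4), (x.1, x.2 0, x.2 1) = q → ∃ m : ℤ, (((T.turnEquiv ^ m) x).1,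
        ((T.turnEquiv ^ m) x).2 0, ((T.turnEquiv ^ m) x).2 1) = p) := by
    intro p q hpq
    induction hpq with
    | rel p q h => exact ⟨h.exists_zpow T, (h.symm T).exists_zpow T⟩
    | refl p => exact ⟨fun x hx => ⟨0, hx⟩, fun x hx => ⟨0, hx⟩⟩
    | symm p q _ ih => exact ih.symm
    | trans p q r _ _ ih1 ih2 =>
      refine ⟨fun x hx => ?_, fun x hx => ?_⟩
      · obtain ⟨m, hm⟩ := ih1.1 x hx
        obtain ⟨n, hn⟩ := ih2.1 _ hm
        exact ⟨n + m, by rw [zpow_add]; exact hn⟩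
      · obtain ⟨m, hm⟩ := ih2.2 x hx
        obtain ⟨n, hn⟩ := ih1.2 _ hm
        exact ⟨n + m, by rw [zpow_add]; exact hn⟩
  obtain ⟨σ, rfl, rfl, -⟩ := exists_perm_pair hab 1
  obtain ⟨m, hm⟩ := (key _ _ (Quot.eqvGen_exact h)).1 (t, σ) rfl
  refine T.turnEquiv_zpow_ne_flagFlip m (t, σ) ?_
  simp only [Prod.mk.injEq] at hm
  have e0 : (Equiv.swap 0 1 * Equiv.swap 2 3 : Equiv.Perm (Fin 4)) 0 = 1 := by decide
  have e1 : (Equiv.swap 0 1 * Equiv.swap 2 3 : Equiv.Perm (Fin 4)) 1 = 0 := by decide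
  have es : Equiv.Perm.sign (Equiv.swap 0 1 * Equiv.swap 2 3 : Equiv.Perm (Fin 4)) = 1 := by decide
  refine Prod.ext hm.1 (perm_ext_of_sign ?_ ?_ ?_)
  · rw [hm.2.1]; simp only [flagFlip, Equiv.Perm.mul_apply (σ), e0]
  · rw [hm.2.2]; simp only [flagFlip, Equiv.Perm.mul_apply (σ), e1]
  · rw [sign_turnEquiv_zpow]; simp only [flagFlip, Equiv.Perm.sign_mul σ, es, mul_one]

/-! ### The potential of an edge function on the sides of the link -/

theorem edgeClass_across (x : ι × Equiv.Perm (Fin 4)) {k u v : Fin 4} (hu : u ≠ k) (hv : v ≠ k) :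
    T.edgeClass (T.across x k).1 ((T.across x k).2 u) ((T.across x k).2 v) =
      T.edgeClass x.1 (x.2 u) (x.2 v) :=
  (Quot.sound (EdgeStep.glue x.1 (x.2 k) (x.2 u) (x.2 v) (by simpa using hu) (by simpa using hv))).symm

theorem edgeClass_turn (x : ι × Equiv.Perm (Fin 4)) :
    T.edgeClass (T.turn x).1 ((T.turn x).2 0) ((T.turn x).2 1) = T.edgeClass x.1 (x.2 0) (x.2 1) := by
  rw [(T.turn_snd x).1, (T.turn_snd x).2.1]
  exact T.edgeClass_across x (by decide) (by decide)

/-- The symplectic dual of the row of an edge function. -/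
def edgeDual {M : Type*} [AddCommGroup M] (c : Quot T.EdgeStep → M) (t : ι) (q : Fin 3) : M :=
  T.typeSum c t (q + 1) - T.typeSum c t (q + 2)

theorem sum_edgeDual {M : Type*} [AddCommGroup M] (c : Quot T.EdgeStep → M) (t : ι) :
    ∑ q, T.edgeDual c t q = 0 := by
  simp only [Fin.sum_univ_three, edgeDual]
  simp only [show (0 : Fin 3) + 1 = 1 from rfl, show (0 : Fin 3) + 2 = 2 from rfl,
    show (1 : Fin 3) + 1 = 2 from rfl, show (1 : Fin 3) + 2 = 0 from rfl,
    show (2 : Fin 3) + 1 = 0 from rfl, show (2 : Fin 3) + 2 = 1 from rfl]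
  abel

/-- The potential at the side on the face `f` of the triangle `(t, v)`. -/
def sidePotential {M : Type*} [AddCommGroup M] (c : Quot T.EdgeStep → M) (t : ι) (v f : Fin 4) : M :=
  ∑ x ∈ Finset.univ.filter (fun x : Fin 4 × Fin 4 =>
      x.1 < x.2 ∧ x.1 ≠ v ∧ x.1 ≠ f ∧ x.2 ≠ v ∧ x.2 ≠ f),
    (c (T.edgeClass t v x.1) + c (T.edgeClass t v x.2) - c (T.edgeClass t x.1 x.2))

theorem sidePotential_perm {M : Type*} [AddCommGroup M] (c : Quot T.EdgeStep → M) (t : ι)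
    (σ : Equiv.Perm (Fin 4)) : T.sidePotential c t (σ 0) (σ 1) =
      c (T.edgeClass t (σ 0) (σ 2)) + c (T.edgeClass t (σ 0) (σ 3)) -
        c (T.edgeClass t (σ 2) (σ 3)) := by
  rw [sidePotential]
  rcases filter_side_eq σ with h | h <;> rw [h, Finset.sum_singleton]
  rw [T.edgeClass_symm t (σ 3) (σ 2)]
  abel

/-- The potential involves only the three edges of the face `f`, and these are shared by both
tetrahedra. -/
theorem sidePotential_glue {M : Type*} [AddCommGroup M] (c : Quot T.EdgeStep → M) (t : ι)
    {v f : Fin 4} (hvf : v ≠ f) :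
    T.sidePotential c (T.nbr t f) (T.perm t f v) (T.perm t f f) = T.sidePotential c t v f := by
  obtain ⟨σ, rfl, rfl, -⟩ := exists_perm_pair hvf 1
  rw [sidePotential_perm, ← Equiv.Perm.mul_apply, ← Equiv.Perm.mul_apply, sidePotential_perm]
  have h := fun {u v : Fin 4} => T.edgeClass_across (t, σ) (k := 1) (u := u) (v := v)
  simp only [across] at h
  rw [h (by decide) (by decide), h (by decide) (by decide), h (by decide) (by decide)]

/-- The edge towards the corner between the two sides cancels, leaving the difference of the sums
over two pairs of opposite edges. Hence the dual of an edge function is an exact corner weight on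
the link. -/
theorem sidePotential_sub {M : Type*} [CommRing M] (c : Quot T.EdgeStep → M) (t : ι)
    (σ : Equiv.Perm (Fin 4)) :
    T.sidePotential c t (σ 0) (σ 2) - T.sidePotential c t (σ 0) (σ 1) =
      ((Equiv.Perm.sign σ : ℤ) : M) * T.edgeDual c t (quadType (σ 0) (σ 3)) := by
  have e0 : (Equiv.swap 1 2 : Equiv.Perm (Fin 4)) 0 = 0 := by decide
  have e1 : (Equiv.swap 1 2 : Equiv.Perm (Fin 4)) 1 = 2 := by decide
  have e2 : (Equiv.swap 1 2 : Equiv.Perm (Fin 4)) 2 = 1 := by decide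
  have e3 : (Equiv.swap 1 2 : Equiv.Perm (Fin 4)) 3 = 3 := by decide
  have h1 := T.sidePotential_perm c t σ
  have h2 := T.sidePotential_perm c t (σ * Equiv.swap 1 2)
  have t1 := T.typeSum_perm c t σ
  have t2 := T.typeSum_perm c t (σ * Equiv.swap 1 2)
  simp only [Equiv.Perm.mul_apply, e0, e1, e2, e3] at h2 t2
  rw [edgeDual]
  rcases quadType_perm σ with ⟨h, q1, q2⟩ | ⟨h, q1, q2⟩ <;> rw [← q1, ← q2, h, h1, h2, t1, t2] <;>
    push_cast <;> ring

/-- The factor `4` is the number of flags of a tetrahedron whose first two vertices span a given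
edge: two orders of the ends and two orders of the remaining vertices. -/
theorem sum_incidence_eq_sum_flags [Fintype ι] [DecidableEq (Quot T.EdgeStep)] {M : Type*}
    [CommRing M] (e : Quot T.EdgeStep) (h : ι → Fin 3 → M) :
    4 * ∑ t, ∑ q, T.typeSum (fun x => if x = e then (1 : M) else 0) t q * h t q =
      ∑ x : ι × Equiv.Perm (Fin 4),
        (if T.edgeClass x.1 (x.2 0) (x.2 1) = e then h x.1 (quadType (x.2 0) (x.2 1)) else 0) := by
  rw [Fintype.sum_prod_type, Finset.mul_sum]
  refine Finset.sum_congr rfl fun t _ => ?_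
  have h1 := sum_perm_eq (fun a b => if a = b then (0 : M) else
    (if T.edgeClass t a b = e then (1 : M) else 0) * h t (quadType a b)) (by simp)
  have h2 : ∑ σ : Equiv.Perm (Fin 4), (if T.edgeClass t (σ 0) (σ 1) = e then
      h t (quadType (σ 0) (σ 1)) else 0) = ∑ σ : Equiv.Perm (Fin 4), (if σ 0 = σ 1 then (0 : M) else
    (if T.edgeClass t (σ 0) (σ 1) = e then (1 : M) else 0) * h t (quadType (σ 0) (σ 1))) := by
    refine Finset.sum_congr rfl fun σ _ => ?_
    rw [if_neg (σ.injective.ne (show (0 : Fin 4) ≠ 1 by decide)), ite_mul, one_mul, zero_mul]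
  rw [h2, h1, T.sum_pairs_mul _ _
    (fun x => (if x = e then (1 : M) else 0) + (if x = e then (1 : M) else 0)) t
    (fun a b => by rw [T.edgeClass_symm t b a])]
  simp only [typeSum_add, two_nsmul, add_mul, Finset.sum_add_distrib]
  ring

/-- The rows of the edges are orthogonal to each other. -/
theorem sum_typeSum_mul_edgeDual [Fintype ι] [DecidableEq (Quot T.EdgeStep)]
    (e : Quot T.EdgeStep) (c : Quot T.EdgeStep → ℤ) :
    ∑ t, ∑ q, T.typeSum (fun x => if x = e then (1 : ℤ) else 0) t q * T.edgeDual c t q = 0 := by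
  have h := T.sum_incidence_eq_sum_flags e (T.edgeDual c)
  -- Around an edge the corner weights are differences of the side potential, so the sum over flags
  -- telescopes along the permutation `turnEquiv`.
  let F : ι × Equiv.Perm (Fin 4) → ℤ := fun x =>
    if T.edgeClass x.1 (x.2 0) (x.2 1) = e then
      (Equiv.Perm.sign x.2 : ℤ) * T.sidePotential c x.1 (x.2 0) (x.2 3) else 0
  have h1 (x : ι × Equiv.Perm (Fin 4)) : (if T.edgeClass x.1 (x.2 0) (x.2 1) = e then
      T.edgeDual c x.1 (quadType (x.2 0) (x.2 1)) else 0) = F x - F (T.turnEquiv x) := by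
    simp only [F, turnEquiv_apply, T.edgeClass_turn, T.sign_turn]
    split_ifs
    · have hs := T.sidePotential_sub c x.1 (x.2 * (Equiv.swap 1 2 * Equiv.swap 2 3))
      have f0 : (Equiv.swap 1 2 * Equiv.swap 2 3 : Equiv.Perm (Fin 4)) 0 = 0 := by decide
      have f1 : (Equiv.swap 1 2 * Equiv.swap 2 3 : Equiv.Perm (Fin 4)) 1 = 2 := by decide
      have f2 : (Equiv.swap 1 2 * Equiv.swap 2 3 : Equiv.Perm (Fin 4)) 2 = 3 := by decide
      have f3 : (Equiv.swap 1 2 * Equiv.swap 2 3 : Equiv.Perm (Fin 4)) 3 = 1 := by decide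
      have fs : Equiv.Perm.sign (Equiv.swap 1 2 * Equiv.swap 2 3 : Equiv.Perm (Fin 4)) = 1 := by
        decide
      simp only [Equiv.Perm.mul_apply x.2, f0, f1, f2, f3, Equiv.Perm.sign_mul x.2, fs, mul_one,
        Int.cast_id] at hs
      have h2 : T.sidePotential c (T.turn x).1 ((T.turn x).2 0) ((T.turn x).2 3) =
          T.sidePotential c x.1 (x.2 0) (x.2 2) := by
        rw [(T.turn_snd x).1, (T.turn_snd x).2.2.2]
        exact T.sidePotential_glue c x.1 (by simp)
      rw [h2, ← mul_sub, hs, ← mul_assoc]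
      rcases Int.units_eq_one_or (Equiv.Perm.sign x.2) with hx | hx <;> simp [hx]
    · rfl
  simp only [h1, Finset.sum_sub_distrib, Equiv.sum_comp T.turnEquiv F, sub_self] at h
  linarith

end GluedTetrahedra

namespace IdealTriangulation

/-! ### The number of edges -/

variable {ι : Type*} (T : IdealTriangulation ι)

/-- The two vertices of the link at the ends of an edge. -/
def edgeEnds : Quot T.EdgeStep → Sym2 (Quot T.LinkStep) :=
  Quot.lift (fun x => s(T.linkVertex x.1 x.2.1 x.2.2, T.linkVertex x.1 x.2.2 x.2.1)) (by
    rintro _ _ (⟨t, a, b⟩ | ⟨t, f, a, b, ha, hb⟩)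
    · exact Sym2.eq_swap
    · exact congrArg₂ (fun x y => s(x, y)) (Quot.sound (.glue t f a b ha hb))
        (Quot.sound (.glue t f b a hb ha)))

/-- The ideal vertex on which a vertex of the link lies. -/
def linkCusp : Quot T.LinkStep → T.Cusp :=
  Quot.lift (fun x => T.cusp x.1 x.2.1) (by
    rintro _ _ ⟨t, f, v, w, hv, hw⟩
    exact Quot.sound (.glue t f v hv))

/-- The edge at a vertex of the link. -/
def linkEdge : Quot T.LinkStep → Quot T.EdgeStep :=
  Quot.lift (fun x => T.edgeClass x.1 x.2.1 x.2.2) (by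
    rintro _ _ ⟨t, f, v, w, hv, hw⟩
    exact Quot.sound (.glue t f v w hv hw))

instance [Finite ι] : Finite T.Edge := Subtype.finite
instance [Finite ι] : Finite T.Cusp := Quot.finite _

/-- Vanishing Euler characteristic gives each cusp half as many link vertices as triangles. With `4
n` triangles there are `2 n` link vertices, and each edge has exactly two of them as ends, distinct
by `linkVertex_ne_symm`. -/
theorem card_edge [Finite ι] : Nat.card T.Edge = Nat.card ι := by
  let V := {x : Quot T.LinkStep // ∃ t v w, v ≠ w ∧ T.linkVertex t v w = x}
  have h1 : 2 * Nat.card V = 4 * Nat.card ι := by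
    have e1 : (Σ c : T.Cusp, {x : Quot T.LinkStep // ∃ t v w, v ≠ w ∧ T.cusp t v = c ∧
        T.linkVertex t v w = x}) ≃ V :=
      { toFun := fun x => ⟨x.2.1, by obtain ⟨t, v, w, h, -, h'⟩ := x.2.2; exact ⟨t, v, w, h, h'⟩⟩
        invFun := fun x => ⟨T.linkCusp x.1, x.1, by
          obtain ⟨t, v, w, h, h'⟩ := x.2; exact ⟨t, v, w, h, by rw [← h']; rfl, h'⟩⟩
        left_inv := by
          rintro ⟨c, _, t, v, w, h, rfl, rfl⟩
          rfl
        right_inv := fun x => rfl }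
    have e2 := Equiv.sigmaFiberEquiv fun x : ι × Fin 4 => T.cusp x.1 x.2
    have := Fintype.ofFinite T.Cusp
    rw [← Nat.card_congr e1, Nat.card_sigma, Finset.mul_sum,
      Finset.sum_congr rfl fun c _ => T.torus c, ← Nat.card_sigma, Nat.card_congr e2,
      Nat.card_prod, Nat.card_eq_fintype_card (α := Fin 4), Fintype.card_fin, mul_comm]
  have h2 : Nat.card V = 2 * Nat.card T.Edge := by
    let p : V → T.Edge := fun x => ⟨T.linkEdge x.1, by
      obtain ⟨t, v, w, h, h'⟩ := x.2
      exact ⟨t, v, w, h, by rw [← h']; rfl⟩⟩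
    have := Fintype.ofFinite T.Edge
    rw [← Nat.card_congr (Equiv.sigmaFiberEquiv p), Nat.card_sigma,
      Finset.sum_congr rfl (g := fun _ => 2)]
    · simp [mul_comm]
    rintro ⟨_, t, a, b, hab, rfl⟩ -
    rw [Nat.card_eq_two_iff]
    refine ⟨⟨⟨T.linkVertex t a b, t, a, b, hab, rfl⟩, Subtype.ext rfl⟩,
      ⟨⟨T.linkVertex t b a, t, b, a, hab.symm, rfl⟩, Subtype.ext (T.edgeClass_symm t b a)⟩, ?_, ?_⟩
    · intro h
      exact T.linkVertex_ne_symm t hab (congrArg (fun x => x.1.1) h)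
    · refine Set.eq_univ_of_forall ?_
      rintro ⟨⟨_, s, v, w, hvw, rfl⟩, hx⟩
      have h3 := congrArg (fun e => T.edgeEnds e.1) hx
      have h4 : s(T.linkVertex s v w, T.linkVertex s w v) =
        s(T.linkVertex t a b, T.linkVertex t b a) := h3
      rw [Sym2.eq_iff] at h4
      rcases h4 with ⟨h4, -⟩ | ⟨h4, -⟩
      · left
        exact Subtype.ext (Subtype.ext h4)
      · right
        exact Subtype.ext (Subtype.ext h4)
  omega

end IdealTriangulation

namespace IdealTriangulation

variable {ι : Type*} (T : IdealTriangulation ι)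

/-! ### The rank of the edge equations -/

/-- The row of an integral combination of edges. -/
def rowOf (c : Quot T.EdgeStep → ℤ) : ι → ℤ × ℤ :=
  fun t => (T.typeSum c t 0 - T.typeSum c t 1, T.typeSum c t 2 - T.typeSum c t 1)

theorem sum_smul_edgeRow [Fintype T.Edge] (c : T.Edge → ℤ) (d : Quot T.EdgeStep → ℤ)
    (h : ∀ e : T.Edge, d e.1 = c e) : ∑ e, c e • T.edgeRow e = T.rowOf d := by
  funext t
  simp only [rowOf, Finset.sum_apply, ← T.sum_mul_incidence c d h, ← Finset.sum_sub_distrib,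
    ← mul_sub]
  ext
  · simp [Prod.fst_sum, edgeRow]
  · simp [Prod.snd_sum, edgeRow]

/-- The sum of a function of the ideal vertices over the ends of an edge. -/
def cuspSum (l : T.Cusp → ℤ) : Quot T.EdgeStep → ℤ :=
  Quot.lift (fun x => l (T.cusp x.1 x.2.1) + l (T.cusp x.1 x.2.2)) (by
    rintro _ _ (⟨t, a, b⟩ | ⟨t, f, a, b, ha, hb⟩)
    · exact add_comm _ _
    · exact congrArg₂ (fun x y => l x + l y) (Quot.sound (.glue t f a ha))
        (Quot.sound (.glue t f b hb)))

theorem cuspSum_edgeClass (l : T.Cusp → ℤ) (t : ι) (a b : Fin 4) :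
    T.cuspSum l (T.edgeClass t a b) = l (T.cusp t a) + l (T.cusp t b) := rfl

/-- Each pair of opposite edges contains every vertex of the tetrahedron once, so its sum does not
depend on the type. -/
theorem rowOf_cuspSum (l : T.Cusp → ℤ) : T.rowOf (T.cuspSum l) = 0 := by
  funext t
  simp only [rowOf, GluedTetrahedra.typeSum_zero, GluedTetrahedra.typeSum_one,
    GluedTetrahedra.typeSum_two, cuspSum_edgeClass]
  ext
  · simp only [Pi.zero_apply, Prod.fst_zero]; ring
  · simp only [Pi.zero_apply, Prod.snd_zero]; ring

/-- The functions `cuspSum` embed the functions on the cusps into the relations between the edge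
rows, and there are as many edges as tetrahedra. -/
theorem finrank_range_edgeRow [Finite ι] [Fintype T.Edge] :
    Module.finrank ℤ (Fintype.linearCombination ℤ T.edgeRow).range + Nat.card T.Cusp ≤
      Nat.card ι := by
  let D := Fintype.linearCombination ℤ T.edgeRow
  have h1 := Submodule.finrank_quotient_add_finrank D.ker
  rw [D.quotKerEquivRange.finrank_eq, Module.finrank_fintype_fun_eq_card,
    ← Nat.card_eq_fintype_card, T.card_edge] at h1
  have := Fintype.ofFinite T.Cusp
  let L : (T.Cusp → ℤ) →ₗ[ℤ] D.ker :=
    { toFun := fun l => ⟨fun e => T.cuspSum l e.1, by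
        rw [LinearMap.mem_ker, Fintype.linearCombination_apply,
          T.sum_smul_edgeRow _ (T.cuspSum l) fun e => rfl, rowOf_cuspSum]⟩
      map_add' := fun l m => by
        refine Subtype.ext (funext fun e => ?_)
        obtain ⟨_, t, a, b, hab, rfl⟩ := e
        exact add_add_add_comm _ _ _ _
      map_smul' := fun r l => by
        refine Subtype.ext (funext fun e => ?_)
        obtain ⟨_, t, a, b, hab, rfl⟩ := e
        exact (mul_add _ _ _).symm }
  have hL : Function.Injective L := by
    rw [← LinearMap.ker_eq_bot, LinearMap.ker_eq_bot']
    intro l hl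
    funext x
    obtain ⟨⟨t, v⟩, rfl⟩ := Quot.exists_rep x
    have h2 (a b : Fin 4) (hab : a ≠ b) : l (T.cusp t a) + l (T.cusp t b) = 0 :=
      congrFun (congrArg Subtype.val hl) ⟨T.edgeClass t a b, t, a, b, hab, rfl⟩
    -- Injectivity comes from one triangle: if the values at three vertices have pairwise sums zero,
    -- they all vanish.
    have h3 : ∀ v : Fin 4, ∃ a b, v ≠ a ∧ v ≠ b ∧ a ≠ b := by decide
    obtain ⟨a, b, hva, hvb, hab⟩ := h3 v
    have h4 := h2 v a hva
    have h5 := h2 v b hvb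
    have h6 := h2 a b hab
    show l (T.cusp t v) = 0
    omega
  have h3 := LinearMap.finrank_le_finrank_of_injective hL
  rw [Module.finrank_fintype_fun_eq_card, ← Nat.card_eq_fintype_card] at h3
  show Module.finrank ℤ D.range + _ ≤ _
  omega

/-- The chosen edges are independent and as many as the rank permits, one curve per cusp making up
the rest of the square matrix. One more edge row therefore creates a relation, in which its
coefficient cannot vanish. -/
theorem exists_smul_edgeRow_mem_span [Fintype ι] {κ : Type*} (α : T.CurveSystem κ)
    (c : T.Choice κ) (e : T.Edge) :
    ∃ m : ℤ, m ≠ 0 ∧ m • T.edgeRow e ∈ Submodule.span ℤ (T.edgeRow '' c.edges) := by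
  classical
  have := Fintype.ofFinite T.Edge
  have := Fintype.ofFinite c.edges
  have hκ : Finite κ := Finite.of_injective (fun i : κ => c.row.symm (Sum.inr i))
    (c.row.symm.injective.comp Sum.inr_injective)
  have h1 : Nat.card c.edges + Nat.card T.Cusp = Nat.card ι := by
    rw [Nat.card_congr c.row, Nat.card_sum, Nat.card_congr (Equiv.ofBijective _ α.bijective)]
  have h2 := T.finrank_range_edgeRow
  let R := (Fintype.linearCombination ℤ T.edgeRow).range
  have hR (e : T.Edge) : T.edgeRow e ∈ R := ⟨Pi.single e 1, by simp⟩
  let v : Option c.edges → R := fun o => o.elim ⟨_, hR e⟩ fun b => ⟨_, hR b.1⟩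
  have h3 : ¬ LinearIndependent ℤ v := by
    intro h
    have := h.fintype_card_le_finrank
    rw [Fintype.card_option, ← Nat.card_eq_fintype_card] at this
    change _ ≤ Module.finrank ℤ (Fintype.linearCombination ℤ T.edgeRow).range at this
    omega
  obtain ⟨g, hg, hne⟩ := Fintype.not_linearIndependent_iff.1 h3
  rw [Fintype.sum_option] at hg
  have hg' := congrArg Subtype.val hg
  simp only [v, Option.elim, Submodule.coe_add, Submodule.coe_smul, Submodule.coe_sum,
    Submodule.coe_zero] at hg'
  refine ⟨g none, fun h0 => ?_, ?_⟩
  · rw [h0, zero_smul, zero_add] at hg'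
    have h4 := Fintype.linearIndependent_iff.1 c.independent (fun b => g (some b)) hg'
    obtain ⟨_ | b, hb⟩ := hne
    · exact hb h0
    · exact hb (h4 b)
  · rw [add_eq_zero_iff_eq_neg] at hg'
    rw [hg']
    exact neg_mem (sum_mem fun b _ => Submodule.smul_mem _ _
      (Submodule.subset_span ⟨b.1, b.2, rfl⟩))

end IdealTriangulation

/-! ### Flows of normal curves through the sides of the link. -/

namespace GluedTetrahedra

variable {ι : Type*} (T : GluedTetrahedra ι)

/-- The side of a triangle of the link that is glued to the side on `f` of the triangle `(t, v)`. -/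
def glueSide (s : ι × Fin 4 × Fin 4) : ι × Fin 4 × Fin 4 :=
  (T.nbr s.1 s.2.2, T.perm s.1 s.2.2 s.2.1, T.perm s.1 s.2.2 s.2.2)

theorem glueSide_glueSide (s : ι × Fin 4 × Fin 4) : T.glueSide (T.glueSide s) = s := by
  simp [glueSide, T.nbr_nbr, T.perm_perm]

theorem glueSide_eq_iff (s u : ι × Fin 4 × Fin 4) : T.glueSide s = u ↔ s = T.glueSide u :=
  ⟨fun h => by rw [← h, glueSide_glueSide], fun h => by rw [h, glueSide_glueSide]⟩

end GluedTetrahedra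

namespace IdealTriangulation

variable {ι : Type*} (T : IdealTriangulation ι)

/-- The edge function that sums a function of the vertices of the link over both ends. -/
def linkSum {M : Type*} [AddCommMonoid M] (p : Quot T.LinkStep → M) : Quot T.EdgeStep → M :=
  Quot.lift (fun x => p (T.linkVertex x.1 x.2.1 x.2.2) + p (T.linkVertex x.1 x.2.2 x.2.1)) (by
    rintro _ _ (⟨t, a, b⟩ | ⟨t, f, a, b, ha, hb⟩)
    · exact add_comm _ _
    · exact congrArg₂ (fun x y => p x + p y) (Quot.sound (.glue t f a b ha hb))
        (Quot.sound (.glue t f b a hb ha)))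

/-- Summation by parts for a flow that bounds a combination of vertices of the link. -/
theorem sum_flow_boundary {M : Type*} [CommRing M] (w : Fin 3 → M) (hw : ∑ q, w q = 0)
    (p : Quot T.LinkStep → M) (t : ι) (k : Fin 4 → Fin 4 → M) (h0 : ∀ v, k v v = 0)
    (hk : ∀ σ : Equiv.Perm (Fin 4), Equiv.Perm.sign σ = 1 →
      k (σ 0) (σ 1) = p (T.linkVertex t (σ 0) (σ 2)) - p (T.linkVertex t (σ 0) (σ 3))) :
    ∑ v, ∑ f, k v f * sideWeight w (quadType v f) =
      ∑ q, T.typeSum (T.linkSum p) t q * w q := by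
  rw [← T.sum_pairs_mul (fun a b => p (T.linkVertex t a b)) w (T.linkSum p) t fun a b => rfl]
  exact Finset.sum_congr rfl fun v _ =>
    sum_boundary_sideWeight w hw k (fun a b => p (T.linkVertex t a b)) h0 hk v

namespace NormalCurve

variable {T} (γ : NormalCurve T)

/-- The side through which the curve leaves the triangle of the arc `i`. -/
def exitSide (i : Fin (γ.m + 1)) : ι × Fin 4 × Fin 4 :=
  ((γ.arc i).1, (γ.arc i).2 0, (γ.arc i).2 2)

/-- The side through which the curve enters the triangle of the arc `i`. -/
def enterSide (i : Fin (γ.m + 1)) : ι × Fin 4 × Fin 4 :=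
  ((γ.arc i).1, (γ.arc i).2 0, (γ.arc i).2 1)

theorem enterSide_succ (i : Fin (γ.m + 1)) : γ.enterSide (i + 1) = T.glueSide (γ.exitSide i) := by
  simp only [enterSide, γ.tet_succ, γ.vertex_succ, γ.side_succ]
  rfl

open Classical in
theorem crossing_eq (t : ι) (v f : Fin 4) :
    γ.crossing t v f = ∑ i, ((if γ.exitSide i = (t, v, f) then (1 : ℤ) else 0) -
      (if γ.enterSide i = (t, v, f) then (1 : ℤ) else 0)) := by
  simp only [crossing, exitSide, enterSide, Prod.mk.injEq]

theorem sum_succ {M : Type*} [AddCommMonoid M] (f : Fin (γ.m + 1) → M) :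
    ∑ i, f (i + 1) = ∑ i, f i :=
  Equiv.sum_comp (Equiv.addRight (1 : Fin (γ.m + 1))) f

theorem crossing_self (t : ι) (v : Fin 4) : γ.crossing t v v = 0 := by
  refine Finset.sum_eq_zero fun i _ => ?_
  have h (k : Fin 4) (hk : k ≠ 0) :
      ¬ ((γ.arc i).1 = t ∧ (γ.arc i).2 0 = v ∧ (γ.arc i).2 k = v) := by
    rintro ⟨-, h1, h2⟩
    exact hk ((γ.arc i).2.injective (h2.trans h1.symm))
  rw [if_neg (h 2 (by decide)), if_neg (h 1 (by decide)), sub_zero]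

theorem sum_crossing (t : ι) (v : Fin 4) : ∑ f, γ.crossing t v f = 0 := by
  classical
  simp only [crossing]
  rw [Finset.sum_comm]
  refine Finset.sum_eq_zero fun i _ => ?_
  rw [Finset.sum_sub_distrib]
  by_cases h : (γ.arc i).1 = t ∧ (γ.arc i).2 0 = v
  · simp [h.1, h.2]
  · have (k f : Fin 4) : ¬ ((γ.arc i).1 = t ∧ (γ.arc i).2 0 = v ∧ (γ.arc i).2 k = f) :=
      fun h' => h ⟨h'.1, h'.2.1⟩
    simp [this]

theorem crossing_glue (t : ι) (v f : Fin 4) :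
    γ.crossing (T.nbr t f) (T.perm t f v) (T.perm t f f) = -γ.crossing t v f := by
  classical
  rw [crossing_eq, crossing_eq, Finset.sum_sub_distrib, Finset.sum_sub_distrib, neg_sub]
  have h : ((T.nbr t f, T.perm t f v, T.perm t f f) : ι × Fin 4 × Fin 4) =
    T.glueSide (t, v, f) := rfl
  rw [h]
  congr 1
  · rw [← γ.sum_succ (fun i => if γ.enterSide i = (t, v, f) then (1 : ℤ) else 0)]
    simp only [enterSide_succ, GluedTetrahedra.glueSide_eq_iff]
  · rw [← γ.sum_succ]
    simp only [enterSide_succ, (Function.LeftInverse.injective T.glueSide_glueSide).eq_iff]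

/-- The weight of the corner cut off by an arc is the value of the primitive `sideWeight` at its
exit minus that at its entry. Thus, against weights of sum zero, a curve matters only through its
crossing numbers. -/
theorem sum_turning_mul {M : Type*} [CommRing M] (t : ι) (w : Fin 3 → M) (hw : ∑ q, w q = 0) :
    ∑ q, (γ.turning t q : M) * w q =
      ∑ v, ∑ f, (γ.crossing t v f : M) * sideWeight w (quadType v f) := by
  classical
  simp only [turning, crossing, Int.cast_sum, Finset.sum_mul]
  rw [Finset.sum_comm]
  simp only [Finset.sum_comm (s := (Finset.univ : Finset (Fin 4)))
    (t := (Finset.univ : Finset (Fin (γ.m + 1))))]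
  refine Finset.sum_congr rfl fun i _ => ?_
  by_cases h : (γ.arc i).1 = t
  · have h1 := sideWeight_sub w hw (γ.arc i).2
    simp only [h, true_and, Int.cast_sub, Int.cast_ite, Int.cast_one, Int.cast_zero, sub_mul,
      ite_mul, one_mul, zero_mul, Finset.sum_sub_distrib]
    rw [Finset.sum_eq_single (quadType ((γ.arc i).2 0) ((γ.arc i).2 3)), if_pos rfl, ← h1]
    · congr 1
      · rw [Finset.sum_eq_single ((γ.arc i).2 0), Finset.sum_eq_single ((γ.arc i).2 2)] <;>
          simp +contextual [eq_comm]
      · rw [Finset.sum_eq_single ((γ.arc i).2 0), Finset.sum_eq_single ((γ.arc i).2 1)] <;>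
          simp +contextual [eq_comm]
    · intro q _ hq
      rw [if_neg hq.symm]
    · simp
  · simp [h]

theorem sum_sum_turning [Fintype ι] {M : Type*} [CommRing M] (G : ι → Fin 3 → M) :
    ∑ t, ∑ q, (γ.turning t q : M) * G t q =
      ∑ i, ((Equiv.Perm.sign (γ.arc i).2 : ℤ) : M) *
        G (γ.arc i).1 (quadType ((γ.arc i).2 0) ((γ.arc i).2 3)) := by
  classical
  simp only [turning, Int.cast_sum, Finset.sum_mul]
  simp only [Finset.sum_comm (t := (Finset.univ : Finset (Fin (γ.m + 1))))]
  refine Finset.sum_congr rfl fun i _ => ?_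
  rw [Finset.sum_eq_single (γ.arc i).1,
    Finset.sum_eq_single (quadType ((γ.arc i).2 0) ((γ.arc i).2 3))]
  · simp
  · intro q _ hq
    simp [hq.symm]
  · simp
  · intro t _ ht
    simp [ht.symm]
  · simp

/-- Corner weights with a potential on the sides of the link are orthogonal to all curves. -/
theorem sum_turning_eq_zero [Fintype ι] (G : ι → Fin 3 → ℤ) (φ : ι → Fin 4 → Fin 4 → ℤ)
    (hφ : ∀ t v f, v ≠ f → φ (T.nbr t f) (T.perm t f v) (T.perm t f f) = φ t v f)
    (hG : ∀ t, ∀ σ : Equiv.Perm (Fin 4), φ t (σ 0) (σ 2) - φ t (σ 0) (σ 1) =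
      (Equiv.Perm.sign σ : ℤ) * G t (quadType (σ 0) (σ 3))) :
    ∑ t, ∑ q, γ.turning t q * G t q = 0 := by
  have h := γ.sum_sum_turning G
  simp only [Int.cast_id, ← hG, Finset.sum_sub_distrib] at h
  rw [h, ← γ.sum_succ (fun i => φ (γ.arc i).1 ((γ.arc i).2 0) ((γ.arc i).2 1)), sub_eq_zero]
  refine Finset.sum_congr rfl fun i _ => ?_
  have h1 := γ.enterSide_succ i
  simp only [enterSide, exitSide, GluedTetrahedra.glueSide, Prod.mk.injEq] at h1
  rw [h1.1, h1.2.1, h1.2.2, hφ _ _ _ (by simp)]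

/-- The dual has the side potential as a primitive, and the increments of a primitive cancel along a
closed curve. -/
theorem sum_turning_edgeDual [Fintype ι] (c : Quot T.EdgeStep → ℤ) :
    ∑ t, ∑ q, γ.turning t q * T.edgeDual c t q = 0 :=
  γ.sum_turning_eq_zero _ (T.sidePotential c) (fun t _ _ h => T.sidePotential_glue c t h)
    fun t σ => T.sidePotential_sub c t σ

/-- Summation by parts moves a bounding 2-chain from the sides to the link vertices, hence to the
edges: the equation of a trivial curve is a combination of edge equations. -/
theorem IsTrivial.sum_turning (h : γ.IsTrivial) :
    ∃ c : Quot T.EdgeStep → ℤ, ∀ t (w : Fin 3 → ℤ), ∑ q, w q = 0 →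
      ∑ q, γ.turning t q * w q = ∑ q, T.typeSum c t q * w q := by
  obtain ⟨p, hp⟩ := h
  refine ⟨T.linkSum p, fun t w hw => ?_⟩
  have h1 := γ.sum_turning_mul t w hw
  simp only [Int.cast_id] at h1
  rw [h1]
  exact T.sum_flow_boundary w hw p t (fun v f => γ.crossing t v f) (γ.crossing_self t)
    fun σ hσ => hp (t, σ) hσ

end NormalCurve

end IdealTriangulation

/-! ### Potentials on graphs -/

theorem sum_range_shift {f : ℕ → ℤ} {k : ℕ} (hf : ∀ i, f (i + k) = f i) (a : ℕ) :
    ∑ n ∈ Finset.range k, f (a + n) = ∑ n ∈ Finset.range k, f n := by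
  induction a with
  | zero => simp
  | succ a ih =>
    have h1 := Finset.sum_range_succ (fun n => f (a + n)) k
    rw [Finset.sum_range_succ', hf, add_zero] at h1
    rw [← ih, ← add_right_cancel h1]
    exact Finset.sum_congr rfl fun n _ => by rw [add_right_comm, add_assoc]

/-- A weight on the edges of a graph is a coboundary if it vanishes on all closed walks that visit
every vertex at most once and do not turn back. -/
theorem exists_potential {V E : Type*} (src tgt : E → V) (wt : E → ℤ) (rev : E → E)
    (hsrc : ∀ d, src (rev d) = tgt d) (htgt : ∀ d, tgt (rev d) = src d)
    (hwt : ∀ d, wt (rev d) = -wt d)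
    (h : ∀ (k : ℕ) (d : ℕ → E), 0 < k → (∀ i, d (i + k) = d i) →
      (∀ i, tgt (d i) = src (d (i + 1))) →
      (∀ i j, i < k → j < k → src (d i) = src (d j) → i = j) → (∀ i, d (i + 1) ≠ rev (d i)) →
      ∑ i ∈ Finset.range k, wt (d i) = 0) :
    ∃ ψ : V → ℤ, ∀ d, ψ (tgt d) = ψ (src d) + wt d := by
  rcases isEmpty_or_nonempty E with hE | hE
  · exact ⟨fun _ => 0, isEmptyElim⟩
  -- Strong induction on the length: a closed walk that repeats a vertex splits there into two
  -- shorter closed walks.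
  have closed (k : ℕ) : ∀ d : ℕ → E, 0 < k → (∀ i, d (i + k) = d i) →
      (∀ i, tgt (d i) = src (d (i + 1))) → ∑ i ∈ Finset.range k, wt (d i) = 0 := by
    induction k using Nat.strong_induction_on with
    | _ k ih =>
    intro d hk hd hch
    have sub (a l : ℕ) (hl : 0 < l) (hlk : l < k) (hal : src (d (a + l)) = src (d a)) :
        ∑ n ∈ Finset.range l, wt (d (a + n)) = 0 := by
      have h1 := ih l hlk (fun n => d (a + n % l)) hl (fun i => by simp) (fun i => by
        show tgt (d (a + i % l)) = src (d (a + (i + 1) % l))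
        rw [hch]
        rcases Nat.lt_or_ge (i % l + 1) l with h2 | h2
        · rw [Nat.add_mod, Nat.mod_eq_of_lt (show 1 < l by omega), Nat.mod_eq_of_lt h2, add_assoc]
        · have h3 : i % l + 1 = l := by have := Nat.mod_lt i hl; omega
          have h4 : (i + 1) % l = 0 := by
            have := Nat.div_add_mod i l
            have h5 : i + 1 = l * (i / l + 1) := by rw [mul_add]; omega
            rw [h5, Nat.mul_mod_right]
          rw [h4, add_assoc, h3, hal, add_zero])
      rw [← h1]
      refine Finset.sum_congr rfl fun n hn => ?_
      rw [Nat.mod_eq_of_lt (Finset.mem_range.1 hn)]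
    by_cases hinj : ∀ i j, i < k → j < k → src (d i) = src (d j) → i = j
    · by_cases hb : ∀ i, d (i + 1) ≠ rev (d i)
      · exact h k d hk hd hch hinj hb
      · push Not at hb
        obtain ⟨i, hi⟩ := hb
        have hmod (n : ℕ) : d (n % k) = d n := by
          conv_rhs => rw [← Nat.mod_add_div n k]
          induction n / k with
          | zero => simp
          | succ m ihm => rw [mul_add, mul_one, ← add_assoc, hd, ihm]
        -- Turning back returns to the same vertex after two steps; as no vertex repeats within a
        -- period, the period divides `2` and the weights cancel directly.
        have h1 : src (d (i + 2)) = src (d i) := by rw [← hch (i + 1), hi, htgt]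
        rw [← hmod, ← hmod i] at h1
        have h2 := hinj _ _ (Nat.mod_lt _ hk) (Nat.mod_lt _ hk) h1
        have h3 : k ∣ 2 := by
          have := (Nat.modEq_iff_dvd' (show i ≤ i + 2 by omega)).1 (show i ≡ i + 2 [MOD k] from h2.symm)
          simpa using this
        have h4 : k ≤ 2 := Nat.le_of_dvd (by norm_num) h3
        have hw := congrArg wt hi
        rw [hwt] at hw
        rw [← sum_range_shift (f := fun n => wt (d n)) (fun n => by rw [hd]) i]
        interval_cases k
        · have h5 := hd i
          rw [h5] at hw
          simp
          omega
        · simp [Finset.sum_range_succ, hw]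
    · push Not at hinj
      obtain ⟨i, j, hi, hj, hs, hne⟩ := hinj
      wlog hij : i < j generalizing i j
      · exact this j i hj hi hs.symm hne.symm (by omega)
      rw [← sum_range_shift (f := fun n => wt (d n)) (fun n => by rw [hd]) i,
        show k = (j - i) + (k - (j - i)) by omega, Finset.sum_range_add,
        sub i (j - i) (by omega) (by omega) (by rw [hs]; congr 2; omega), zero_add]
      have h1 := sub j (k - (j - i)) (by omega) (by omega) (by
        rw [show j + (k - (j - i)) = i + k by omega, hd, hs])
      rw [← h1]
      exact Finset.sum_congr rfl fun n _ => by rw [← add_assoc, show i + (j - i) = j by omega]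
  -- Adjacency in the covering graph with fibre `ℤ` in which an edge raises the height by its
  -- weight. A potential is a section; `R_zero` says that a component meets each fibre at most once.
  let R : V × ℤ → V × ℤ → Prop := fun x y => ∃ d, src d = x.1 ∧ tgt d = y.1 ∧ y.2 = x.2 + wt d
  have R_symm : Std.Symm R := ⟨by
    rintro x y ⟨d, h1, h2, h3⟩
    exact ⟨rev d, by rw [hsrc, h2], by rw [htgt, h1], by rw [hwt, h3]; ring⟩⟩
  have R_rev {x y : V × ℤ} (hxy : Relation.ReflTransGen R x y) : Relation.ReflTransGen R y x :=
    Relation.ReflTransGen.stdSymm.symm _ _ hxy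
  have R_shift (x y : V × ℤ) (n : ℤ) (hxy : Relation.ReflTransGen R x y) :
      Relation.ReflTransGen R (x.1, x.2 + n) (y.1, y.2 + n) := by
    induction hxy with
    | refl => exact .refl
    | tail _ hyz ih =>
      obtain ⟨d, h1, h2, h3⟩ := hyz
      exact ih.tail ⟨d, h1, h2, by simp only [h3]; ring⟩
  have R_walk (x y : V × ℤ) (hxy : Relation.ReflTransGen R x y) :
      ∃ (k : ℕ) (d : ℕ → E), (k = 0 → x = y) ∧ (0 < k → src (d 0) = x.1 ∧ tgt (d (k - 1)) = y.1) ∧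
        (∀ i, i + 1 < k → tgt (d i) = src (d (i + 1))) ∧
        y.2 = x.2 + ∑ i ∈ Finset.range k, wt (d i) := by
    induction hxy with
    | refl =>
      exact ⟨0, fun _ => Classical.arbitrary E, by simp, by simp, by simp, by simp⟩
    | tail _ hyz ih =>
      obtain ⟨d', e1, e2, e3⟩ := hyz
      obtain ⟨k, d, h0, h1, h2, h3⟩ := ih
      refine ⟨k + 1, fun i => if i < k then d i else d', by simp, fun _ => ⟨?_, ?_⟩, ?_, ?_⟩
      · rcases Nat.eq_zero_or_pos k with rfl | hk
        · simp [e1, h0 rfl]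
        · simp [hk, (h1 hk).1]
      · simp [e2]
      · intro i hi
        have hi' : i < k := by omega
        rcases Nat.lt_or_ge (i + 1) k with h4 | h4
        · simp [hi', h4, h2 i h4]
        · have : i = k - 1 := by omega
          simp only [hi', if_true, if_neg (show ¬ i + 1 < k by omega), e1]
          rw [this]
          exact (h1 (by omega)).2
      · rw [Finset.sum_range_succ, e3, h3, add_assoc]
        simp only [lt_irrefl, if_false]
        congr 2
        exact Finset.sum_congr rfl fun i hi => by rw [if_pos (Finset.mem_range.1 hi)]
  have R_zero (x y : V × ℤ) (hxy : Relation.ReflTransGen R x y) (hx : x.1 = y.1) : x.2 = y.2 := by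
    obtain ⟨k, d, h0, h1, h2, h3⟩ := R_walk x y hxy
    rcases Nat.eq_zero_or_pos k with rfl | hk
    · rw [h0 rfl]
    · have h4 := closed k (fun n => d (n % k)) hk (by simp) (fun i => by
        show tgt (d (i % k)) = src (d ((i + 1) % k))
        rcases Nat.lt_or_ge (i % k + 1) k with h5 | h5
        · rw [h2 _ h5, Nat.add_mod, Nat.mod_eq_of_lt (show 1 < k by omega), Nat.mod_eq_of_lt h5]
        · have h6 : i % k + 1 = k := by have := Nat.mod_lt i hk; omega
          have h7 : (i + 1) % k = 0 := by
            have := Nat.div_add_mod i k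
            have h5 : i + 1 = k * (i / k + 1) := by rw [mul_add]; omega
            rw [h5, Nat.mul_mod_right]
          rw [h7, (h1 hk).1, hx, ← (h1 hk).2]
          congr 2
          omega)
      have h5 : ∑ i ∈ Finset.range k, wt (d i) = ∑ i ∈ Finset.range k, wt (d (i % k)) :=
        Finset.sum_congr rfl fun i hi => by rw [Nat.mod_eq_of_lt (Finset.mem_range.1 hi)]
      rw [h3, h5, h4, add_zero]
  let r : V → V → Prop := fun u v => ∃ n : ℤ, Relation.ReflTransGen R (u, 0) (v, n)
  have r_equiv : Equivalence r := by
    refine ⟨fun u => ⟨0, .refl⟩, ?_, ?_⟩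
    · rintro u v ⟨n, hn⟩
      refine ⟨-n, ?_⟩
      have := R_shift _ _ (-n) (R_rev hn)
      simpa using this
    · rintro u v w ⟨n, hn⟩ ⟨m, hm⟩
      exact ⟨m + n, hn.trans (by simpa using R_shift _ _ n hm)⟩
  let S : Setoid V := ⟨r, r_equiv⟩
  -- The potential is the height reached from the base vertex of the component, started at height
  -- `0`.
  have hrep (v : V) : ∃ n : ℤ, Relation.ReflTransGen R ((Quotient.mk S v).out, 0) (v, n) :=
    Quotient.mk_out (s := S) v
  choose ψ hψ using hrep
  refine ⟨ψ, fun d => ?_⟩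
  have hq : Quotient.mk S (tgt d) = Quotient.mk S (src d) := by
    refine Quotient.sound ?_
    exact r_equiv.symm ⟨wt d, .single ⟨d, rfl, rfl, by simp⟩⟩
  have h1 := hψ (tgt d)
  rw [hq] at h1
  have h2 : Relation.ReflTransGen R ((Quotient.mk S (src d)).out, 0) (tgt d, ψ (src d) + wt d) :=
    (hψ (src d)).tail ⟨d, rfl, rfl, rfl⟩
  exact R_zero _ _ ((R_rev h1).trans h2) rfl

/-! ### Corner weights orthogonal to closed curves. -/

namespace IdealTriangulation

variable {ι : Type*} (T : IdealTriangulation ι)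

/-- A cyclic sequence of arcs, given by a successor map on a finite set, is a normal curve. -/
theorem exists_normalCurve {S : Type*} [Finite S] (nxt : S → S) (s₀ : S)
    (hcyc : ∃ n > 0, nxt^[n] s₀ = s₀) (hreach : ∀ s, ∃ n, nxt^[n] s₀ = s)
    (arc : S → ι × Equiv.Perm (Fin 4)) (pt : S → Fin 4 → ℝ)
    (tet_succ : ∀ s, (arc (nxt s)).1 = (T.across (arc s) 2).1)
    (vertex_succ : ∀ s, (arc (nxt s)).2 0 = (T.across (arc s) 2).2 0)
    (side_succ : ∀ s, (arc (nxt s)).2 1 = (T.across (arc s) 2).2 2)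
    (pt_vertex : ∀ s, pt s ((arc s).2 0) = 0) (pt_side : ∀ s, pt s ((arc s).2 1) = 0)
    (pt_pos : ∀ s, 0 < pt s ((arc s).2 2) ∧ 0 < pt s ((arc s).2 3))
    (pt_sum : ∀ s, ∑ w, pt s w = 1) :
    ∃ (γ : NormalCurve T) (e : Fin (γ.m + 1) ≃ S), (∀ i, e (i + 1) = nxt (e i)) ∧
      (∀ i, γ.arc i = arc (e i)) ∧ ∀ i, γ.pt i = pt (e i) := by
  obtain ⟨n, hn, hn'⟩ := hcyc
  -- The arcs are numbered by the iterates of the starting arc within its minimal period, so the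
  -- numbering is a bijection.
  have hpos : 0 < Function.minimalPeriod nxt s₀ :=
    Function.minimalPeriod_pos_of_mem_periodicPts ⟨n, hn, hn'⟩
  obtain ⟨m, hm⟩ : ∃ m, Function.minimalPeriod nxt s₀ = m + 1 :=
    ⟨Function.minimalPeriod nxt s₀ - 1, by omega⟩
  have hmod (n : ℕ) : nxt^[n % (m + 1)] s₀ = nxt^[n] s₀ := by
    rw [← hm, Function.iterate_mod_minimalPeriod_eq]
  let e : Fin (m + 1) ≃ S := Equiv.ofBijective (fun i => nxt^[i.val] s₀) ⟨fun i j hij => by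
    have h1 := Function.iterate_injOn_Iio_minimalPeriod (f := nxt) (x := s₀)
      (show i.val ∈ _ by rw [hm]; exact i.2) (show j.val ∈ _ by rw [hm]; exact j.2) hij
    exact Fin.ext h1, fun s => by
    obtain ⟨n, hn⟩ := hreach s
    exact ⟨⟨n % (m + 1), Nat.mod_lt _ (Nat.succ_pos m)⟩, (hmod n).trans hn⟩⟩
  have he (i : Fin (m + 1)) : e (i + 1) = nxt (e i) := by
    show nxt^[(i + 1).val] s₀ = nxt (nxt^[i.val] s₀)
    rw [← Function.iterate_succ_apply' nxt, Fin.val_add, Fin.val_one', ← hmod i.val.succ]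
    simp [Nat.add_mod]
  exact ⟨{
    m := m
    arc := fun i => arc (e i)
    tet_succ := fun i => by rw [he, tet_succ]
    vertex_succ := fun i => by rw [he, vertex_succ]
    side_succ := fun i => by rw [he, side_succ]
    pt := fun i => pt (e i)
    pt_vertex := fun i => pt_vertex _
    pt_side := fun i => pt_side _
    pt_pos := fun i => pt_pos _
    pt_sum := fun i => pt_sum _ }, e, he, fun _ => rfl, fun _ => rfl⟩

/-- The midpoint of the side on `f` of the triangle at `v`, in barycentric coordinates. -/
def sideMidpoint (v f : Fin 4) : Fin 4 → ℝ := fun w => if w = v ∨ w = f then 0 else 1 / 2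

theorem sum_sideMidpoint {v f : Fin 4} (h : v ≠ f) : ∑ w, sideMidpoint v f w = 1 := by
  obtain ⟨σ, rfl, rfl, -⟩ := exists_perm_pair h 1
  rw [← Equiv.sum_comp σ, Fin.sum_univ_four]
  simp [sideMidpoint]
  norm_num

/-- The curve visits every triangle of the link at most once. -/
def NormalCurve.VisitsOnce {T : IdealTriangulation ι} (γ : NormalCurve T) : Prop :=
  ∀ i j, (γ.arc i).1 = (γ.arc j).1 → (γ.arc i).2 0 = (γ.arc j).2 0 → i = j

theorem NormalCurve.VisitsOnce.isSimple {T : IdealTriangulation ι} {γ : NormalCurve T}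
    (h : γ.VisitsOnce) : γ.IsSimple :=
  fun i j hij h1 h2 => absurd (h i j h1 h2) hij

/-- Corner weights orthogonal to all curves have a potential on the sides of the link. -/
theorem exists_sidePotential [Fintype ι] (g : ι → Fin 3 → ℤ) (hg : ∀ t, ∑ q, g t q = 0)
    (h : ∀ γ : NormalCurve T, γ.VisitsOnce → ∑ t, ∑ q, γ.turning t q * g t q = 0) :
    ∃ φ : ι → Fin 4 → Fin 4 → ℤ,
      (∀ t v f, v ≠ f → φ (T.nbr t f) (T.perm t f v) (T.perm t f f) = φ t v f) ∧
      ∀ t, ∀ σ : Equiv.Perm (Fin 4), φ t (σ 0) (σ 2) - φ t (σ 0) (σ 1) =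
        (Equiv.Perm.sign σ : ℤ) * g t (quadType (σ 0) (σ 3)) := by
  let E := {s : ι × Fin 4 × Fin 4 // s.2.1 ≠ s.2.2}
  let H : ι × Fin 4 × Fin 4 → ℤ := fun s => sideWeight (g s.1) (quadType s.2.1 s.2.2)
  let rev : E → E := fun s => ⟨T.glueSide s.1, by
    simpa [GluedTetrahedra.glueSide] using s.2⟩
  have rev_rev (s : E) : rev (rev s) = s := Subtype.ext (T.glueSide_glueSide s.1)
  let src : E → ι × Fin 4 := fun s => (s.1.1, s.1.2.1)
  -- In the graph of triangles joined across their sides, the weight of a side is the mismatch of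
  -- the local primitives on both sides of it. A potential for it supplies the constants that make
  -- the primitives agree.
  let wt : E → ℤ := fun s => H s.1 - H (rev s).1
  obtain ⟨ψ, hψ⟩ := exists_potential src (fun s => src (rev s)) wt rev (fun _ => rfl)
    (fun d => by simp only [rev_rev]) (fun d => by simp only [wt, rev_rev]; ring) (by
      intro k d hk hper hch hinj hback
      obtain ⟨m, rfl⟩ : ∃ m, k = m + 1 := ⟨k - 1, by omega⟩
      -- Since the period is `m + 1`, the index `i + m` is the predecessor of `i`.
      have hpred (i : ℕ) : src (rev (d (i + m))) = src (d i) := by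
        rw [hch, add_assoc, hper]
      have hσ (i : ℕ) : ∃ σ : Equiv.Perm (Fin 4), σ 0 = (d i).1.2.1 ∧
          σ 1 = (rev (d (i + m))).1.2.2 ∧ σ 2 = (d i).1.2.2 := by
        have h1 : (rev (d (i + m))).1.2.1 = (d i).1.2.1 := congrArg Prod.snd (hpred i)
        refine exists_perm_triple ?_ (d i).2 ?_
        · rw [← h1]; exact (rev (d (i + m))).2
        -- The walk does not turn back, so the side of entry differs from the side of exit and the
        -- arc is a genuine normal arc.
        · intro h2
          refine hback (i + m) ?_
          rw [add_assoc, hper]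
          exact Subtype.ext (Prod.ext (congrArg Prod.fst (hpred i)).symm (Prod.ext h1.symm h2.symm))
      choose σ hσ0 hσ1 hσ2 using hσ
      have hdm (i : ℕ) : d (i % (m + 1)) = d i := by
        conv_rhs => rw [← Nat.mod_add_div i (m + 1)]
        induction i / (m + 1) with
        | zero => simp
        | succ n ihn => rw [mul_add, mul_one, ← add_assoc, hper, ihn]
      have hsucc (i : Fin (m + 1)) (n : ℕ) : d ((i + 1).val + n) = d (i.val + 1 + n) := by
        rw [← hdm, ← hdm (i.val + 1 + n), Fin.val_add, Fin.val_one']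
        congr 1
        simp [Nat.add_mod]
      let γ : NormalCurve T :=
        { m := m
          arc := fun i => ((d i.val).1.1, σ i.val)
          tet_succ := fun i => by
            have h1 := congrArg Prod.fst (hch i.val)
            simp only [GluedTetrahedra.across, hσ2]
            rw [← add_zero (i + 1).val, hsucc]
            exact h1.symm
          vertex_succ := fun i => by
            have h1 := congrArg Prod.snd (hch i.val)
            simp only [GluedTetrahedra.across, Equiv.Perm.mul_apply, hσ2, hσ0]
            rw [← add_zero (i + 1).val, hsucc]
            exact h1.symm
          side_succ := fun i => by
            simp only [GluedTetrahedra.across, Equiv.Perm.mul_apply, hσ2, hσ1]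
            rw [hsucc, add_assoc, add_comm 1 m, hper]
            rfl
          pt := fun i => sideMidpoint (σ i.val 0) (σ i.val 1)
          pt_vertex := fun i => by simp [sideMidpoint]
          pt_side := fun i => by simp [sideMidpoint]
          pt_pos := fun i => by simp [sideMidpoint]
          pt_sum := fun i => sum_sideMidpoint (by simp) }
      have h1 := h γ fun i j h1 h2 =>
        Fin.ext (hinj i j i.2 j.2 (Prod.ext h1 ((hσ0 _).symm.trans (h2.trans (hσ0 _)))))
      have h2 := γ.sum_sum_turning g
      simp only [Int.cast_id] at h2
      rw [h1] at h2
      have h3 (i : Fin (γ.m + 1)) : (Equiv.Perm.sign (γ.arc i).2 : ℤ) *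
          g (γ.arc i).1 (quadType ((γ.arc i).2 0) ((γ.arc i).2 3)) =
          H (d i.val).1 - H (rev (d (i.val + m))).1 := by
        have h4 := sideWeight_sub (g (γ.arc i).1) (hg _) (γ.arc i).2
        rw [Int.cast_id] at h4
        rw [← h4]
        have h5 := hpred i.val
        simp only [src, Prod.mk.injEq] at h5
        simp only [γ, H, hσ0, hσ1, hσ2, h5]
      rw [Finset.sum_congr rfl fun i _ => h3 i, Finset.sum_sub_distrib] at h2
      have h6 := Fin.sum_univ_eq_sum_range (fun i => H (rev (d (m + i))).1) (m + 1)
      have h7 := sum_range_shift (f := fun i => H (rev (d i)).1) (fun i => by rw [hper]) m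
      have h8 := Fin.sum_univ_eq_sum_range (fun i => H (d i).1) (m + 1)
      simp only [wt, Finset.sum_sub_distrib]
      rw [← h7, ← h6, ← h8]
      simp only [add_comm m]
      exact h2.symm)
  refine ⟨fun t v f => ψ (t, v) + H (t, v, f), fun t v f hvf => ?_, fun t σ => ?_⟩
  · have h1 : ψ (T.nbr t f, T.perm t f v) = ψ (t, v) +
        (H (t, v, f) - H (T.nbr t f, T.perm t f v, T.perm t f f)) := hψ ⟨(t, v, f), hvf⟩
    show ψ _ + _ = ψ _ + _
    rw [h1]
    ring
  · have h1 := sideWeight_sub (g t) (hg t) σ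
    rw [Int.cast_id] at h1
    rw [← h1]
    simp only [H]
    ring

end IdealTriangulation

/-! ### Products of shapes -/

theorem shape_ne_zero {z : ℂ} (h0 : z ≠ 0) (h1 : z ≠ 1) (q : Fin 3) : shape z q ≠ 0 := by
  have h2 : 1 - z ≠ 0 := sub_ne_zero.2 h1.symm
  have h3 : 1 - z⁻¹ ≠ 0 := by
    rw [sub_ne_zero]
    exact fun h => h1 (inv_eq_one.1 h.symm)
  fin_cases q <;> simp [shape, h0, h2, h3]

theorem prod_shape {z : ℂ} (h0 : z ≠ 0) (h1 : z ≠ 1) :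
    shape z 1 = -(z⁻¹ * (shape z 2)⁻¹) := by
  have h2 : 1 - z ≠ 0 := sub_ne_zero.2 h1.symm
  have h3 : z - 1 ≠ 0 := sub_ne_zero.2 h1
  have h4 : z * (1 - z⁻¹) = z - 1 := by field_simp
  simp only [shape, Matrix.cons_val]
  rw [← mul_inv, h4, ← inv_neg, neg_sub]

theorem prod_zpow_eq {κ : Type*} (s : Finset κ) {a : ℂ} (ha : a ≠ 0) (f : κ → ℤ) :
    ∏ i ∈ s, a ^ f i = a ^ ∑ i ∈ s, f i := by
  classical
  induction s using Finset.induction_on with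
  | empty => simp
  | insert i s hi ih => rw [Finset.prod_insert hi, Finset.sum_insert hi, ih, zpow_add₀ ha]

/-- The factor at one tetrahedron of the monomial in the 1-loop invariant. -/
def shapeMonomial (z : ℂ) (f : Fin 3 → ℤ) : ℂ := z ^ f 2 * shape z 2 ^ (-f 0)

theorem shapeMonomial_add {z : ℂ} (h0 : z ≠ 0) (h1 : z ≠ 1) (f g : Fin 3 → ℤ) :
    shapeMonomial z (fun q => f q + g q) = shapeMonomial z f * shapeMonomial z g := by
  simp only [shapeMonomial, neg_add]
  rw [zpow_add₀ h0, zpow_add₀ (shape_ne_zero h0 h1 2)]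
  ring

theorem shapeMonomial_mul_int (z : ℂ) (m : ℤ) (f : Fin 3 → ℤ) :
    shapeMonomial z (fun q => m * f q) = shapeMonomial z f ^ m := by
  simp only [shapeMonomial]
  rw [mul_zpow, ← zpow_mul, ← zpow_mul, mul_comm m, neg_mul, mul_comm m]

theorem prod_shape_zpow {z : ℂ} (h0 : z ≠ 0) (h1 : z ≠ 1) (a : Fin 3 → ℤ) :
    ∏ q, shape z q ^ a q = (-1) ^ a 1 * (z ^ (a 0 - a 1) * shape z 2 ^ (a 2 - a 1)) := by
  have h3 := shape_ne_zero h0 h1 2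
  have h4 : shape z 0 = z := rfl
  rw [Fin.prod_univ_three, h4, prod_shape h0 h1, neg_eq_neg_one_mul, mul_zpow, mul_zpow, inv_zpow,
    inv_zpow, zpow_sub₀ h0, zpow_sub₀ h3]
  field_simp

namespace IdealTriangulation

variable {ι : Type*} (T : IdealTriangulation ι)

theorem prod_shape_typeSum [Fintype ι] {z : ι → ℂ} (hz : z ∈ T.gluingVariety) (c : Quot T.EdgeStep → ℤ) :
    ∏ t, ∏ q, shape (z t) q ^ T.typeSum c t q = 1 := by
  have := Fintype.ofFinite T.Edge
  have h1 (t : ι) (q : Fin 3) : shape (z t) q ^ T.typeSum c t q =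
      ∏ e : T.Edge, (shape (z t) q ^ T.incidence e t q) ^ c e.1 := by
    rw [← T.sum_mul_incidence (fun e => c e.1) c (fun _ => rfl),
      ← prod_zpow_eq _ (shape_ne_zero (hz.1 t).1 (hz.1 t).2 q)]
    refine Finset.prod_congr rfl fun e _ => ?_
    rw [mul_comm, zpow_mul]
    rfl
  simp only [h1]
  rw [Finset.prod_congr rfl fun t _ => Finset.prod_comm, Finset.prod_comm]
  refine Finset.prod_eq_one fun e _ => ?_
  simp only [Finset.prod_zpow]
  rw [hz.2 e, one_zpow]

/-- The monomial of the dual is the edge equation after elimination of `z'` through `z z' z'' = -1`;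
each power of `z'` contributes a sign. -/
theorem prod_shapeMonomial_edgeDual [Fintype ι] {z : ι → ℂ} (hz : z ∈ T.gluingVariety)
    (c : Quot T.EdgeStep → ℤ) :
    ∏ t, shapeMonomial (z t) (T.edgeDual c t) = (-1) ^ ∑ t, T.typeSum c t 1 := by
  have h := T.prod_shape_typeSum hz c
  rw [Finset.prod_congr rfl fun t _ => prod_shape_zpow (hz.1 t).1 (hz.1 t).2 (T.typeSum c t),
    Finset.prod_mul_distrib, prod_zpow_eq _ (by norm_num)] at h
  have h1 (t : ι) : shapeMonomial (z t) (T.edgeDual c t) =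
      z t ^ (T.typeSum c t 0 - T.typeSum c t 1) *
        shape (z t) 2 ^ (T.typeSum c t 2 - T.typeSum c t 1) := by
    rw [shapeMonomial, GluedTetrahedra.edgeDual, GluedTetrahedra.edgeDual, neg_sub]
    rfl
  rw [Finset.prod_congr rfl fun t _ => h1 t]
  rcases Int.even_or_odd (∑ t, T.typeSum c t 1) with h2 | h2
  · rw [h2.neg_one_zpow] at h ⊢
    rwa [one_mul] at h
  · rw [h2.neg_one_zpow] at h ⊢
    linear_combination -h

/-- A quadratic expression in the values of an edge function modulo 2 on the edges of a face. -/
def faceParity (c : Quot T.EdgeStep → ZMod 2) (t : ι) (f : Fin 4) : ZMod 2 :=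
  c (T.edgeClass t (f + 1) (f + 2)) * c (T.edgeClass t (f + 2) (f + 3)) +
    c (T.edgeClass t (f + 2) (f + 3)) * c (T.edgeClass t (f + 1) (f + 3)) +
    c (T.edgeClass t (f + 1) (f + 3)) * c (T.edgeClass t (f + 1) (f + 2))

theorem faceParity_perm (c : Quot T.EdgeStep → ZMod 2) (t : ι) (σ : Equiv.Perm (Fin 4)) :
    T.faceParity c t (σ 0) =
      c (T.edgeClass t (σ 1) (σ 2)) * c (T.edgeClass t (σ 2) (σ 3)) +
      c (T.edgeClass t (σ 2) (σ 3)) * c (T.edgeClass t (σ 1) (σ 3)) +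
      c (T.edgeClass t (σ 1) (σ 3)) * c (T.edgeClass t (σ 1) (σ 2)) := by
  have key : ∀ σ : Equiv.Perm (Fin 4),
      (σ 1, σ 2, σ 3) = (σ 0 + 1, σ 0 + 2, σ 0 + 3) ∨ (σ 1, σ 2, σ 3) = (σ 0 + 1, σ 0 + 3, σ 0 + 2) ∨
      (σ 1, σ 2, σ 3) = (σ 0 + 2, σ 0 + 1, σ 0 + 3) ∨ (σ 1, σ 2, σ 3) = (σ 0 + 2, σ 0 + 3, σ 0 + 1) ∨
      (σ 1, σ 2, σ 3) = (σ 0 + 3, σ 0 + 1, σ 0 + 2) ∨ (σ 1, σ 2, σ 3) = (σ 0 + 3, σ 0 + 2, σ 0 + 1) := by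
    decide
  have h1 := key σ
  simp only [Prod.mk.injEq] at h1
  rw [faceParity]
  rcases h1 with h | h | h | h | h | h <;> rw [h.1, h.2.1, h.2.2] <;>
    simp only [T.edgeClass_symm t (σ 0 + 2) (σ 0 + 1), T.edgeClass_symm t (σ 0 + 3) (σ 0 + 1),
      T.edgeClass_symm t (σ 0 + 3) (σ 0 + 2)] <;> ring

/-- Faces are glued in pairs without fixed faces, and the expression depends only on the edges of
the face, so its values cancel in pairs modulo 2. -/
theorem sum_faceParity [Fintype ι] (c : Quot T.EdgeStep → ZMod 2) : ∑ t, ∑ f, T.faceParity c t f = 0 := by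
  classical
  rw [← Fintype.sum_prod_type']
  refine Finset.sum_involution (fun x _ => (T.nbr x.1 x.2, T.perm x.1 x.2 x.2)) ?_ ?_ ?_ ?_
  · rintro ⟨t, f⟩ -
    obtain ⟨σ, rfl⟩ : ∃ σ : Equiv.Perm (Fin 4), σ 0 = f := ⟨Equiv.swap 0 f, by simp⟩
    simp only
    rw [← Equiv.Perm.mul_apply, faceParity_perm, faceParity_perm]
    have h := fun {u v : Fin 4} => T.edgeClass_across (t, σ) (k := 0) (u := u) (v := v)
    simp only [GluedTetrahedra.across] at h
    rw [h (by decide) (by decide), h (by decide) (by decide), h (by decide) (by decide)]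
    exact CharTwo.add_self_eq_zero _
  · rintro ⟨t, f⟩ - - h
    rw [Prod.mk.injEq] at h
    exact T.no_fold t f h
  · intro x _
    exact Finset.mem_univ _
  · rintro ⟨t, f⟩ -
    simp [T.nbr_nbr, T.perm_perm]

/-- An edge function with even sums over the faces has an even sum over all edges of type `1`. -/
theorem even_sum_typeSum [Fintype ι] (C : Quot T.EdgeStep → ℤ)
    (hC : ∀ t, ∀ σ : Equiv.Perm (Fin 4), Even (C (T.edgeClass t (σ 1) (σ 2)) +
      C (T.edgeClass t (σ 2) (σ 3)) + C (T.edgeClass t (σ 1) (σ 3)))) :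
    Even (∑ t, T.typeSum C t 1) := by
  let c : Quot T.EdgeStep → ZMod 2 := fun e => (C e : ZMod 2)
  have hc (t : ι) (σ : Equiv.Perm (Fin 4)) : c (T.edgeClass t (σ 1) (σ 2)) +
      c (T.edgeClass t (σ 2) (σ 3)) + c (T.edgeClass t (σ 1) (σ 3)) = 0 := by
    have := (ZMod.intCast_zmod_eq_zero_iff_dvd _ 2).2 (hC t σ).two_dvd
    push_cast at this
    exact this
  -- For a mod 2 cocycle on a tetrahedron, the sum over the pair of type `1` is a sum of quadratic
  -- terms, one per face; this makes the total a sum over glued faces.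
  have key : ∀ c01 c02 c03 c12 c13 c23 : ZMod 2, c12 + c23 + c13 = 0 → c23 + c03 + c02 = 0 →
      c03 + c01 + c13 = 0 → c01 + c12 + c02 = 0 → c02 + c13 =
      (c12 * c23 + c23 * c13 + c13 * c12) + (c23 * c03 + c03 * c02 + c02 * c23) +
      (c03 * c01 + c01 * c13 + c13 * c03) + (c01 * c12 + c12 * c02 + c02 * c01) := by decide
  have h1 (t : ι) : ((T.typeSum C t 1 : ℤ) : ZMod 2) = ∑ f, T.faceParity c t f := by
    have hf (f : Fin 4) := hc t (Equiv.addLeft f)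
    have h0 := hf 0
    have h1 := hf 1
    have h2 := hf 2
    have h3 := hf 3
    simp only [Equiv.coe_addLeft, Fin.reduceAdd] at h0 h1 h2 h3
    rw [GluedTetrahedra.typeSum_one, Fin.sum_univ_four]
    simp only [faceParity, Fin.reduceAdd]
    simp only [T.edgeClass_symm t 3 0, T.edgeClass_symm t 2 0, T.edgeClass_symm t 3 1] at *
    rw [Int.cast_add]
    exact key _ _ _ _ _ _ h0 h1 h2 h3
  have h2 : ((∑ t, T.typeSum C t 1 : ℤ) : ZMod 2) = 0 := by
    rw [Int.cast_sum, ← T.sum_faceParity c]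
    exact Finset.sum_congr rfl fun t _ => h1 t
  exact even_iff_two_dvd.2 ((ZMod.intCast_zmod_eq_zero_iff_dvd _ 2).1 h2)

/-- Add the potentials at the two ends of an edge, taken at a face containing it. Passing to the
other face of the same tetrahedron changes them by corner weights of the same type with opposite
signs, and passing through a face changes nothing, so the sum belongs to the edge. -/
theorem exists_edge_of_sidePotential (g : ι → Fin 3 → ℤ) (φ : ι → Fin 4 → Fin 4 → ℤ)
    (hφ : ∀ t v f, v ≠ f → φ (T.nbr t f) (T.perm t f v) (T.perm t f f) = φ t v f)
    (hG : ∀ t, ∀ σ : Equiv.Perm (Fin 4), φ t (σ 0) (σ 2) - φ t (σ 0) (σ 1) =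
      (Equiv.Perm.sign σ : ℤ) * g t (quadType (σ 0) (σ 3))) :
    ∃ C : Quot T.EdgeStep → ℤ, ∀ t, ∀ σ : Equiv.Perm (Fin 4),
      C (T.edgeClass t (σ 0) (σ 1)) = φ t (σ 0) (σ 2) + φ t (σ 1) (σ 2) := by
  -- A symmetric choice of a vertex other than `a` and `b`, that is, of a face containing the edge
  -- `ab`.
  let o : Fin 4 → Fin 4 → Fin 4 := fun a b =>
    if a ≠ 0 ∧ b ≠ 0 then 0 else if a ≠ 1 ∧ b ≠ 1 then 1 else 2
  have ho : ∀ a b, o a b ≠ a ∧ o a b ≠ b ∧ o a b = o b a := by decide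
  have indep (t : ι) (a b f f' : Fin 4) (hab : a ≠ b) (hfa : f ≠ a) (hfb : f ≠ b) (hfa' : f' ≠ a)
      (hfb' : f' ≠ b) : φ t a f + φ t b f = φ t a f' + φ t b f' := by
    by_cases hff : f = f'
    · rw [hff]
    obtain ⟨σ, rfl, rfl, rfl⟩ := exists_perm_triple hfa.symm hfa'.symm hff
    have hb : b = σ 3 := by
      obtain ⟨u, rfl⟩ := σ.surjective b
      have h0 : u ≠ 0 := fun h => hab (by rw [h])
      have h1 : u ≠ 1 := fun h => hfb (by rw [h])
      have h2 : u ≠ 2 := fun h => hfb' (by rw [h])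
      congr 1
      omega
    subst hb
    have h1 := hG t σ
    have h2 := hG t (σ * Equiv.swap 0 3)
    have e1 : (Equiv.swap 0 3 : Equiv.Perm (Fin 4)) 1 = 1 := by decide
    have e2 : (Equiv.swap 0 3 : Equiv.Perm (Fin 4)) 2 = 2 := by decide
    have es : Equiv.Perm.sign (Equiv.swap 0 3 : Equiv.Perm (Fin 4)) = -1 := by decide
    simp only [Equiv.Perm.mul_apply, Equiv.swap_apply_left, Equiv.swap_apply_right, e1, e2,
      Equiv.Perm.sign_mul, es, quadType_symm (σ 3) (σ 0)] at h2
    push_cast at h2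
    linarith
  refine ⟨Quot.lift (fun x => if x.2.1 = x.2.2 then 0 else
    φ x.1 x.2.1 (o x.2.1 x.2.2) + φ x.1 x.2.2 (o x.2.1 x.2.2)) ?_, fun t σ => ?_⟩
  · rintro _ _ (⟨t, a, b⟩ | ⟨t, f, a, b, ha, hb⟩)
    · simp only [eq_comm (a := b), (ho a b).2.2, add_comm]
    · by_cases hab : a = b
      · simp [hab]
      · simp only [EmbeddingLike.apply_eq_iff_eq, if_neg hab]
        have h1 := fun a b => ho a b
        rw [indep t a b _ f hab (ho a b).1 (ho a b).2.1 ha.symm hb.symm,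
          indep (T.nbr t f) (T.perm t f a) (T.perm t f b) _ (T.perm t f f) (by simpa using hab)
            (ho _ _).1 (ho _ _).2.1 (by simpa using ha.symm) (by simpa using hb.symm),
          hφ t a f ha, hφ t b f hb]
  · show (if σ 0 = σ 1 then 0 else _) = _
    rw [if_neg (σ.injective.ne (by decide))]
    exact indep t (σ 0) (σ 1) _ _ (by simp) (ho _ _).1 (ho _ _).2.1 (by simp) (by simp)

/-- The monomial with exponents orthogonal to all edges and curves is `1` or `-1`. -/
theorem prod_shapeMonomial_sq [Fintype ι] {z : ι → ℂ} (hz : z ∈ T.gluingVariety)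
    (g : ι → Fin 3 → ℤ) (hg : ∀ t, ∑ q, g t q = 0)
    (h : ∀ γ : NormalCurve T, γ.VisitsOnce → ∑ t, ∑ q, γ.turning t q * g t q = 0) :
    (∏ t, shapeMonomial (z t) (g t)) ^ 2 = 1 := by
  obtain ⟨φ, hφ, hG⟩ := T.exists_sidePotential g hg h
  obtain ⟨C, hC⟩ := T.exists_edge_of_sidePotential g φ hφ hG
  -- Each of the three edges of the face is the sum of the potentials at its two ends, so the signed
  -- sum leaves twice the value at one vertex. Hence `2 * g` is the dual of `C`.
  have h1 (t : ι) (σ : Equiv.Perm (Fin 4)) : T.sidePotential C t (σ 0) (σ 1) =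
      2 * φ t (σ 0) (σ 1) := by
    let a : Equiv.Perm (Fin 4) := Equiv.swap 1 2
    let b : Equiv.Perm (Fin 4) := Equiv.swap 1 3 * Equiv.swap 2 3
    let c : Equiv.Perm (Fin 4) := Equiv.swap 0 2 * Equiv.swap 1 3 * Equiv.swap 2 3
    have c1 := hC t (σ * a)
    have c2 := hC t (σ * b)
    have c3 := hC t (σ * c)
    simp only [Equiv.Perm.mul_apply σ, show a 0 = 0 by decide, show a 1 = 2 by decide,
      show a 2 = 1 by decide, show b 0 = 0 by decide, show b 1 = 3 by decide,
      show b 2 = 1 by decide, show c 0 = 2 by decide, show c 1 = 3 by decide,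
      show c 2 = 1 by decide] at c1 c2 c3
    rw [GluedTetrahedra.sidePotential_perm, c1, c2, c3]
    ring
  have h2 (t : ι) : (fun q => 2 * g t q) = T.edgeDual C t := by
    funext q
    obtain ⟨σ, hσ⟩ : ∃ σ : Equiv.Perm (Fin 4), quadType (σ 0) (σ 3) = q := by
      revert q; decide
    have e1 := T.sidePotential_sub C t σ
    have e2 := h1 t (σ * Equiv.swap 1 2)
    have e3 : (Equiv.swap 1 2 : Equiv.Perm (Fin 4)) 0 = 0 := by decide
    simp only [Equiv.Perm.mul_apply, e3, Equiv.swap_apply_left] at e2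
    rw [h1, e2, ← mul_sub, hG, hσ, Int.cast_id] at e1
    rcases Int.units_eq_one_or (Equiv.Perm.sign σ) with hs | hs <;> rw [hs] at e1 <;>
      push_cast at e1 <;> linarith
  have h3 := T.prod_shapeMonomial_edgeDual hz C
  rw [Even.neg_one_zpow] at h3
  · rw [← Finset.prod_pow, ← h3]
    refine Finset.prod_congr rfl fun t _ => ?_
    rw [← h2, shapeMonomial_mul_int]
    rfl
  -- All three edges can be evaluated at their common face, where each vertex occurs twice; so the
  -- face sums are even and the sign disappears.
  · refine T.even_sum_typeSum C fun t σ => ?_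
    let a : Equiv.Perm (Fin 4) := Equiv.swap 0 1 * Equiv.swap 1 2
    let b : Equiv.Perm (Fin 4) := Equiv.swap 0 2 * Equiv.swap 1 3
    let c : Equiv.Perm (Fin 4) := Equiv.swap 0 1 * Equiv.swap 1 3 * Equiv.swap 3 2
    have c1 := hC t (σ * a)
    have c2 := hC t (σ * b)
    have c3 := hC t (σ * c)
    simp only [Equiv.Perm.mul_apply σ, show a 0 = 1 by decide, show a 1 = 2 by decide,
      show a 2 = 0 by decide, show b 0 = 2 by decide, show b 1 = 3 by decide,
      show b 2 = 0 by decide, show c 0 = 1 by decide, show c 1 = 3 by decide,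
      show c 2 = 0 by decide] at c1 c2 c3
    rw [c1, c2, c3]
    exact ⟨φ t (σ 1) (σ 0) + φ t (σ 2) (σ 0) + φ t (σ 3) (σ 0), by ring⟩

end IdealTriangulation

namespace IdealTriangulation

namespace ZeroTwoMove

variable {ι : Type*} {T : IdealTriangulation ι} {T' : IdealTriangulation (ι ⊕ Fin 2)}
  (M : ZeroTwoMove T T')

/-! ### The opened faces and the new tetrahedra -/

/-- The flag of `T` whose face number `k` (`2` or `3`) is opened, on the side of the new
tetrahedron `j`. -/
def opened (j : Fin 2) (k : Fin 4) : ι × Equiv.Perm (Fin 4) :=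
  if k = 3 then (if j = 0 then M.x else T.across M.x 3) else
    (if j = 0 then M.y else T.across M.y 2)

theorem across_opened (j : Fin 2) {k : Fin 4} (hk : k = 2 ∨ k = 3) :
    T.across (M.opened j k) k = M.opened (j + 1) k := by
  rcases hk with rfl | rfl <;> fin_cases j <;> simp [opened, T.across_across]

theorem across_inl_opened (j : Fin 2) {k : Fin 4} (hk : k = 2 ∨ k = 3) :
    T'.across (Sum.inl (M.opened j k).1, (M.opened j k).2) k = (Sum.inr j, M.lab j) := by
  rcases hk with rfl | rfl <;> fin_cases j
  · exact M.second_face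
  · exact M.second_face'
  · exact M.first_face
  · exact M.first_face'

theorem across_inr_outer (j : Fin 2) {k : Fin 4} (hk : k = 2 ∨ k = 3) :
    T'.across (Sum.inr j, M.lab j) k = (Sum.inl (M.opened j k).1, (M.opened j k).2) := by
  rw [← M.across_inl_opened j hk, T'.across_across]

theorem across_inr_inner (j : Fin 2) {k : Fin 4} (hk : k = 0 ∨ k = 1) :
    T'.across (Sum.inr j, M.lab j) k = (Sum.inr (j + 1), M.lab (j + 1)) := by
  have h : ∀ k : Fin 4, k = 0 ∨ k = 1 →
      T'.across (Sum.inr 0, M.lab 0) k = (Sum.inr 1, M.lab 1) := by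
    rintro k (rfl | rfl)
    · exact M.inner_BCD
    · exact M.inner_ACD
  fin_cases j
  · exact h k hk
  · show T'.across (Sum.inr 1, M.lab 1) k = (Sum.inr 0, M.lab 0)
    rw [← h k hk, T'.across_across]

theorem sign_lab : Equiv.Perm.sign (M.lab 1) = -Equiv.Perm.sign (M.lab 0) := by
  rw [← T'.sign_across (Sum.inr 0, M.lab 0) 0, M.inner_BCD]

theorem nbr_opened (j : Fin 2) {k : Fin 4} (hk : k = 2 ∨ k = 3) :
    T.nbr (M.opened j k).1 ((M.opened j k).2 k) = (M.opened (j + 1) k).1 :=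
  congrArg Prod.fst (M.across_opened j hk)

theorem perm_opened (j : Fin 2) {k : Fin 4} (hk : k = 2 ∨ k = 3) (u : Fin 4) :
    T.perm (M.opened j k).1 ((M.opened j k).2 k) ((M.opened j k).2 u) =
      (M.opened (j + 1) k).2 u :=
  congrArg (fun x => x.2 u) (M.across_opened j hk)

theorem nbr_inl_opened (j : Fin 2) {k : Fin 4} (hk : k = 2 ∨ k = 3) :
    T'.nbr (Sum.inl (M.opened j k).1) ((M.opened j k).2 k) = Sum.inr j :=
  congrArg Prod.fst (M.across_inl_opened j hk)

theorem perm_inl_opened (j : Fin 2) {k : Fin 4} (hk : k = 2 ∨ k = 3) (u : Fin 4) :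
    T'.perm (Sum.inl (M.opened j k).1) ((M.opened j k).2 k) ((M.opened j k).2 u) = M.lab j u :=
  congrArg (fun x => x.2 u) (M.across_inl_opened j hk)

theorem nbr_inr_outer (j : Fin 2) {k : Fin 4} (hk : k = 2 ∨ k = 3) :
    T'.nbr (Sum.inr j) (M.lab j k) = Sum.inl (M.opened j k).1 :=
  congrArg Prod.fst (M.across_inr_outer j hk)

theorem perm_inr_outer (j : Fin 2) {k : Fin 4} (hk : k = 2 ∨ k = 3) (u : Fin 4) :
    T'.perm (Sum.inr j) (M.lab j k) (M.lab j u) = (M.opened j k).2 u :=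
  congrArg (fun x => x.2 u) (M.across_inr_outer j hk)

theorem nbr_inr_inner (j : Fin 2) {k : Fin 4} (hk : k = 0 ∨ k = 1) :
    T'.nbr (Sum.inr j) (M.lab j k) = Sum.inr (j + 1) :=
  congrArg Prod.fst (M.across_inr_inner j hk)

theorem perm_inr_inner (j : Fin 2) {k : Fin 4} (hk : k = 0 ∨ k = 1) (u : Fin 4) :
    T'.perm (Sum.inr j) (M.lab j k) (M.lab j u) = M.lab (j + 1) u :=
  congrArg (fun x => x.2 u) (M.across_inr_inner j hk)

theorem opened_or_old (t : ι) (f : Fin 4) :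
    (∃ j k, (k = 2 ∨ k = 3) ∧ t = (M.opened j k).1 ∧ f = (M.opened j k).2 k) ∨
      (T'.nbr (Sum.inl t) f = Sum.inl (T.nbr t f) ∧ T'.perm (Sum.inl t) f = T.perm t f) := by
  by_cases h : ∃ j k, (k = 2 ∨ k = 3) ∧ t = (M.opened j k).1 ∧ f = (M.opened j k).2 k
  · exact Or.inl h
  · right
    push Not at h
    refine M.old_faces t f ?_ ?_ ?_ ?_ <;> intro h' <;> rw [Prod.mk.injEq] at h'
    · exact h 0 3 (Or.inr rfl) h'.1 h'.2
    · exact h 0 2 (Or.inl rfl) h'.1 h'.2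
    · exact h 1 3 (Or.inr rfl) h'.1 h'.2
    · exact h 1 2 (Or.inl rfl) h'.1 h'.2

/-! ### The edges before and after the move -/

theorem edgeClass_opened_succ (j : Fin 2) {k u v : Fin 4} (hk : k = 2 ∨ k = 3) (hu : u ≠ k)
    (hv : v ≠ k) :
    T.edgeClass (M.opened (j + 1) k).1 ((M.opened (j + 1) k).2 u) ((M.opened (j + 1) k).2 v) =
      T.edgeClass (M.opened j k).1 ((M.opened j k).2 u) ((M.opened j k).2 v) := by
  rw [← M.across_opened j hk]
  exact T.edgeClass_across _ hu hv

theorem edgeClass_y {u v : Fin 4} (hu : u = 0 ∨ u = 1) (hv : v = 0 ∨ v = 1) :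
    T.edgeClass M.y.1 (M.y.2 u) (M.y.2 v) = T.edgeClass M.x.1 (M.x.2 u) (M.x.2 v) := by
  rw [M.y_eq]
  induction M.steps with
  | zero => rfl
  | succ n ih =>
    rw [Function.iterate_succ_apply', ← ih]
    generalize T.turn^[n] M.x = w
    have h (u : Fin 4) (hu : u = 0 ∨ u = 1) : (T.turn w).2 u = (T.across w 2).2 u := by
      rcases hu with rfl | rfl
      · exact (T.turn_snd w).1
      · exact (T.turn_snd w).2.1
    rw [h u hu, h v hv]
    exact T.edgeClass_across w (by omega) (by omega)

theorem edgeClass_opened (i j : Fin 2) {k l u v : Fin 4} (hk : k = 2 ∨ k = 3) (hl : l = 2 ∨ l = 3)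
    (huk : u ≠ k) (hvk : v ≠ k) (hul : u ≠ l) (hvl : v ≠ l) :
    T.edgeClass (M.opened i k).1 ((M.opened i k).2 u) ((M.opened i k).2 v) =
      T.edgeClass (M.opened j l).1 ((M.opened j l).2 u) ((M.opened j l).2 v) := by
  have h0 (i : Fin 2) (k : Fin 4) (hk : k = 2 ∨ k = 3) (huk : u ≠ k) (hvk : v ≠ k) :
      T.edgeClass (M.opened i k).1 ((M.opened i k).2 u) ((M.opened i k).2 v) =
        T.edgeClass (M.opened 0 k).1 ((M.opened 0 k).2 u) ((M.opened 0 k).2 v) := by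
    fin_cases i
    · rfl
    · exact M.edgeClass_opened_succ 0 hk huk hvk
  rw [h0 i k hk huk hvk, h0 j l hl hul hvl]
  by_cases hkl : k = l
  · rw [hkl]
  · have hy := M.edgeClass_y (u := u) (v := v) (by omega) (by omega)
    rcases hk with rfl | rfl <;> rcases hl with rfl | rfl <;> simp [opened] at hkl ⊢
    · exact hy
    · exact hy.symm

/-- The edge `uv` of the new tetrahedron `j`. -/
def newEdge (j : Fin 2) (u v : Fin 4) : Quot T'.EdgeStep :=
  T'.edgeClass (Sum.inr j) (M.lab j u) (M.lab j v)

theorem newEdge_symm (j : Fin 2) (u v : Fin 4) : M.newEdge j u v = M.newEdge j v u :=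
  T'.edgeClass_symm _ _ _

theorem newEdge_succ (j : Fin 2) {k u v : Fin 4} (hk : k = 0 ∨ k = 1) (hu : u ≠ k) (hv : v ≠ k) :
    M.newEdge (j + 1) u v = M.newEdge j u v := by
  have h := T'.edgeClass_across (Sum.inr j, M.lab j) hu hv
  rw [M.across_inr_inner j hk] at h
  exact h

theorem edgeClass_inl_opened (j : Fin 2) {k u v : Fin 4} (hk : k = 2 ∨ k = 3) (hu : u ≠ k)
    (hv : v ≠ k) :
    T'.edgeClass (Sum.inl (M.opened j k).1) ((M.opened j k).2 u) ((M.opened j k).2 v) =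
      M.newEdge j u v := by
  have h := T'.edgeClass_across (Sum.inl (M.opened j k).1, (M.opened j k).2) hu hv
  rw [M.across_inl_opened j hk] at h
  exact h.symm

theorem newEdge_one {u v : Fin 4} (h : ¬ (u = 0 ∧ v = 1)) (h' : ¬ (u = 1 ∧ v = 0)) :
    M.newEdge 1 u v = M.newEdge 0 u v := by
  have key : ∀ u v : Fin 4, ¬ (u = 0 ∧ v = 1) → ¬ (u = 1 ∧ v = 0) →
      (u ≠ 0 ∧ v ≠ 0) ∨ (u ≠ 1 ∧ v ≠ 1) := by decide
  rcases key u v h h' with ⟨hu, hv⟩ | ⟨hu, hv⟩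
  · exact M.newEdge_succ 0 (Or.inl rfl) hu hv
  · exact M.newEdge_succ 0 (Or.inr rfl) hu hv

/-- A function of the edges of `T'` that agrees on the two edges `AB` descends to `T`. -/
theorem exists_descent {N : Type*} (c' : Quot T'.EdgeStep → N)
    (h : c' (M.newEdge 0 0 1) = c' (M.newEdge 1 0 1)) :
    ∃ c : Quot T.EdgeStep → N, ∀ t a b, c (T.edgeClass t a b) = c' (T'.edgeClass (Sum.inl t) a b) := by
  refine ⟨Quot.lift (fun x => c' (T'.edgeClass (Sum.inl x.1) x.2.1 x.2.2)) ?_, fun _ _ _ => rfl⟩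
  have h01 (u v : Fin 4) (i j : Fin 2) : c' (M.newEdge i u v) = c' (M.newEdge j u v) := by
    have h1 : c' (M.newEdge 0 u v) = c' (M.newEdge 1 u v) := by
      by_cases h1 : u = 0 ∧ v = 1
      · rw [h1.1, h1.2, h]
      · by_cases h2 : u = 1 ∧ v = 0
        · rw [h2.1, h2.2, M.newEdge_symm, h, M.newEdge_symm]
        · rw [M.newEdge_one h1 h2]
    fin_cases i <;> fin_cases j
    · rfl
    · exact h1
    · exact h1.symm
    · rfl
  rintro _ _ (⟨t, a, b⟩ | ⟨t, f, a, b, ha, hb⟩)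
  · simp only [T'.edgeClass_symm (Sum.inl t) a b]
  · rcases M.opened_or_old t f with ⟨j, k, hk, rfl, rfl⟩ | ⟨h1, h2⟩
    · obtain ⟨u, rfl⟩ := (M.opened j k).2.surjective a
      obtain ⟨v, rfl⟩ := (M.opened j k).2.surjective b
      have hu : u ≠ k := fun h => ha (by rw [h])
      have hv : v ≠ k := fun h => hb (by rw [h])
      simp only [M.nbr_opened j hk, M.perm_opened j hk, M.edgeClass_inl_opened _ hk hu hv]
      exact h01 u v _ _
    · have h3 := Quot.sound (r := T'.EdgeStep) (.glue (Sum.inl t) f a b ha hb)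
      rw [h1, h2] at h3
      exact congrArg c' h3

/-- The edge of `T` from which an edge of `T'` arises; there is none for the edge `CD`. -/
def projFlag : (ι ⊕ Fin 2) × Fin 4 × Fin 4 → Option (Quot T.EdgeStep)
  | (Sum.inl t, a, b) => some (T.edgeClass t a b)
  | (Sum.inr j, a, b) =>
    let u := (M.lab j).symm a
    let v := (M.lab j).symm b
    if u ≠ 3 ∧ v ≠ 3 then
      some (T.edgeClass (M.opened j 3).1 ((M.opened j 3).2 u) ((M.opened j 3).2 v))
    else if u ≠ 2 ∧ v ≠ 2 then
      some (T.edgeClass (M.opened j 2).1 ((M.opened j 2).2 u) ((M.opened j 2).2 v))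
    else none

theorem projFlag_inr (j : Fin 2) {k u v : Fin 4} (hk : k = 2 ∨ k = 3) (hu : u ≠ k) (hv : v ≠ k) :
    M.projFlag (Sum.inr j, M.lab j u, M.lab j v) =
      some (T.edgeClass (M.opened j k).1 ((M.opened j k).2 u) ((M.opened j k).2 v)) := by
  simp only [projFlag, Equiv.symm_apply_apply]
  split_ifs with h1 h2
  · rw [M.edgeClass_opened j j (Or.inr rfl) hk h1.1 h1.2 hu hv]
  · rw [M.edgeClass_opened j j (Or.inl rfl) hk h2.1 h2.2 hu hv]
  · rcases hk with rfl | rfl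
    · exact absurd ⟨hu, hv⟩ h2
    · exact absurd ⟨hu, hv⟩ h1

theorem projFlag_inr_none (j : Fin 2) {u v : Fin 4} (h3 : ¬ (u ≠ 3 ∧ v ≠ 3))
    (h2 : ¬ (u ≠ 2 ∧ v ≠ 2)) : M.projFlag (Sum.inr j, M.lab j u, M.lab j v) = none := by
  simp only [projFlag, Equiv.symm_apply_apply, if_neg h3, if_neg h2]

/-- The edge of `T` from which an edge of `T'` arises; there is none for the edge `CD`. -/
def proj : Quot T'.EdgeStep → Option (Quot T.EdgeStep) :=
  Quot.lift M.projFlag (by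
    rintro _ _ (⟨t | j, a, b⟩ | ⟨t | j, f, a, b, ha, hb⟩)
    · exact congrArg some (T.edgeClass_symm t a b)
    · obtain ⟨u, rfl⟩ := (M.lab j).surjective a
      obtain ⟨v, rfl⟩ := (M.lab j).surjective b
      by_cases h3 : u ≠ 3 ∧ v ≠ 3
      · rw [M.projFlag_inr j (Or.inr rfl) h3.1 h3.2, M.projFlag_inr j (Or.inr rfl) h3.2 h3.1,
          T.edgeClass_symm]
      by_cases h2 : u ≠ 2 ∧ v ≠ 2
      · rw [M.projFlag_inr j (Or.inl rfl) h2.1 h2.2, M.projFlag_inr j (Or.inl rfl) h2.2 h2.1,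
          T.edgeClass_symm]
      rw [M.projFlag_inr_none j h3 h2, M.projFlag_inr_none j (by tauto) (by tauto)]
    · rcases M.opened_or_old t f with ⟨j, k, hk, rfl, rfl⟩ | ⟨h1, h2⟩
      · obtain ⟨u, rfl⟩ := (M.opened j k).2.surjective a
        obtain ⟨v, rfl⟩ := (M.opened j k).2.surjective b
        rw [M.nbr_inl_opened j hk, M.perm_inl_opened j hk, M.perm_inl_opened j hk,
          M.projFlag_inr j hk (fun h => ha (by rw [h])) (fun h => hb (by rw [h]))]
        rfl
      · rw [h1, h2]
        exact congrArg some (Quot.sound (.glue t f a b ha hb))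
    · obtain ⟨k, rfl⟩ := (M.lab j).surjective f
      obtain ⟨u, rfl⟩ := (M.lab j).surjective a
      obtain ⟨v, rfl⟩ := (M.lab j).surjective b
      have hu : u ≠ k := fun h => ha (by rw [h])
      have hv : v ≠ k := fun h => hb (by rw [h])
      by_cases hk : k = 2 ∨ k = 3
      · rw [M.nbr_inr_outer j hk, M.perm_inr_outer j hk, M.perm_inr_outer j hk,
          M.projFlag_inr j hk hu hv]
        rfl
      · have hk' : k = 0 ∨ k = 1 := by omega
        rw [M.nbr_inr_inner j hk', M.perm_inr_inner j hk', M.perm_inr_inner j hk']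
        by_cases h3 : u ≠ 3 ∧ v ≠ 3
        · rw [M.projFlag_inr _ (Or.inr rfl) h3.1 h3.2, M.projFlag_inr _ (Or.inr rfl) h3.1 h3.2,
            M.edgeClass_opened_succ j (Or.inr rfl) h3.1 h3.2]
        by_cases h2 : u ≠ 2 ∧ v ≠ 2
        · rw [M.projFlag_inr _ (Or.inl rfl) h2.1 h2.2, M.projFlag_inr _ (Or.inl rfl) h2.1 h2.2,
            M.edgeClass_opened_succ j (Or.inl rfl) h2.1 h2.2]
        rw [M.projFlag_inr_none _ h3 h2, M.projFlag_inr_none _ h3 h2])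

theorem proj_inl (t : ι) (a b : Fin 4) :
    M.proj (T'.edgeClass (Sum.inl t) a b) = some (T.edgeClass t a b) := rfl

theorem proj_newEdge (j : Fin 2) {k u v : Fin 4} (hk : k = 2 ∨ k = 3) (hu : u ≠ k) (hv : v ≠ k) :
    M.proj (M.newEdge j u v) =
      some (T.edgeClass (M.opened j k).1 ((M.opened j k).2 u) ((M.opened j k).2 v)) :=
  M.projFlag_inr j hk hu hv

theorem proj_newEdge_CD (j : Fin 2) : M.proj (M.newEdge j 2 3) = none :=
  M.projFlag_inr_none j (by decide) (by decide)

/-- In the pillow only `CD` lies on neither outer face; every other edge of a new tetrahedron is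
also an edge of an old one. -/
theorem edge_cases (e : T'.Edge) :
    e.1 = M.newEdge 0 2 3 ∨ ∃ t a b, a ≠ b ∧ e.1 = T'.edgeClass (Sum.inl t) a b := by
  obtain ⟨_, t | j, a, b, hab, rfl⟩ := e
  · exact Or.inr ⟨t, a, b, hab, rfl⟩
  · obtain ⟨u, rfl⟩ := (M.lab j).surjective a
    obtain ⟨v, rfl⟩ := (M.lab j).surjective b
    have huv : u ≠ v := fun h => hab (by rw [h])
    have key : ∀ u v : Fin 4, u ≠ v → (u = 2 ∧ v = 3) ∨ (u = 3 ∧ v = 2) ∨ (u ≠ 3 ∧ v ≠ 3) ∨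
        (u ≠ 2 ∧ v ≠ 2) := by decide
    have hcd (j : Fin 2) : M.newEdge j 2 3 = M.newEdge 0 2 3 := by
      fin_cases j
      · rfl
      · exact M.newEdge_one (by decide) (by decide)
    rcases key u v huv with ⟨rfl, rfl⟩ | ⟨rfl, rfl⟩ | ⟨hu, hv⟩ | ⟨hu, hv⟩
    · exact Or.inl (hcd j)
    · exact Or.inl ((M.newEdge_symm j 3 2).trans (hcd j))
    · exact Or.inr ⟨_, _, _, by simpa using huv, (M.edgeClass_inl_opened j (Or.inr rfl) hu hv).symm⟩
    · exact Or.inr ⟨_, _, _, by simpa using huv, (M.edgeClass_inl_opened j (Or.inl rfl) hu hv).symm⟩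

/-- The function that merges the two edges `AB` and is otherwise the identity descends to the old
edges. Old edges can therefore only come apart along `AB`. -/
theorem edgeClass_inl_eq {t s : ι} {a b c d : Fin 4} (h : T.edgeClass t a b = T.edgeClass s c d) :
    T'.edgeClass (Sum.inl t) a b = T'.edgeClass (Sum.inl s) c d ∨
      ((∃ i, T'.edgeClass (Sum.inl t) a b = M.newEdge i 0 1) ∧
        ∃ j, T'.edgeClass (Sum.inl s) c d = M.newEdge j 0 1) := by
  classical
  obtain ⟨f, hf⟩ := M.exists_descent
    (fun e => if e = M.newEdge 1 0 1 then M.newEdge 0 0 1 else e) (by simp)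
  have h1 := hf t a b
  rw [h, hf] at h1
  split_ifs at h1 with h2 h3 h3
  · exact Or.inr ⟨⟨1, h3⟩, ⟨1, h2⟩⟩
  · exact Or.inr ⟨⟨0, h1.symm⟩, ⟨1, h2⟩⟩
  · exact Or.inr ⟨⟨1, h3⟩, ⟨0, h1⟩⟩
  · exact Or.inl h1.symm

/-- The two edges `AB` of the new triangulation. -/
def edgeAB (j : Fin 2) : T'.Edge :=
  ⟨M.newEdge j 0 1, Sum.inr j, _, _, (M.lab j).injective.ne (by decide), rfl⟩

/-- The new edge `CD`. -/
def edgeCD : T'.Edge :=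
  ⟨M.newEdge 0 2 3, Sum.inr 0, _, _, (M.lab 0).injective.ne (by decide), rfl⟩

/-- The edge `AB` of the old triangulation. -/
def oldAB : T.Edge :=
  ⟨T.edgeClass (M.opened 0 3).1 ((M.opened 0 3).2 0) ((M.opened 0 3).2 1), _, _, _,
    (M.opened 0 3).2.injective.ne (by decide), rfl⟩

theorem proj_edgeAB (j : Fin 2) : M.proj (M.edgeAB j).1 = some M.oldAB.1 :=
  (M.proj_newEdge j (Or.inr rfl) (by decide) (by decide)).trans
    (congrArg some (M.edgeClass_opened j 0 (Or.inr rfl) (Or.inr rfl) (by decide) (by decide)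
      (by decide) (by decide)))

theorem proj_edgeCD : M.proj M.edgeCD.1 = none := M.proj_newEdge_CD 0

theorem eq_edgeCD {e : T'.Edge} (h : M.proj e.1 = none) : e = M.edgeCD := by
  rcases M.edge_cases e with h1 | ⟨t, a, b, hab, h1⟩
  · exact Subtype.ext h1
  · rw [h1, proj_inl] at h
    exact absurd h (by simp)

theorem exists_proj {e : T'.Edge} (h : e ≠ M.edgeCD) : ∃ e₀ : T.Edge, M.proj e.1 = some e₀.1 := by
  rcases M.edge_cases e with h1 | ⟨t, a, b, hab, h1⟩
  · exact absurd (Subtype.ext h1) h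
  · exact ⟨⟨_, t, a, b, hab, rfl⟩, by rw [h1, proj_inl]⟩

theorem eq_or_edgeAB {e f : T'.Edge} (h : M.proj e.1 = M.proj f.1) :
    e = f ∨ ((∃ i, e = M.edgeAB i) ∧ ∃ j, f = M.edgeAB j) := by
  rcases M.edge_cases e with h1 | ⟨t, a, b, hab, h1⟩
  · have h2 : e = M.edgeCD := Subtype.ext h1
    rw [h2, proj_edgeCD] at h
    exact Or.inl (h2.trans (M.eq_edgeCD h.symm).symm)
  · rcases M.edge_cases f with h2 | ⟨s, c, d, hcd, h2⟩
    · have h3 : f = M.edgeCD := Subtype.ext h2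
      rw [h3, proj_edgeCD] at h
      exact Or.inl ((M.eq_edgeCD h).trans h3.symm)
    · rw [h1, h2, proj_inl, proj_inl, Option.some.injEq] at h
      rcases M.edgeClass_inl_eq h with h3 | ⟨⟨i, hi⟩, j, hj⟩
      · exact Or.inl (Subtype.ext (h1.trans (h3.trans h2.symm)))
      · exact Or.inr ⟨⟨i, Subtype.ext (h1.trans hi)⟩, j, Subtype.ext (h2.trans hj)⟩

/-- By counting: if the two coincided, the old edges together with `CD` would cover the new ones,
giving at most `n + 1` edges where `card_edge` requires `n + 2`. -/
theorem edgeAB_ne [Finite ι] : M.edgeAB 0 ≠ M.edgeAB 1 := by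
  intro h
  have hrep (e : T.Edge) : ∃ e' : T'.Edge, M.proj e'.1 = some e.1 := by
    obtain ⟨_, t, a, b, hab, rfl⟩ := e
    exact ⟨⟨_, Sum.inl t, a, b, hab, rfl⟩, rfl⟩
  choose l hl using hrep
  have hall (i j : Fin 2) : M.edgeAB i = M.edgeAB j := by
    fin_cases i <;> fin_cases j
    · rfl
    · exact h
    · exact h.symm
    · rfl
  have hsurj : Function.Surjective (fun o : Option T.Edge => o.elim M.edgeCD l) := by
    intro e
    by_cases he : e = M.edgeCD
    · exact ⟨none, he.symm⟩
    · obtain ⟨e₀, h0⟩ := M.exists_proj he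
      refine ⟨some e₀, ?_⟩
      rcases M.eq_or_edgeAB ((hl e₀).trans h0.symm) with h1 | ⟨⟨i, hi⟩, j, hj⟩
      · exact h1
      · exact hi.trans ((hall i j).trans hj.symm)
  have h1 := Nat.card_le_card_of_surjective _ hsurj
  rw [T'.card_edge, Finite.card_option, T.card_edge, Nat.card_sum] at h1
  simp at h1

theorem edgeAB_injective [Finite ι] : Function.Injective M.edgeAB := by
  intro i j h
  fin_cases i <;> fin_cases j
  · rfl
  · exact absurd h M.edgeAB_ne
  · exact absurd h.symm M.edgeAB_ne
  · rfl

theorem exists_lift [Finite ι] (e : T.Edge) (j : Fin 2) :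
    ∃ e' : T'.Edge, M.proj e'.1 = some e.1 ∧ e' ≠ M.edgeAB j := by
  by_cases h : e = M.oldAB
  · refine ⟨M.edgeAB (j + 1), by rw [h, proj_edgeAB], fun h' => ?_⟩
    have := M.edgeAB_injective h'
    fin_cases j <;> simp at this
  · obtain ⟨_, t, a, b, hab, rfl⟩ := e
    refine ⟨⟨_, Sum.inl t, a, b, hab, rfl⟩, rfl, fun h' => h ?_⟩
    have h1 := M.proj_edgeAB j
    rw [← h'] at h1
    exact Subtype.ext (Option.some.inj h1)

theorem eq_of_proj_eq {e f : T'.Edge} {j : Fin 2} (h : M.proj e.1 = M.proj f.1)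
    (he : e ≠ M.edgeAB j) (hf : f ≠ M.edgeAB j) : e = f := by
  rcases M.eq_or_edgeAB h with h1 | ⟨⟨i, rfl⟩, l, rfl⟩
  · exact h1
  · have hi : i ≠ j := fun h => he (by rw [h])
    have hl : l ≠ j := fun h => hf (by rw [h])
    have : i = l := by omega
    rw [this]

/-- The pullback of an edge function to the new triangulation, with the value `m` at `CD`. -/
def pullback {N : Type*} (c : Quot T.EdgeStep → N) (m : N) (e : Quot T'.EdgeStep) : N :=
  (M.proj e).elim m c

theorem typeSum_inl {N : Type*} [AddCommMonoid N] {c' : Quot T'.EdgeStep → N}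
    {c : Quot T.EdgeStep → N}
    (h : ∀ t a b, c (T.edgeClass t a b) = c' (T'.edgeClass (Sum.inl t) a b)) (t : ι) (q : Fin 3) :
    T'.typeSum c' (Sum.inl t) q = T.typeSum c t q :=
  Finset.sum_congr rfl fun _ _ => (h _ _ _).symm

end ZeroTwoMove

end IdealTriangulation

/-! ### Determinants -/

/-- Each determinant is an integral multiple of the other. Unless both vanish, the two integers are
inverse to each other, hence both `1` or both `-1`. -/
theorem det_eq_or_neg_of_span {n : Type*} [Fintype n] [DecidableEq n] {A B : Matrix n n ℂ}
    (hA : ∀ i, A i ∈ Submodule.span ℤ (Set.range B))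
    (hB : ∀ i, B i ∈ Submodule.span ℤ (Set.range A)) : A.det = B.det ∨ A.det = -B.det := by
  have key {A B : Matrix n n ℂ} (hA : ∀ i, A i ∈ Submodule.span ℤ (Set.range B)) :
      ∃ m : ℤ, A.det = m * B.det := by
    have hA' := fun i => (Submodule.mem_span_range_iff_exists_fun ℤ).1 (hA i)
    choose N hN using hA'
    refine ⟨(Matrix.of N).det, ?_⟩
    have : A = (Matrix.of N).map (Int.castRingHom ℂ) * B := by
      ext i k
      rw [← hN, Matrix.mul_apply]
      simp
    rw [this, Matrix.det_mul, ← RingHom.mapMatrix_apply, ← RingHom.map_det]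
    simp
  obtain ⟨a, ha⟩ := key hA
  obtain ⟨b, hb⟩ := key hB
  by_cases h : B.det = 0
  · left
    rw [ha, h, mul_zero]
  · have h1 : ((a * b : ℤ) : ℂ) = 1 := by
      rw [ha] at hb
      push_cast
      refine mul_right_cancel₀ h ?_
      linear_combination -hb
    have h2 : a * b = 1 := by exact_mod_cast h1
    rcases Int.eq_one_or_neg_one_of_mul_eq_one h2 with rfl | rfl
    · left; simpa using ha
    · right; simpa using ha

theorem det_eq_mul_det_of_two_rows {n : Type*} [Fintype n] [DecidableEq n]
    (A : Matrix (n ⊕ Fin 2) (n ⊕ Fin 2) ℂ) {l u d : ℂ} (hd : d ≠ 0)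
    (h0 : ∀ t, A (Sum.inr 0) (Sum.inl t) = 0) (h1 : A (Sum.inr 0) (Sum.inr 0) = u)
    (h2 : A (Sum.inr 0) (Sum.inr 1) = l * u)
    (h3 : A (Sum.inr 1) (Sum.inr 1) - l * A (Sum.inr 1) (Sum.inr 0) = d) :
    A.det = u * d * (Matrix.of fun i t => A (Sum.inl i) (Sum.inl t) -
      (A (Sum.inl i) (Sum.inr 1) - l * A (Sum.inl i) (Sum.inr 0)) / d *
        A (Sum.inr 1) (Sum.inl t)).det := by
  -- Column operations of determinant one: subtract `l` times the first new column from the second,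
  -- then use the entry `d` to clear the old columns in the last row. The row `(0, u, l * u)`
  -- becomes `(0, u, 0)`.
  let N : Matrix (n ⊕ Fin 2) (n ⊕ Fin 2) ℂ := Matrix.fromBlocks 1 0
    (Matrix.of fun j t => (![l, -1] : Fin 2 → ℂ) j * A (Sum.inr 1) (Sum.inl t) / d)
    !![1, -l; 0, 1]
  have hN : N.det = 1 := by
    rw [Matrix.det_fromBlocks_zero₁₂, Matrix.det_one, Matrix.det_fin_two]
    simp
  have hl (i : n ⊕ Fin 2) (t : n) : (A * N) i (Sum.inl t) = A i (Sum.inl t) -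
      (A i (Sum.inr 1) - l * A i (Sum.inr 0)) / d * A (Sum.inr 1) (Sum.inl t) := by
    rw [Matrix.mul_apply, Fintype.sum_sum_type, Fin.sum_univ_two]
    simp [N, Matrix.one_apply]
    ring
  have hr0 (i : n ⊕ Fin 2) : (A * N) i (Sum.inr 0) = A i (Sum.inr 0) := by
    rw [Matrix.mul_apply, Fintype.sum_sum_type, Fin.sum_univ_two]
    simp [N]
  have hr1 (i : n ⊕ Fin 2) :
      (A * N) i (Sum.inr 1) = A i (Sum.inr 1) - l * A i (Sum.inr 0) := by
    rw [Matrix.mul_apply, Fintype.sum_sum_type, Fin.sum_univ_two]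
    simp [N]
    ring
  have hAN : A * N = Matrix.fromBlocks (Matrix.of fun i t => A (Sum.inl i) (Sum.inl t) -
      (A (Sum.inl i) (Sum.inr 1) - l * A (Sum.inl i) (Sum.inr 0)) / d *
        A (Sum.inr 1) (Sum.inl t)) (Matrix.of fun i j => (A * N) (Sum.inl i) (Sum.inr j)) 0
      !![u, 0; A (Sum.inr 1) (Sum.inr 0), d] := by
    ext (i | i) (t | j)
    · rw [hl]; rfl
    · rfl
    · rw [hl]
      fin_cases i
      · simp [h0, h1, h2]
      · simp [h3, hd]
    · fin_cases i <;> fin_cases j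
      · exact (hr0 _).trans h1
      · exact (hr1 (Sum.inr 0)).trans
          (by rw [h1, h2, sub_self] : A (Sum.inr 0) (Sum.inr 1) - l * A (Sum.inr 0) (Sum.inr 0) = 0)
      · exact hr0 _
      · exact (hr1 _).trans h3
  have h4 := Matrix.det_mul A N
  rw [hN, mul_one] at h4
  rw [← h4, hAN, Matrix.det_fromBlocks_zero₂₁, Matrix.det_fin_two]
  simp
  ring

/-- Row operations with a block unitriangular matrix; this is what makes edge rows added to curve
rows harmless. -/
theorem det_eq_of_sub_mem_span {n E κ : Type*} [Fintype n] [DecidableEq n] [Finite E] [Finite κ]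
    (r : n ≃ E ⊕ κ) (f : E → n → ℂ) (g g' : κ → n → ℂ)
    (h : ∀ a, g' a - g a ∈ Submodule.span ℂ (Set.range f)) :
    (Matrix.of fun i => Sum.elim f g' (r i)).det = (Matrix.of fun i => Sum.elim f g (r i)).det := by
  classical
  have := Fintype.ofFinite E
  have := Fintype.ofFinite κ
  simp only [Submodule.mem_span_range_iff_exists_fun] at h
  choose N hN using h
  let P : Matrix (E ⊕ κ) (E ⊕ κ) ℂ := Matrix.fromBlocks 1 0 (Matrix.of N) 1
  have h1 : (Matrix.of fun i => Sum.elim f g' (r i)) =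
      P.submatrix r r * Matrix.of fun i => Sum.elim f g (r i) := by
    ext i t
    rw [Matrix.mul_apply]
    simp only [Matrix.submatrix_apply, Matrix.of_apply]
    rw [Equiv.sum_comp r (fun x => P (r i) x * Sum.elim f g x t), Fintype.sum_sum_type]
    rcases r i with e | a
    · simp [P, Matrix.one_apply]
    · have := congrFun (hN a) t
      simp [P, Matrix.one_apply, Finset.sum_apply] at this ⊢
      rw [this]
      ring
  rw [h1, Matrix.det_mul, Matrix.det_submatrix_equiv_self, Matrix.det_fromBlocks_zero₁₂]
  simp

/-! ### The rows of the matrix in the 1-loop invariant -/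

/-- The weights of the edges of a tetrahedron of shape `z` in the 1-loop invariant. -/
def shapeWeight (z : ℂ) : Fin 3 → ℂ := ![1 - z⁻¹, -1, z⁻¹]

theorem sum_shapeWeight (z : ℂ) : ∑ q, shapeWeight z q = 0 := by
  rw [Fin.sum_univ_three]
  simp [shapeWeight]
  ring

theorem shapeWeight_ne_zero {z : ℂ} (h0 : z ≠ 0) (h1 : z ≠ 1) (q : Fin 3) :
    shapeWeight z q ≠ 0 := by
  have h3 : 1 - z⁻¹ ≠ 0 := by
    rw [sub_ne_zero]
    exact fun h => h1 (inv_eq_one.1 h.symm)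
  fin_cases q <;> simp [shapeWeight, h0, h3]

/-- The cyclic symmetry of the weights: up to a common factor they have the same form whichever of
the three shapes is taken as the parameter. -/
theorem shapeWeight_eq {z : ℂ} (h0 : z ≠ 0) (h1 : z ≠ 1) (q : Fin 3) :
    shapeWeight z q = (1 - (shape z q)⁻¹) * -shapeWeight z (q + 1) ∧
      shapeWeight z (q + 2) = (shape z q)⁻¹ * -shapeWeight z (q + 1) := by
  have h2 : 1 - z ≠ 0 := sub_ne_zero.2 h1.symm
  have h3 : z - 1 ≠ 0 := sub_ne_zero.2 h1
  have h4 : 1 - z⁻¹ ≠ 0 := by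
    rw [sub_ne_zero]
    exact fun h => h1 (inv_eq_one.1 h.symm)
  fin_cases q
  · simp [shapeWeight, shape]
  · simp [shapeWeight, shape]
    constructor <;> field_simp <;> ring
  · simp [shapeWeight, shape]
    constructor <;> (field_simp; ring)

/-- With `s` the shape of the first tetrahedron, the normalized weights are `(1 - s⁻¹, -1, s⁻¹)` and
`(1 - s, -1, s)`. Multiplying the former by `-s` gives the latter with the last two entries
exchanged, as befits opposite orientations. -/
theorem exists_shapeWeight_proportional {a b : ℂ} (ha0 : a ≠ 0) (ha1 : a ≠ 1) (hb0 : b ≠ 0)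
    (hb1 : b ≠ 1) {q r : Fin 3} (h : shape a q * shape b r = 1) :
    ∃ l : ℂ, l ≠ 0 ∧ shapeWeight b r = l * shapeWeight a q ∧
      shapeWeight b (r + 2) = l * shapeWeight a (q + 1) ∧
      shapeWeight b (r + 1) = l * shapeWeight a (q + 2) := by
  obtain ⟨a1, a2⟩ := shapeWeight_eq ha0 ha1 q
  obtain ⟨b1, b2⟩ := shapeWeight_eq hb0 hb1 r
  have hA := shapeWeight_ne_zero ha0 ha1 (q + 1)
  have hB := shapeWeight_ne_zero hb0 hb1 (r + 1)
  have hs := shape_ne_zero ha0 ha1 q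
  have h1 : (shape b r)⁻¹ = shape a q := inv_eq_of_mul_eq_one_left h
  rw [h1] at b1 b2
  refine ⟨-(shape a q * shapeWeight b (r + 1)) / shapeWeight a (q + 1),
    div_ne_zero (neg_ne_zero.2 (mul_ne_zero hs hB)) hA, ?_, ?_, ?_⟩
  · rw [a1, b1]
    field_simp
    ring
  · rw [b2]
    field_simp
  · rw [a2]
    field_simp

namespace IdealTriangulation

variable {ι : Type*} (T : IdealTriangulation ι)

/-- The row of a combination of edges in the matrix of the 1-loop invariant. -/
def loopRow (z : ι → ℂ) (c : Quot T.EdgeStep → ℂ) (t : ι) : ℂ :=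
  ∑ q, T.typeSum c t q * shapeWeight (z t) q

/-- The row of an edge. -/
def edgeLoopRow (z : ι → ℂ) (e : T.Edge) (t : ι) : ℂ :=
  ∑ q, (T.incidence e t q : ℂ) * shapeWeight (z t) q

/-- The row of a curve. -/
def curveLoopRow {T : IdealTriangulation ι} (z : ι → ℂ) (γ : NormalCurve T) (t : ι) : ℂ :=
  ∑ q, (γ.turning t q : ℂ) * shapeWeight (z t) q

open Classical in
theorem edgeLoopRow_eq (z : ι → ℂ) (e : T.Edge) :
    T.edgeLoopRow z e = T.loopRow z (fun x => if x = e.1 then 1 else 0) := by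
  funext t
  simp only [edgeLoopRow, loopRow, incidence_eq_typeSum]

theorem loopRow_add (z : ι → ℂ) (c d : Quot T.EdgeStep → ℂ) :
    T.loopRow z (fun e => c e + d e) = T.loopRow z c + T.loopRow z d := by
  funext t
  simp only [loopRow, GluedTetrahedra.typeSum_add, add_mul, Finset.sum_add_distrib, Pi.add_apply]

theorem loopRow_mul (z : ι → ℂ) (m : ℂ) (c : Quot T.EdgeStep → ℂ) :
    T.loopRow z (fun e => m * c e) = m • T.loopRow z c := by
  funext t
  simp only [loopRow, GluedTetrahedra.typeSum_mul, mul_assoc, Finset.mul_sum, Pi.smul_apply,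
    smul_eq_mul]

theorem loopRow_congr (z : ι → ℂ) {c d : Quot T.EdgeStep → ℂ} (h : ∀ e : T.Edge, c e.1 = d e.1) :
    T.loopRow z c = T.loopRow z d := by
  funext t
  simp only [loopRow, T.typeSum_congr h]

theorem loopRow_mem_span [Finite ι] (z : ι → ℂ) (c : Quot T.EdgeStep → ℂ) :
    T.loopRow z c ∈ Submodule.span ℂ (Set.range (T.edgeLoopRow z)) := by
  have := Fintype.ofFinite T.Edge
  have h : T.loopRow z c = ∑ e : T.Edge, c e.1 • T.edgeLoopRow z e := by
    funext t
    simp only [loopRow, ← T.sum_mul_incidence (fun e => c e.1) c (fun _ => rfl),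
      Finset.sum_apply, Pi.smul_apply, edgeLoopRow, smul_eq_mul, Finset.mul_sum, Finset.sum_mul]
    rw [Finset.sum_comm]
    simp only [mul_assoc]
  rw [h]
  exact sum_mem fun e _ => Submodule.smul_mem _ _ (Submodule.subset_span ⟨e, rfl⟩)

/-- Evaluation of the integral rows at the shapes. -/
def rowEval (z : ι → ℂ) : (ι → ℤ × ℤ) →ₗ[ℤ] (ι → ℂ) where
  toFun r t := (r t).1 * shapeWeight (z t) 0 + (r t).2 * shapeWeight (z t) 2
  map_add' r s := by
    funext t
    simp only [Pi.add_apply, Prod.fst_add, Prod.snd_add]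
    push_cast
    ring
  map_smul' m r := by
    funext t
    show ((m * (r t).1 : ℤ) : ℂ) * _ + ((m * (r t).2 : ℤ) : ℂ) * _ = m • (_ + _)
    rw [zsmul_eq_mul]
    push_cast
    ring

theorem rowEval_edgeRow (z : ι → ℂ) (e : T.Edge) : rowEval z (T.edgeRow e) = T.edgeLoopRow z e := by
  funext t
  have h := sum_shapeWeight (z t)
  rw [Fin.sum_univ_three] at h
  simp only [rowEval, edgeRow, edgeLoopRow, LinearMap.coe_mk, AddHom.coe_mk, Fin.sum_univ_three]
  push_cast
  linear_combination -(T.incidence e t 1 : ℂ) * h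

theorem edgeLoopRow_mem_span_int (z : ι → ℂ) {e : T.Edge} {B : Set T.Edge}
    (h : T.edgeRow e ∈ Submodule.span ℤ (T.edgeRow '' B)) :
    T.edgeLoopRow z e ∈ Submodule.span ℤ (T.edgeLoopRow z '' B) := by
  have h1 := Submodule.mem_map_of_mem (f := rowEval z) h
  rw [Submodule.map_span, ← Set.image_comp, rowEval_edgeRow] at h1
  have h2 : rowEval z ∘ T.edgeRow = T.edgeLoopRow z := funext (T.rowEval_edgeRow z)
  rwa [h2] at h1

/-- A nonzero integral multiple of the row is a combination of the chosen rows; over `ℂ` the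
multiple can be divided out. -/
theorem edgeLoopRow_mem_span [Fintype ι] {κ : Type*} (α : T.CurveSystem κ) (c : T.Choice κ)
    (z : ι → ℂ) (e : T.Edge) :
    T.edgeLoopRow z e ∈ Submodule.span ℂ (T.edgeLoopRow z '' c.edges) := by
  obtain ⟨m, hm, h⟩ := T.exists_smul_edgeRow_mem_span α c e
  have h1 := Submodule.mem_map_of_mem (f := rowEval z) h
  rw [Submodule.map_span, ← Set.image_comp, map_smul, rowEval_edgeRow] at h1
  have h2 : rowEval z ∘ T.edgeRow = T.edgeLoopRow z := funext (T.rowEval_edgeRow z)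
  rw [h2] at h1
  have h3 : (m : ℂ) • T.edgeLoopRow z e ∈ Submodule.span ℂ (T.edgeLoopRow z '' c.edges) := by
    rw [Int.cast_smul_eq_zsmul]
    exact Submodule.span_subset_span ℤ ℂ _ h1
  exact (Submodule.smul_mem_iff _ (by exact_mod_cast hm)).1 h3

/-- The coefficient of `G'` is `-z'' - z⁻¹ = -1`, so every row pairs its counts with the weights
`(z'', -1, z⁻¹)`. -/
theorem oneLoop_eq [Fintype ι] [DecidableEq ι] {κ : Type*} (α : T.CurveSystem κ)
    (c : T.Choice κ) (z : ι → ℂ) :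
    T.oneLoop α c z = 1 / 2 * (Matrix.of fun i => Sum.elim (fun e : c.edges => T.edgeLoopRow z e)
      (fun a => curveLoopRow z (α.curve a).toNormalCurve) (c.row i)).det *
        ∏ t, shapeMonomial (z t) (c.flat t) := by
  rw [oneLoop]
  congr 3
  ext i t
  rw [Matrix.add_apply, Matrix.mul_diagonal, Matrix.mul_diagonal]
  simp only [gluingMatrix, Matrix.sub_apply, Matrix.of_apply]
  rcases c.row i with e | a
  · simp only [Sum.elim_inl, edgeLoopRow, Fin.sum_univ_three]
    simp [shape, shapeWeight]
    ring
  · simp only [Sum.elim_inr, curveLoopRow, Fin.sum_univ_three]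
    simp [shape, shapeWeight]
    ring

end IdealTriangulation

/-! ### Edge types with respect to a labelling of a tetrahedron. -/

theorem quadType_perm_univ (σ : Equiv.Perm (Fin 4)) :
    (Finset.univ : Finset (Fin 3)) = {quadType (σ 0) (σ 1), quadType (σ 0) (σ 2), quadType (σ 0) (σ 3)} ∧
    quadType (σ 0) (σ 1) ≠ quadType (σ 0) (σ 2) ∧ quadType (σ 0) (σ 1) ≠ quadType (σ 0) (σ 3) ∧
    quadType (σ 0) (σ 2) ≠ quadType (σ 0) (σ 3) := by
  revert σ; decide

theorem sum_quadType_perm {N : Type*} [AddCommMonoid N] (G : Fin 3 → N) (σ : Equiv.Perm (Fin 4)) :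
    ∑ q, G q = G (quadType (σ 0) (σ 1)) + (G (quadType (σ 0) (σ 2)) +
      G (quadType (σ 0) (σ 3))) := by
  obtain ⟨h, h1, h2, h3⟩ := quadType_perm_univ σ
  rw [h, Finset.sum_insert (by simp [h1, h2]), Finset.sum_pair h3]

theorem prod_quadType_perm {N : Type*} [CommMonoid N] (G : Fin 3 → N) (σ : Equiv.Perm (Fin 4)) :
    ∏ q, G q = G (quadType (σ 0) (σ 1)) * (G (quadType (σ 0) (σ 2)) *
      G (quadType (σ 0) (σ 3))) := by
  obtain ⟨h, h1, h2, h3⟩ := quadType_perm_univ σ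
  rw [h, Finset.prod_insert (by simp [h1, h2]), Finset.prod_pair h3]

theorem quadType_perm_apply (σ : Equiv.Perm (Fin 4)) {u v : Fin 4} (huv : u ≠ v) :
    quadType (σ u) (σ v) = quadType (σ 0) (σ 1) ∧ (∀ τ : Equiv.Perm (Fin 4),
        quadType (τ u) (τ v) = quadType (τ 0) (τ 1)) ∨
    quadType (σ u) (σ v) = quadType (σ 0) (σ 2) ∧ (∀ τ : Equiv.Perm (Fin 4),
        quadType (τ u) (τ v) = quadType (τ 0) (τ 2)) ∨
    quadType (σ u) (σ v) = quadType (σ 0) (σ 3) ∧ (∀ τ : Equiv.Perm (Fin 4),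
        quadType (τ u) (τ v) = quadType (τ 0) (τ 3)) := by
  have key : ∀ u v : Fin 4, u ≠ v → (∀ τ : Equiv.Perm (Fin 4),
        quadType (τ u) (τ v) = quadType (τ 0) (τ 1)) ∨ (∀ τ : Equiv.Perm (Fin 4),
        quadType (τ u) (τ v) = quadType (τ 0) (τ 2)) ∨ (∀ τ : Equiv.Perm (Fin 4),
        quadType (τ u) (τ v) = quadType (τ 0) (τ 3)) := by decide
  rcases key u v huv with h | h | h
  · exact Or.inl ⟨h σ, h⟩
  · exact Or.inr (Or.inl ⟨h σ, h⟩)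
  · exact Or.inr (Or.inr ⟨h σ, h⟩)

namespace GluedTetrahedra

variable {ι : Type*} (T : GluedTetrahedra ι)

theorem typeSum_perm_two {M : Type*} [AddCommMonoid M] (c : Quot T.EdgeStep → M) (t : ι)
    (σ : Equiv.Perm (Fin 4)) :
    T.typeSum c t (quadType (σ 0) (σ 2)) =
      c (T.edgeClass t (σ 0) (σ 2)) + c (T.edgeClass t (σ 1) (σ 3)) := by
  have h := T.typeSum_perm c t (σ * Equiv.swap 1 2)
  simpa only [Equiv.Perm.mul_apply, Equiv.swap_apply_left, Equiv.swap_apply_right,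
    show (Equiv.swap 1 2 : Equiv.Perm (Fin 4)) 0 = 0 by decide,
    show (Equiv.swap 1 2 : Equiv.Perm (Fin 4)) 3 = 3 by decide] using h

theorem typeSum_perm_three {M : Type*} [AddCommMonoid M] (c : Quot T.EdgeStep → M) (t : ι)
    (σ : Equiv.Perm (Fin 4)) :
    T.typeSum c t (quadType (σ 0) (σ 3)) =
      c (T.edgeClass t (σ 0) (σ 3)) + c (T.edgeClass t (σ 1) (σ 2)) := by
  have h := T.typeSum_perm c t (σ * Equiv.swap 1 3)
  rw [T.edgeClass_symm t (σ 1) (σ 2)]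
  simpa only [Equiv.Perm.mul_apply, Equiv.swap_apply_left, Equiv.swap_apply_right,
    show (Equiv.swap 1 3 : Equiv.Perm (Fin 4)) 0 = 0 by decide,
    show (Equiv.swap 1 3 : Equiv.Perm (Fin 4)) 2 = 2 by decide] using h

end GluedTetrahedra

namespace IdealTriangulation

/-! ### Boundaries as flows -/

section Flow

variable {ι : Type*} (T : IdealTriangulation ι) (p : Quot T.LinkStep → ℤ)

/-- The flow through the sides of the link that bounds the combination `p` of dual cells. -/
def boundaryFlow (t : ι) (v f : Fin 4) : ℤ :=
  if h : v = f then 0 else T.boundaryCrossing p (t, (exists_perm_pair h 1).choose)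

theorem boundaryFlow_self (t : ι) (v : Fin 4) : T.boundaryFlow p t v v = 0 := dif_pos rfl

theorem boundaryFlow_even (t : ι) (σ : Equiv.Perm (Fin 4)) (hσ : Equiv.Perm.sign σ = 1) :
    T.boundaryFlow p t (σ 0) (σ 1) = T.boundaryCrossing p (t, σ) := by
  have h : σ 0 ≠ σ 1 := by simp
  rw [boundaryFlow, dif_neg h]
  obtain ⟨h0, h1, h2⟩ := (exists_perm_pair h 1).choose_spec
  rw [perm_ext_of_sign h0 h1 (h2.trans hσ.symm)]

theorem boundaryFlow_perm (t : ι) (σ : Equiv.Perm (Fin 4)) :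
    T.boundaryFlow p t (σ 0) (σ 1) = (Equiv.Perm.sign σ : ℤ) *
      (p (T.linkVertex t (σ 0) (σ 2)) - p (T.linkVertex t (σ 0) (σ 3))) := by
  rcases Int.units_eq_one_or (Equiv.Perm.sign σ) with h | h
  · rw [boundaryFlow_even _ _ _ _ h, h, Units.val_one, one_mul]
    rfl
  · have es : Equiv.Perm.sign (Equiv.swap 2 3 : Equiv.Perm (Fin 4)) = -1 := by decide
    have e0 : (Equiv.swap 2 3 : Equiv.Perm (Fin 4)) 0 = 0 := by decide
    have e1 : (Equiv.swap 2 3 : Equiv.Perm (Fin 4)) 1 = 1 := by decide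
    have h1 := T.boundaryFlow_even p t (σ * Equiv.swap 2 3) (by rw [Equiv.Perm.sign_mul, h, es]; rfl)
    simp only [boundaryCrossing, Equiv.Perm.mul_apply, e0, e1, Equiv.swap_apply_left,
      Equiv.swap_apply_right] at h1
    rw [h1, h]
    push_cast
    ring

theorem sum_boundaryFlow (t : ι) (v : Fin 4) : ∑ f, T.boundaryFlow p t v f = 0 := by
  obtain ⟨σ, rfl, hs⟩ : ∃ σ : Equiv.Perm (Fin 4), σ 0 = v ∧ Equiv.Perm.sign σ = 1 := by
    revert v; decide
  let c : Equiv.Perm (Fin 4) := Equiv.swap 1 2 * Equiv.swap 2 3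
  have h1 := T.boundaryFlow_perm p t σ
  have h2 := T.boundaryFlow_perm p t (σ * c)
  have h3 := T.boundaryFlow_perm p t (σ * (c * c))
  simp only [Equiv.Perm.mul_apply σ, Equiv.Perm.sign_mul σ, show c 0 = 0 by decide,
    show c 1 = 2 by decide, show c 2 = 3 by decide, show c 3 = 1 by decide,
    show (c * c) 0 = 0 by decide, show (c * c) 1 = 3 by decide, show (c * c) 2 = 1 by decide,
    show (c * c) 3 = 2 by decide, show Equiv.Perm.sign c = 1 by decide,
    show Equiv.Perm.sign (c * c) = 1 by decide, hs] at h1 h2 h3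
  rw [← Equiv.sum_comp σ, Fin.sum_univ_four, boundaryFlow_self, h1, h2, h3]
  push_cast
  ring

theorem boundaryFlow_glue (t : ι) (v f : Fin 4) :
    T.boundaryFlow p (T.nbr t f) (T.perm t f v) (T.perm t f f) = -T.boundaryFlow p t v f := by
  by_cases h : v = f
  · rw [h, boundaryFlow_self, boundaryFlow_self, neg_zero]
  obtain ⟨σ, rfl, rfl, -⟩ := exists_perm_pair h 1
  have h1 := T.boundaryFlow_perm p (T.nbr t (σ 1)) (T.perm t (σ 1) * σ)
  have hl (u : Fin 4) (hu : u ≠ 1) : T.linkVertex (T.nbr t (σ 1)) (T.perm t (σ 1) (σ 0))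
      (T.perm t (σ 1) (σ u)) = T.linkVertex t (σ 0) (σ u) :=
    (Quot.sound (.glue t (σ 1) (σ 0) (σ u) (by simp) (by simpa using hu))).symm
  simp only [Equiv.Perm.mul_apply, Equiv.Perm.sign_mul, T.perm_sign, hl 2 (by decide),
    hl 3 (by decide)] at h1
  rw [h1, boundaryFlow_perm]
  push_cast
  ring

end Flow

/-! ### Rows on the two new tetrahedra. -/

namespace ZeroTwoMove

variable {ι : Type*} {T : IdealTriangulation ι} {T' : IdealTriangulation (ι ⊕ Fin 2)}
  (M : ZeroTwoMove T T')

/-- The type of the edge `uv` of the new tetrahedron `j`. -/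
def newType (j : Fin 2) (u v : Fin 4) : Fin 3 := quadType (M.lab j u) (M.lab j v)

theorem pullback_newEdge {N : Type*} (c : Quot T.EdgeStep → N) (m : N) (j : Fin 2) {k u v : Fin 4}
    (hk : k = 2 ∨ k = 3) (hu : u ≠ k) (hv : v ≠ k) :
    M.pullback c m (M.newEdge j u v) =
      c (T.edgeClass (M.opened j k).1 ((M.opened j k).2 u) ((M.opened j k).2 v)) := by
  rw [pullback, M.proj_newEdge j hk hu hv, Option.elim]

theorem pullback_newEdge_CD {N : Type*} (c : Quot T.EdgeStep → N) (m : N) (j : Fin 2) :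
    M.pullback c m (M.newEdge j 2 3) = m := by
  rw [pullback, M.proj_newEdge_CD j, Option.elim]

/-- The edge equation of `CD`. -/
theorem shape_mul_shape [Fintype ι] {z' : ι ⊕ Fin 2 → ℂ} (hz' : z' ∈ T'.gluingVariety) :
    shape (z' (Sum.inr 0)) (M.newType 0 0 1) * shape (z' (Sum.inr 1)) (M.newType 1 0 1) = 1 := by
  -- This pullback is the indicator function of `CD`, the only edge without an image in the old
  -- triangulation.
  have h := T'.prod_shape_typeSum hz' (M.pullback (fun _ => (0 : ℤ)) 1)
  rw [Fintype.prod_sum_type, Finset.prod_eq_one, one_mul, Fin.prod_univ_two] at h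
  · have h1 (j : Fin 2) : ∏ q, shape (z' (Sum.inr j)) q ^
        T'.typeSum (M.pullback (fun _ => (0 : ℤ)) 1) (Sum.inr j) q =
        shape (z' (Sum.inr j)) (M.newType j 0 1) := by
      have e0 := M.pullback_newEdge (fun _ => (0 : ℤ)) 1 j (Or.inr rfl) (u := 0) (v := 1) (by decide) (by decide)
      have e1 := M.pullback_newEdge_CD (fun _ => (0 : ℤ)) 1 j
      have e2 := M.pullback_newEdge (fun _ => (0 : ℤ)) 1 j (Or.inr rfl) (u := 0) (v := 2) (by decide) (by decide)
      have e3 := M.pullback_newEdge (fun _ => (0 : ℤ)) 1 j (Or.inl rfl) (u := 1) (v := 3) (by decide) (by decide)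
      have e4 := M.pullback_newEdge (fun _ => (0 : ℤ)) 1 j (Or.inl rfl) (u := 0) (v := 3) (by decide) (by decide)
      have e5 := M.pullback_newEdge (fun _ => (0 : ℤ)) 1 j (Or.inr rfl) (u := 1) (v := 2) (by decide) (by decide)
      rw [newEdge] at e0 e1 e2 e3 e4 e5
      rw [prod_quadType_perm _ (M.lab j), GluedTetrahedra.typeSum_perm,
        GluedTetrahedra.typeSum_perm_two, GluedTetrahedra.typeSum_perm_three, e0, e1, e2, e3, e4, e5]
      simp [newType]
    rwa [h1, h1] at h
  · intro t _
    refine Finset.prod_eq_one fun q _ => ?_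
    rw [typeSum_inl (T := T) (c := fun _ => (0 : ℤ)) (fun t a b => rfl)]
    simp [GluedTetrahedra.typeSum]

/-- The weights of the two new tetrahedra are proportional. -/
theorem exists_weight_ratio [Fintype ι] {z' : ι ⊕ Fin 2 → ℂ} (hz' : z' ∈ T'.gluingVariety) :
    ∃ l : ℂ, l ≠ 0 ∧ ∀ u v, u ≠ v → shapeWeight (z' (Sum.inr 1)) (M.newType 1 u v) =
      l * shapeWeight (z' (Sum.inr 0)) (M.newType 0 u v) := by
  obtain ⟨l, hl, h1, h2, h3⟩ := exists_shapeWeight_proportional (hz'.1 (Sum.inr 0)).1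
    (hz'.1 (Sum.inr 0)).2 (hz'.1 (Sum.inr 1)).1 (hz'.1 (Sum.inr 1)).2 (M.shape_mul_shape hz')
  have hs := M.sign_lab
  have key : shapeWeight (z' (Sum.inr 1)) (M.newType 1 0 2) =
      l * shapeWeight (z' (Sum.inr 0)) (M.newType 0 0 2) ∧
      shapeWeight (z' (Sum.inr 1)) (M.newType 1 0 3) =
      l * shapeWeight (z' (Sum.inr 0)) (M.newType 0 0 3) := by
    have e : ∀ q : Fin 3, q + 1 + 1 = q + 2 ∧ q + 1 + 2 = q ∧ q + 2 + 1 = q ∧ q + 2 + 2 = q + 1 := by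
      decide
    simp only [newType] at *
    rcases quadType_perm (M.lab 0) with ⟨s0, a1, a2⟩ | ⟨s0, a1, a2⟩ <;>
      rcases quadType_perm (M.lab 1) with ⟨s1, b1, b2⟩ | ⟨s1, b1, b2⟩ <;>
      rw [s0, s1] at hs
    · exact absurd hs (by decide)
    · rw [a1, b1] at h2 h3
      rw [a2, b2]
      simp only [(e _).1, (e _).2.1, (e _).2.2.1, (e _).2.2.2] at h2 h3
      exact ⟨h2, h3⟩
    · rw [a1, b1] at h2 h3
      rw [a2, b2]
      simp only [(e _).1, (e _).2.1, (e _).2.2.1, (e _).2.2.2] at h2 h3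
      exact ⟨h3, h2⟩
    · exact absurd hs (by decide)
  refine ⟨l, hl, fun u v huv => ?_⟩
  simp only [newType] at *
  rcases quadType_perm_apply (M.lab 0) huv with ⟨h, h'⟩ | ⟨h, h'⟩ | ⟨h, h'⟩ <;> rw [h, h']
  · exact h1
  · exact key.1
  · exact key.2

theorem loopRow_inr (z' : ι ⊕ Fin 2 → ℂ) (c : Quot T'.EdgeStep → ℂ) (j : Fin 2) :
    T'.loopRow z' c (Sum.inr j) =
      (c (M.newEdge j 0 1) + c (M.newEdge j 2 3)) * shapeWeight (z' (Sum.inr j)) (M.newType j 0 1) +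
      ((c (M.newEdge j 0 2) + c (M.newEdge j 1 3)) * shapeWeight (z' (Sum.inr j)) (M.newType j 0 2) +
      (c (M.newEdge j 0 3) + c (M.newEdge j 1 2)) *
        shapeWeight (z' (Sum.inr j)) (M.newType j 0 3)) := by
  rw [loopRow, sum_quadType_perm _ (M.lab j), GluedTetrahedra.typeSum_perm,
    GluedTetrahedra.typeSum_perm_two, GluedTetrahedra.typeSum_perm_three]
  rfl

/-- The two new tetrahedra share all their edges except `AB`, and their weights are proportional, so
everything but the values at `AB` cancels. -/
theorem loopRow_inr_sub {z' : ι ⊕ Fin 2 → ℂ} {l : ℂ}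
    (hl : ∀ u v, u ≠ v → shapeWeight (z' (Sum.inr 1)) (M.newType 1 u v) =
      l * shapeWeight (z' (Sum.inr 0)) (M.newType 0 u v)) (c : Quot T'.EdgeStep → ℂ) :
    T'.loopRow z' c (Sum.inr 1) - l * T'.loopRow z' c (Sum.inr 0) =
      l * shapeWeight (z' (Sum.inr 0)) (M.newType 0 0 1) *
        (c (M.edgeAB 1).1 - c (M.edgeAB 0).1) := by
  simp only [edgeAB]
  rw [M.loopRow_inr, M.loopRow_inr, hl _ _ (by decide), hl _ _ (by decide), hl _ _ (by decide),
    M.newEdge_one (u := 2) (v := 3) (by decide) (by decide),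
    M.newEdge_one (u := 0) (v := 2) (by decide) (by decide),
    M.newEdge_one (u := 1) (v := 3) (by decide) (by decide),
    M.newEdge_one (u := 0) (v := 3) (by decide) (by decide),
    M.newEdge_one (u := 1) (v := 2) (by decide) (by decide)]
  ring

/-- The rows of corresponding curves differ by a row of edges and a multiple of the row `(1, l)` on
the new tetrahedra. -/
theorem curveLoopRow_sub {z : ι → ℂ} {z' : ι ⊕ Fin 2 → ℂ} (hzz' : ∀ t, z t = z' (Sum.inl t)) {l : ℂ}
    (hl : ∀ u v, u ≠ v → shapeWeight (z' (Sum.inr 1)) (M.newType 1 u v) =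
      l * shapeWeight (z' (Sum.inr 0)) (M.newType 0 u v)) {γ : NormalCurve T} {γ' : NormalCurve T'}
    (h : SameClass γ γ') :
    ∃ c : Quot T'.EdgeStep → ℂ,
      (∀ t, curveLoopRow z' γ' (Sum.inl t) - T'.loopRow z' c (Sum.inl t) = curveLoopRow z γ t) ∧
      curveLoopRow z' γ' (Sum.inr 1) - T'.loopRow z' c (Sum.inr 1) =
        l * (curveLoopRow z' γ' (Sum.inr 0) - T'.loopRow z' c (Sum.inr 0)) := by
  obtain ⟨p, hp⟩ := h
  -- A cycle homologous to `γ'` that coincides with `γ` on the old triangles. Subtracting the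
  -- boundary costs exactly the edge row of `c`.
  let κ : ι ⊕ Fin 2 → Fin 4 → Fin 4 → ℤ := fun t v f => γ'.crossing t v f - T'.boundaryFlow p t v f
  have hκ0 (t v) : κ t v v = 0 := by
    simp only [κ, NormalCurve.crossing_self, boundaryFlow_self, sub_zero]
  have hκs (t v) : ∑ f, κ t v f = 0 := by
    simp only [κ, Finset.sum_sub_distrib, NormalCurve.sum_crossing, sum_boundaryFlow, sub_zero]
  have hκg (t v f) : κ (T'.nbr t f) (T'.perm t f v) (T'.perm t f f) = -κ t v f := by
    simp only [κ, NormalCurve.crossing_glue, boundaryFlow_glue]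
    ring
  have hκl (t v f) : κ (Sum.inl t) v f = γ.crossing t v f := by
    by_cases hvf : v = f
    · rw [hvf, hκ0, NormalCurve.crossing_self]
    obtain ⟨σ, rfl, rfl, hs⟩ := exists_perm_pair hvf 1
    simp only [κ]
    rw [hp (t, σ) hs, boundaryFlow_even _ _ _ _ hs]
    ring
  -- The flow passes straight through the pillow: on inner faces by the gluing, on outer faces
  -- because `γ` leaves one side of an opened face as it enters the other.
  have hκr (v f : Fin 4) : κ (Sum.inr 1) (M.lab 1 v) (M.lab 1 f) =
      -κ (Sum.inr 0) (M.lab 0 v) (M.lab 0 f) := by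
    by_cases hf : f = 0 ∨ f = 1
    · have h1 := hκg (Sum.inr 0) (M.lab 0 v) (M.lab 0 f)
      rwa [M.nbr_inr_inner 0 hf, M.perm_inr_inner 0 hf, M.perm_inr_inner 0 hf] at h1
    · have hf' : f = 2 ∨ f = 3 := by omega
      have h1 (j : Fin 2) : γ.crossing (M.opened j f).1 ((M.opened j f).2 v) ((M.opened j f).2 f) =
          -κ (Sum.inr j) (M.lab j v) (M.lab j f) := by
        have h1 := hκg (Sum.inr j) (M.lab j v) (M.lab j f)
        rwa [M.nbr_inr_outer j hf', M.perm_inr_outer j hf', M.perm_inr_outer j hf', hκl] at h1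
      have h2 := γ.crossing_glue (M.opened 0 f).1 ((M.opened 0 f).2 v) ((M.opened 0 f).2 f)
      rw [M.nbr_opened 0 hf', M.perm_opened 0 hf', M.perm_opened 0 hf', zero_add, h1, h1] at h2
      linarith
  let c := T'.linkSum fun x => (p x : ℂ)
  have hη (t : ι ⊕ Fin 2) : curveLoopRow z' γ' t - T'.loopRow z' c t =
      ∑ v, ∑ f, (κ t v f : ℂ) * sideWeight (shapeWeight (z' t)) (quadType v f) := by
    rw [curveLoopRow, γ'.sum_turning_mul t _ (sum_shapeWeight _), loopRow,
      ← T'.sum_flow_boundary _ (sum_shapeWeight _) (fun x => (p x : ℂ)) t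
        (fun v f => (T'.boundaryFlow p t v f : ℂ)) (by simp [boundaryFlow_self])]
    · simp only [κ, Int.cast_sub, sub_mul, Finset.sum_sub_distrib]
    · intro σ hσ
      rw [boundaryFlow_even _ _ _ _ hσ, boundaryCrossing]
      push_cast
      rfl
  refine ⟨c, fun t => ?_, ?_⟩
  · rw [hη, curveLoopRow, γ.sum_turning_mul t _ (sum_shapeWeight _), hzz']
    simp only [hκl]
  · have hv (v : Fin 4) : ∃ τ : Equiv.Perm (Fin 4), τ 0 = v := ⟨Equiv.swap 0 v, by simp⟩
    have h1 (j : Fin 2) (τ : Equiv.Perm (Fin 4)) :=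
      sum_flow_sideWeight (shapeWeight (z' (Sum.inr j))) (sum_shapeWeight _)
        (fun f => (κ (Sum.inr j) (M.lab j (τ 0)) f : ℂ)) (M.lab j * τ)
        (by simp [hκ0]) (by exact_mod_cast hκs _ _)
    simp only [Equiv.Perm.mul_apply] at h1
    rw [hη, hη, Finset.mul_sum, ← Equiv.sum_comp (M.lab 1) (fun v => ∑ f, (κ (Sum.inr 1) v f : ℂ) *
        sideWeight (shapeWeight (z' (Sum.inr 1))) (quadType v f)),
      ← Equiv.sum_comp (M.lab 0) (fun v => l * ∑ f, (κ (Sum.inr 0) v f : ℂ) *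
        sideWeight (shapeWeight (z' (Sum.inr 0))) (quadType v f))]
    refine Finset.sum_congr rfl fun v _ => ?_
    obtain ⟨τ, rfl⟩ := hv v
    have e2 := hl (τ 0) (τ 2) (by simp)
    have e3 := hl (τ 0) (τ 3) (by simp)
    simp only [newType] at e2 e3
    -- Opposite flow and opposite orientation compensate, leaving only the ratio `l` of the weights.
    rw [h1, h1, hκr, hκr, e2, e3, Equiv.Perm.sign_mul, Equiv.Perm.sign_mul, M.sign_lab]
    push_cast
    ring

end ZeroTwoMove

end IdealTriangulation

/-! ### Lifting relations between edge rows. -/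

namespace IdealTriangulation

variable {ι : Type*} {T : IdealTriangulation ι} {T' : IdealTriangulation (ι ⊕ Fin 2)}

theorem edge_eq_iff (e f : T.Edge) : e.1 = f.1 ↔ e = f := Subtype.ext_iff.symm

theorem typeSum_eq_of_rowOf_eq_zero {c : Quot T.EdgeStep → ℤ} (h : T.rowOf c = 0) (t : ι)
    (q r : Fin 3) : T.typeSum c t q = T.typeSum c t r := by
  have h1 := congrArg Prod.fst (congrFun h t)
  have h2 := congrArg Prod.snd (congrFun h t)
  simp only [rowOf, Pi.zero_apply, Prod.fst_zero, Prod.snd_zero, sub_eq_zero] at h1 h2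
  have key (q : Fin 3) : T.typeSum c t q = T.typeSum c t 1 := by
    fin_cases q
    · exact h1
    · rfl
    · exact h2
  rw [key, key r]

theorem rowOf_eq_zero {c : Quot T.EdgeStep → ℤ}
    (h : ∀ t q r, T.typeSum c t q = T.typeSum c t r) : T.rowOf c = 0 := by
  funext t
  simp only [rowOf, h t 0 1, h t 2 1, sub_self, Pi.zero_apply]
  rfl

/-- The differences at the two faces of a flag along its first edge agree. -/
theorem sub_eq_of_turn {c : Quot T.EdgeStep → ℤ} (h : T.rowOf c = 0) (x : ι × Equiv.Perm (Fin 4)) :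
    c (T.edgeClass x.1 (x.2 0) (x.2 3)) - c (T.edgeClass x.1 (x.2 1) (x.2 3)) =
      c (T.edgeClass x.1 (x.2 0) (x.2 2)) - c (T.edgeClass x.1 (x.2 1) (x.2 2)) := by
  have h1 := typeSum_eq_of_rowOf_eq_zero h x.1 (quadType (x.2 0) (x.2 2)) (quadType (x.2 0) (x.2 3))
  rw [GluedTetrahedra.typeSum_perm_two, GluedTetrahedra.typeSum_perm_three] at h1
  linarith

theorem sub_turn_iterate {c : Quot T.EdgeStep → ℤ} (h : T.rowOf c = 0)
    (x : ι × Equiv.Perm (Fin 4)) (n : ℕ) :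
    c (T.edgeClass (T.turn^[n] x).1 ((T.turn^[n] x).2 0) ((T.turn^[n] x).2 2)) -
      c (T.edgeClass (T.turn^[n] x).1 ((T.turn^[n] x).2 1) ((T.turn^[n] x).2 2)) =
    c (T.edgeClass x.1 (x.2 0) (x.2 2)) - c (T.edgeClass x.1 (x.2 1) (x.2 2)) := by
  induction n with
  | zero => rfl
  | succ n ih =>
    rw [Function.iterate_succ_apply', ← ih, ← sub_eq_of_turn h (T.turn^[n] x)]
    generalize T.turn^[n] x = y
    obtain ⟨h0, h1, h2, -⟩ := T.turn_snd y
    have ht : (T.turn y).1 = (T.across y 2).1 := rfl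
    rw [h0, h1, h2, ht, T.edgeClass_across y (by decide) (by decide),
      T.edgeClass_across y (by decide) (by decide)]

namespace ZeroTwoMove

variable (M : ZeroTwoMove T T')

/-- Relations between the rows of the edges lift to the new triangulation. -/
theorem exists_rowOf_pullback_eq_zero {c : Quot T.EdgeStep → ℤ} (h : T.rowOf c = 0) :
    ∃ m, T'.rowOf (M.pullback c m) = 0 := by
  -- For a relation, the difference of the values at the two other edges of a face around `AB` is
  -- unchanged by turning. Comparing `ABC` with `ABD` gives equal sums over `AC, BD` and over `AD,
  -- BC`; the value at `CD` is then chosen so that `AB, CD` has this sum too.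
  have hsq : c (T.edgeClass M.x.1 (M.x.2 0) (M.x.2 2)) + c (T.edgeClass M.y.1 (M.y.2 1) (M.y.2 3)) =
      c (T.edgeClass M.y.1 (M.y.2 0) (M.y.2 3)) + c (T.edgeClass M.x.1 (M.x.2 1) (M.x.2 2)) := by
    have h1 := sub_turn_iterate h M.x M.steps
    rw [← M.y_eq, ← sub_eq_of_turn h] at h1
    linarith
  refine ⟨c (T.edgeClass M.x.1 (M.x.2 0) (M.x.2 2)) + c (T.edgeClass M.y.1 (M.y.2 1) (M.y.2 3)) -
    c M.oldAB.1, rowOf_eq_zero ?_⟩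
  set m := c (T.edgeClass M.x.1 (M.x.2 0) (M.x.2 2)) + c (T.edgeClass M.y.1 (M.y.2 1) (M.y.2 3)) -
    c M.oldAB.1 with hm
  rintro (t | j) q r
  · rw [typeSum_inl (T := T) (c := c) (fun t a b => rfl), typeSum_inl (T := T) (c := c)
      (fun t a b => rfl)]
    exact typeSum_eq_of_rowOf_eq_zero h t q r
  · have hx (u v : Fin 4) (hu : u ≠ 3) (hv : v ≠ 3) : M.pullback c m (M.newEdge j u v) =
        c (T.edgeClass M.x.1 (M.x.2 u) (M.x.2 v)) := by
      rw [M.pullback_newEdge c m j (Or.inr rfl) hu hv,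
        M.edgeClass_opened j 0 (Or.inr rfl) (Or.inr rfl) hu hv hu hv]
      rfl
    have hy (u v : Fin 4) (hu : u ≠ 2) (hv : v ≠ 2) : M.pullback c m (M.newEdge j u v) =
        c (T.edgeClass M.y.1 (M.y.2 u) (M.y.2 v)) := by
      rw [M.pullback_newEdge c m j (Or.inl rfl) hu hv,
        M.edgeClass_opened j 0 (Or.inl rfl) (Or.inl rfl) hu hv hu hv]
      rfl
    have hcd := M.pullback_newEdge_CD c m j
    have hab : M.pullback c m (M.newEdge j 0 1) = c M.oldAB.1 := by
      exact congrArg (fun x => x.elim m c) (M.proj_edgeAB j)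
    have h01 := T'.typeSum_perm (M.pullback c m) (Sum.inr j) (M.lab j)
    have h02 := T'.typeSum_perm_two (M.pullback c m) (Sum.inr j) (M.lab j)
    have h03 := T'.typeSum_perm_three (M.pullback c m) (Sum.inr j) (M.lab j)
    have e02 := hx 0 2 (by decide) (by decide)
    have e12 := hx 1 2 (by decide) (by decide)
    have e03 := hy 0 3 (by decide) (by decide)
    have e13 := hy 1 3 (by decide) (by decide)
    simp only [newEdge] at e02 e12 e03 e13 hcd hab
    rw [hab, hcd] at h01
    rw [e02, e13] at h02
    rw [e03, e12] at h03
    have key (q : Fin 3) : T'.typeSum (M.pullback c m) (Sum.inr j) q =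
        c (T.edgeClass M.x.1 (M.x.2 0) (M.x.2 2)) + c (T.edgeClass M.y.1 (M.y.2 1) (M.y.2 3)) := by
      have hq : q ∈ (Finset.univ : Finset (Fin 3)) := Finset.mem_univ q
      rw [(quadType_perm_univ (M.lab j)).1] at hq
      simp only [Finset.mem_insert, Finset.mem_singleton] at hq
      rcases hq with rfl | rfl | rfl <;> linarith
    rw [key, key]

open Classical in
/-- The indicator function of the edges that arise from `e`, in terms of one of them and `AB`. -/
theorem indicator_proj {R : Type*} [CommRing R] [Finite ι] {j : Fin 2} {e : T.Edge} {e' : T'.Edge}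
    (h : M.proj e'.1 = some e.1) (hne : e' ≠ M.edgeAB j) (x : T'.Edge) :
    (if x.1 = e'.1 then (1 : R) else 0) +
      (if (M.edgeAB (j + 1)).1 = e'.1 then 1 else 0) * (if x.1 = (M.edgeAB j).1 then 1 else 0) =
    if M.proj x.1 = some e.1 then 1 else 0 := by
  have hjj : M.edgeAB j ≠ M.edgeAB (j + 1) := fun h => by
    have := M.edgeAB_injective h
    fin_cases j <;> simp at this
  simp only [edge_eq_iff]
  by_cases hx : M.proj x.1 = some e.1
  · rw [if_pos hx]
    rcases M.eq_or_edgeAB (hx.trans h.symm) with rfl | ⟨⟨i, rfl⟩, l, rfl⟩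
    · rw [if_pos rfl, if_neg hne, mul_zero, add_zero]
    · have hl : l = j + 1 := by
        have : l ≠ j := fun h => hne (by rw [h])
        omega
      subst hl
      rw [if_pos rfl, one_mul]
      rcases (by omega : i = j ∨ i = j + 1) with rfl | rfl
      · rw [if_neg hjj, if_pos rfl, zero_add]
      · rw [if_pos rfl, if_neg hjj.symm, add_zero]
  · have h1 : x ≠ e' := fun h' => hx (h' ▸ h)
    rw [if_neg hx, if_neg h1, zero_add]
    by_cases h2 : M.edgeAB (j + 1) = e'
    · rw [if_pos h2, one_mul, if_neg]
      rintro rfl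
      refine hx ?_
      rw [← h, ← h2, proj_edgeAB, proj_edgeAB]
    · rw [if_neg h2, zero_mul]

/-- The relation that expresses the old row through `B` is lifted; the lift involves in addition
only `CD` and the copy of `AB` not used by `lift`. -/
theorem edgeRow_lift_mem_span [Fintype ι] {B : Set T.Edge} (j : Fin 2) (lift : T.Edge → T'.Edge)
    (hlift : ∀ e, M.proj (lift e).1 = some e.1) (hne : ∀ e, lift e ≠ M.edgeAB j) {e : T.Edge}
    (h : T.edgeRow e ∈ Submodule.span ℤ (T.edgeRow '' B)) :
    T'.edgeRow (lift e) ∈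
      Submodule.span ℤ (T'.edgeRow '' insert M.edgeCD (insert (M.edgeAB j) (lift '' B))) := by
  classical
  have := Fintype.ofFinite T.Edge
  have := Fintype.ofFinite T'.Edge
  obtain ⟨l, hl, hle⟩ := (Finsupp.mem_span_image_iff_linearCombination ℤ).1 h
  let c : T.Edge → ℤ := fun f => (if f = e then 1 else 0) - l f
  -- The quotient also contains degenerate classes `aa`, on which the value `0` is arbitrary.
  let d : Quot T.EdgeStep → ℤ := fun x => if hx : ∃ f : T.Edge, f.1 = x then c hx.choose else 0
  have hd (f : T.Edge) : d f.1 = c f := by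
    have hx : ∃ f' : T.Edge, f'.1 = f.1 := ⟨f, rfl⟩
    simp only [d]
    rw [dif_pos hx, Subtype.ext hx.choose_spec]
  have h0 : T.rowOf d = 0 := by
    rw [← T.sum_smul_edgeRow c d hd]
    simp only [c, sub_smul, Finset.sum_sub_distrib, ite_smul, one_smul, zero_smul,
      Finset.sum_ite_eq', Finset.mem_univ, if_true]
    rw [← hle, Finsupp.linearCombination_apply, Finsupp.sum_fintype _ _ (by simp), sub_self]
  obtain ⟨m, hm⟩ := M.exists_rowOf_pullback_eq_zero h0
  -- Marks the old edge `AB`: the pullback counts both its copies, while `lift` provides only the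
  -- copy `j + 1`.
  let a : T.Edge → ℤ := fun f => if (M.edgeAB (j + 1)).1 = (lift f).1 then 1 else 0
  have h1 : ∑ f, c f • T'.edgeRow (lift f) + (∑ f, c f * a f) • T'.edgeRow (M.edgeAB j) +
      m • T'.edgeRow M.edgeCD = 0 := by
    rw [← hm, ← T'.sum_smul_edgeRow (fun x => M.pullback d m x.1) _ (fun _ => rfl)]
    have h2 (x : T'.Edge) : M.pullback d m x.1 = ∑ f, c f * ((if x = lift f then 1 else 0) +
        a f * (if x = M.edgeAB j then 1 else 0)) + m * (if x = M.edgeCD then 1 else 0) := by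
      have h3 (f : T.Edge) := M.indicator_proj (R := ℤ) (hlift f) (hne f) x
      simp only [edge_eq_iff x] at h3
      simp only [a, h3]
      by_cases hx : x = M.edgeCD
      · rw [if_pos hx, hx, pullback, M.proj_edgeCD, Option.elim]
        simp
      · obtain ⟨f, hf⟩ := M.exists_proj hx
        rw [if_neg hx, pullback, hf, Option.elim, hd, mul_zero, add_zero]
        simp [edge_eq_iff]
    simp only [h2, add_smul, Finset.sum_add_distrib, Finset.sum_smul, mul_add]
    congr 1
    · congr 1
      · rw [Finset.sum_comm]
        refine Finset.sum_congr rfl fun f _ => ?_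
        simp
      · rw [Finset.sum_comm]
        refine Finset.sum_congr rfl fun f _ => ?_
        simp
    · simp
  have h2 : T'.edgeRow (lift e) = ∑ f, l f • T'.edgeRow (lift f) -
      (∑ f, c f * a f) • T'.edgeRow (M.edgeAB j) - m • T'.edgeRow M.edgeCD := by
    simp only [c, sub_smul, Finset.sum_sub_distrib, ite_smul, one_smul, zero_smul,
      Finset.sum_ite_eq', Finset.mem_univ, if_true] at h1 ⊢
    rw [← sub_eq_zero, ← h1]
    abel
  rw [h2]
  refine sub_mem (sub_mem (sum_mem fun f _ => ?_) ?_) ?_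
  · by_cases hf : f ∈ B
    · exact Submodule.smul_mem _ _ (Submodule.subset_span
        ⟨_, Set.mem_insert_of_mem _ (Set.mem_insert_of_mem _ ⟨f, hf, rfl⟩), rfl⟩)
    · have : l f = 0 := by
        by_contra h'
        exact hf (hl (Finsupp.mem_support_iff.2 h'))
      rw [this, zero_smul]
      exact zero_mem _
  · exact Submodule.smul_mem _ _ (Submodule.subset_span
      ⟨_, Set.mem_insert_of_mem _ (Set.mem_insert _ _), rfl⟩)
  · exact Submodule.smul_mem _ _ (Submodule.subset_span ⟨_, Set.mem_insert _ _, rfl⟩)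

end ZeroTwoMove

end IdealTriangulation

theorem Equiv.sumElim_symm_inl {n E κ R : Type*} (r : n ≃ E ⊕ κ) (f : E → R) (g : κ → R) (e : E) :
    Sum.elim f g (r (r.symm (Sum.inl e))) = f e := by
  rw [Equiv.apply_symm_apply, Sum.elim_inl]

theorem Equiv.sumElim_symm_inr {n E κ R : Type*} (r : n ≃ E ⊕ κ) (f : E → R) (g : κ → R) (a : κ) :
    Sum.elim f g (r (r.symm (Sum.inr a))) = g a := by
  rw [Equiv.apply_symm_apply, Sum.elim_inr]

/-! ### Elimination of the new tetrahedra from the determinant. -/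

namespace IdealTriangulation

namespace ZeroTwoMove

variable {ι : Type*} {T : IdealTriangulation ι} {T' : IdealTriangulation (ι ⊕ Fin 2)}
  (M : ZeroTwoMove T T')

/-- The edge `CD` arises from no old edge, so it is not omitted. Both copies of `AB` arise from the
same old edge, so at most one of them is omitted; a copy that is kept determines `j`. -/
theorem exists_lifts_of_sameOmittedEdges [Finite ι] {B : Set T.Edge} {B' : Set T'.Edge}
    (h : SameOmittedEdges B B') :
    ∃ (j : Fin 2) (lift : T.Edge → T'.Edge), (∀ e, M.proj (lift e).1 = some e.1) ∧
      (∀ e, lift e ≠ M.edgeAB j) ∧ B' = insert M.edgeCD (insert (M.edgeAB j) (lift '' B)) := by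
  obtain ⟨φ, hφ⟩ := h
  have hp (e) : M.proj (φ e).1.1 = some e.1.1 := by
    obtain ⟨t, a, b, -, h1, h2⟩ := hφ e
    rw [← h2, ← h1, proj_inl]
  have hout {e' : T'.Edge} (he' : e' ∉ B') : ∃ e, e ∉ B ∧ M.proj e'.1 = some e.1 ∧
      ∃ h, (φ ⟨e, h⟩).1 = e' := by
    refine ⟨(φ.symm ⟨e', he'⟩).1, (φ.symm ⟨e', he'⟩).2, ?_, (φ.symm ⟨e', he'⟩).2, ?_⟩
    · rw [← hp, Equiv.apply_symm_apply]
    · rw [Subtype.coe_eta, Equiv.apply_symm_apply]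
  have hcd : M.edgeCD ∈ B' := by
    by_contra h'
    obtain ⟨e, -, h1, -⟩ := hout h'
    rw [proj_edgeCD] at h1
    exact absurd h1 (by simp)
  have hab : ∃ j, M.edgeAB j ∈ B' := by
    by_contra! h'
    obtain ⟨e, -, h1, he, h2⟩ := hout (h' 0)
    obtain ⟨f, -, h3, hf, h4⟩ := hout (h' 1)
    have h5 : e.1 = f.1 := by
      rw [proj_edgeAB] at h1 h3
      exact Option.some_injective _ (h1.symm.trans h3)
    obtain rfl := (edge_eq_iff e f).1 h5
    exact M.edgeAB_ne (h2.symm.trans h4)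
  obtain ⟨j, hj⟩ := hab
  choose lift hlift hne using fun e : T.Edge => M.exists_lift e j
  refine ⟨j, lift, hlift, hne, Set.ext fun e' => ⟨fun he' => ?_, ?_⟩⟩
  · by_cases h1 : e' = M.edgeCD
    · exact Or.inl h1
    by_cases h2 : e' = M.edgeAB j
    · exact Or.inr (Or.inl h2)
    obtain ⟨e, he⟩ := M.exists_proj h1
    refine Or.inr (Or.inr ⟨e, ?_, (M.eq_of_proj_eq (he.trans (hlift e).symm) h2 (hne e)).symm⟩)
    by_contra heB
    have h3 : (φ ⟨e, heB⟩).1 ≠ M.edgeAB j := fun h => (φ ⟨e, heB⟩).2 (h ▸ hj)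
    exact (φ ⟨e, heB⟩).2 (M.eq_of_proj_eq (he.trans (hp ⟨e, heB⟩).symm) h2 h3 ▸ he')
  · rintro (rfl | rfl | ⟨e, he, rfl⟩)
    · exact hcd
    · exact hj
    · by_contra h'
      obtain ⟨f, hf, h1, -⟩ := hout h'
      rw [hlift] at h1
      exact hf ((edge_eq_iff e f).1 (Option.some_injective _ h1) ▸ he)

/-- Reduces both kinds of choices to one situation: `B'` has the same integral span as the lifts of
`B` together with `CD` and one copy of `AB`. -/
theorem exists_lifts [Fintype ι] {B : Set T.Edge} {B' : Set T'.Edge}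
    (h : (T.GeneratesEdgeEquations B ∧ T'.GeneratesEdgeEquations B') ∨ SameOmittedEdges B B') :
    ∃ (j : Fin 2) (lift : T.Edge → T'.Edge), (∀ e, M.proj (lift e).1 = some e.1) ∧
      (∀ e, lift e ≠ M.edgeAB j) ∧
      (∀ e ∈ B', T'.edgeRow e ∈ Submodule.span ℤ (T'.edgeRow '' insert M.edgeCD
        (insert (M.edgeAB j) (lift '' B)))) ∧
      ∀ e ∈ insert M.edgeCD (insert (M.edgeAB j) (lift '' B)),
        T'.edgeRow e ∈ Submodule.span ℤ (T'.edgeRow '' B') := by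
  rcases h with ⟨h, h'⟩ | h
  · choose lift hlift hne using fun e : T.Edge => M.exists_lift e 0
    refine ⟨0, lift, hlift, hne, fun e' _ => ?_, fun e' _ => h' e'⟩
    by_cases h1 : e' = M.edgeCD
    · exact Submodule.subset_span ⟨e', Or.inl h1, rfl⟩
    by_cases h2 : e' = M.edgeAB 0
    · exact Submodule.subset_span ⟨e', Or.inr (Or.inl h2), rfl⟩
    obtain ⟨e, he⟩ := M.exists_proj h1
    rw [M.eq_of_proj_eq (he.trans (hlift e).symm) h2 (hne e)]
    exact M.edgeRow_lift_mem_span 0 lift hlift hne (h e)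
  · obtain ⟨j, lift, hlift, hne, hB⟩ := M.exists_lifts_of_sameOmittedEdges h
    refine ⟨j, lift, hlift, hne, fun e he => ?_, fun e he => ?_⟩
    · exact Submodule.subset_span ⟨e, hB ▸ he, rfl⟩
    · exact Submodule.subset_span ⟨e, hB ▸ he, rfl⟩

/-- Elimination of the new tetrahedra from a row by means of the rows of `CD` and `AB`. -/
def reduceRow (z' : ι ⊕ Fin 2 → ℂ) (l : ℂ) (j : Fin 2) (v : ι ⊕ Fin 2 → ℂ) (t : ι) : ℂ :=
  v (Sum.inl t) - (v (Sum.inr 1) - l * v (Sum.inr 0)) /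
    (T'.edgeLoopRow z' (M.edgeAB j) (Sum.inr 1) - l * T'.edgeLoopRow z' (M.edgeAB j) (Sum.inr 0)) *
      T'.edgeLoopRow z' (M.edgeAB j) (Sum.inl t)

theorem loopRow_inl {z : ι → ℂ} {z' : ι ⊕ Fin 2 → ℂ} (hzz' : ∀ t, z t = z' (Sum.inl t))
    {c' : Quot T'.EdgeStep → ℂ} {c : Quot T.EdgeStep → ℂ}
    (h : ∀ t a b, c (T.edgeClass t a b) = c' (T'.edgeClass (Sum.inl t) a b)) (t : ι) :
    T'.loopRow z' c' (Sum.inl t) = T.loopRow z c t := by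
  simp only [loopRow, typeSum_inl h, hzz']

theorem edgeLoopRow_edgeAB_sub [Finite ι] {z' : ι ⊕ Fin 2 → ℂ} {l : ℂ}
    (hl : ∀ u v, u ≠ v → shapeWeight (z' (Sum.inr 1)) (M.newType 1 u v) =
      l * shapeWeight (z' (Sum.inr 0)) (M.newType 0 u v)) (j : Fin 2) :
    T'.edgeLoopRow z' (M.edgeAB j) (Sum.inr 1) - l * T'.edgeLoopRow z' (M.edgeAB j) (Sum.inr 0) =
      l * shapeWeight (z' (Sum.inr 0)) (M.newType 0 0 1) * (-1) ^ (j.1 + 1) := by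
  rw [edgeLoopRow_eq, M.loopRow_inr_sub hl]
  simp only [edge_eq_iff, M.edgeAB_injective.eq_iff]
  fin_cases j <;> simp

theorem reduceRow_add (z' : ι ⊕ Fin 2 → ℂ) (l : ℂ) (j : Fin 2) (v w : ι ⊕ Fin 2 → ℂ) (t : ι) :
    M.reduceRow z' l j (fun s => v s + w s) t = M.reduceRow z' l j v t + M.reduceRow z' l j w t := by
  simp only [reduceRow]
  ring

open Classical in
-- Elimination adds the multiple of the edge `AB` number `j` that makes the values at both copies
-- equal, which is precisely the condition for descent.
theorem exists_reduceRow_loopRow [Finite ι] {z : ι → ℂ} {z' : ι ⊕ Fin 2 → ℂ}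
    (hzz' : ∀ t, z t = z' (Sum.inl t)) {l : ℂ} (hl0 : l ≠ 0)
    (hl : ∀ u v, u ≠ v → shapeWeight (z' (Sum.inr 1)) (M.newType 1 u v) =
      l * shapeWeight (z' (Sum.inr 0)) (M.newType 0 u v))
    (h0 : shapeWeight (z' (Sum.inr 0)) (M.newType 0 0 1) ≠ 0) (j : Fin 2)
    (c' : Quot T'.EdgeStep → ℂ) :
    ∃ c : Quot T.EdgeStep → ℂ, (∀ t a b, c (T.edgeClass t a b) = c' (T'.edgeClass (Sum.inl t) a b) +
        (c' (M.edgeAB (j + 1)).1 - c' (M.edgeAB j).1) *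
          (if T'.edgeClass (Sum.inl t) a b = (M.edgeAB j).1 then 1 else 0)) ∧
      M.reduceRow z' l j (T'.loopRow z' c') = T.loopRow z c := by
  have hAB : (M.edgeAB 0).1 ≠ (M.edgeAB 1).1 := fun h => M.edgeAB_ne (Subtype.ext h)
  obtain ⟨c, hc⟩ := M.exists_descent (fun x => c' x +
    (c' (M.edgeAB (j + 1)).1 - c' (M.edgeAB j).1) * (if x = (M.edgeAB j).1 then 1 else 0)) (by
      show c' (M.edgeAB 0).1 + _ * (if (M.edgeAB 0).1 = _ then 1 else 0) =
        c' (M.edgeAB 1).1 + _ * (if (M.edgeAB 1).1 = _ then 1 else 0)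
      fin_cases j
      · simp [hAB.symm]
      · simp [hAB])
  refine ⟨c, hc, funext fun t => ?_⟩
  rw [← loopRow_inl (T' := T') (c' := fun x => c' x +
    (c' (M.edgeAB (j + 1)).1 - c' (M.edgeAB j).1) * (if x = (M.edgeAB j).1 then 1 else 0)) hzz' hc,
    loopRow_add, loopRow_mul, ← edgeLoopRow_eq, reduceRow,
    M.edgeLoopRow_edgeAB_sub hl, M.loopRow_inr_sub hl, Pi.add_apply, Pi.smul_apply, smul_eq_mul,
    sub_eq_add_neg, ← neg_mul]
  congr 2
  have h1 := mul_ne_zero hl0 h0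
  rw [mul_div_mul_left _ _ h1]
  fin_cases j
  · simp
    ring
  · simp

theorem reduceRow_edgeLoopRow [Finite ι] {z : ι → ℂ} {z' : ι ⊕ Fin 2 → ℂ}
    (hzz' : ∀ t, z t = z' (Sum.inl t)) {l : ℂ} (hl0 : l ≠ 0)
    (hl : ∀ u v, u ≠ v → shapeWeight (z' (Sum.inr 1)) (M.newType 1 u v) =
      l * shapeWeight (z' (Sum.inr 0)) (M.newType 0 u v))
    (h0 : shapeWeight (z' (Sum.inr 0)) (M.newType 0 0 1) ≠ 0) {j : Fin 2} {e : T.Edge} {e' : T'.Edge}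
    (h : M.proj e'.1 = some e.1) (hne : e' ≠ M.edgeAB j) :
    M.reduceRow z' l j (T'.edgeLoopRow z' e') = T.edgeLoopRow z e := by
  classical
  rw [edgeLoopRow_eq, edgeLoopRow_eq]
  obtain ⟨c, hc, h1⟩ := M.exists_reduceRow_loopRow hzz' hl0 hl h0 j
    (fun x => if x = e'.1 then (1 : ℂ) else 0)
  rw [h1]
  refine T.loopRow_congr z fun f => ?_
  obtain ⟨_, t, a, b, hab, rfl⟩ := f
  have h2 := M.indicator_proj (R := ℂ) h hne ⟨T'.edgeClass (Sum.inl t) a b, _, _, _, hab, rfl⟩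
  have h3 : (M.edgeAB j).1 ≠ e'.1 := fun h => hne (Subtype.ext h.symm)
  rw [hc, if_neg h3, sub_zero]
  refine h2.trans ?_
  simp only [proj_inl, Option.some_inj]

/-- After removal of an edge row, the curve row is proportional to `(1, l)` on the new columns, so
elimination does not alter it; the removed row reduces to an old edge row, which the chosen edges
span. -/
theorem reduceRow_curveLoopRow_sub_mem [Fintype ι] {κ : Type*} (α : T.CurveSystem κ)
    (c : T.Choice κ) {z : ι → ℂ} {z' : ι ⊕ Fin 2 → ℂ}
    (hzz' : ∀ t, z t = z' (Sum.inl t)) {l : ℂ} (hl0 : l ≠ 0)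
    (hl : ∀ u v, u ≠ v → shapeWeight (z' (Sum.inr 1)) (M.newType 1 u v) =
      l * shapeWeight (z' (Sum.inr 0)) (M.newType 0 u v))
    (h0 : shapeWeight (z' (Sum.inr 0)) (M.newType 0 0 1) ≠ 0) (j : Fin 2)
    {γ : NormalCurve T} {γ' : NormalCurve T'} (h : SameClass γ γ') :
    M.reduceRow z' l j (curveLoopRow z' γ') - curveLoopRow z γ ∈
      Submodule.span ℂ (T.edgeLoopRow z '' c.edges) := by
  obtain ⟨d, h1, h2⟩ := M.curveLoopRow_sub hzz' hl h
  obtain ⟨d₀, -, h3⟩ := M.exists_reduceRow_loopRow hzz' hl0 hl h0 j d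
  have h4 : M.reduceRow z' l j (curveLoopRow z' γ') - curveLoopRow z γ = T.loopRow z d₀ := by
    funext t
    have h5 := M.reduceRow_add z' l j (fun s => curveLoopRow z' γ' s - T'.loopRow z' d s)
      (T'.loopRow z' d) t
    simp only [sub_add_cancel] at h5
    rw [Pi.sub_apply, h5, h3, reduceRow, h1, h2, sub_self, zero_div, zero_mul, sub_zero,
      add_sub_cancel_left]
  rw [h4]
  refine Submodule.span_le.2 ?_ (T.loopRow_mem_span z d₀)
  rintro _ ⟨e, rfl⟩
  exact T.edgeLoopRow_mem_span α c z e

theorem edgeLoopRow_edgeCD_inl (z' : ι ⊕ Fin 2 → ℂ) (t : ι) :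
    T'.edgeLoopRow z' M.edgeCD (Sum.inl t) = 0 := by
  classical
  rw [edgeLoopRow_eq, loopRow_inl (T := T) (z := fun t => z' (Sum.inl t)) (fun _ => rfl) (c := fun _ => 0)]
  · simp [loopRow, GluedTetrahedra.typeSum]
  · intro t a b
    rw [if_neg]
    intro h
    have h1 := congrArg M.proj h
    rw [proj_edgeCD, proj_inl] at h1
    exact absurd h1 (by simp)

theorem edgeLoopRow_edgeCD_inr (z' : ι ⊕ Fin 2 → ℂ) (j : Fin 2) :
    T'.edgeLoopRow z' M.edgeCD (Sum.inr j) = shapeWeight (z' (Sum.inr j)) (M.newType j 0 1) := by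
  classical
  have hcd : M.newEdge j 2 3 = M.edgeCD.1 := by
    rcases (by omega : j = 0 ∨ j = 1) with rfl | rfl
    · rfl
    · exact M.newEdge_one (by decide) (by decide)
  have h {k u v : Fin 4} (hk : k = 2 ∨ k = 3) (hu : u ≠ k) (hv : v ≠ k) :
      M.newEdge j u v ≠ M.edgeCD.1 := by
    intro h
    have h1 := congrArg M.proj h
    rw [proj_edgeCD, M.proj_newEdge j hk hu hv] at h1
    exact absurd h1 (by simp)
  rw [edgeLoopRow_eq, M.loopRow_inr, if_pos hcd,
    if_neg (h (Or.inr rfl) (u := 0) (v := 1) (by decide) (by decide)),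
    if_neg (h (Or.inr rfl) (u := 0) (v := 2) (by decide) (by decide)),
    if_neg (h (Or.inl rfl) (u := 1) (v := 3) (by decide) (by decide)),
    if_neg (h (Or.inl rfl) (u := 0) (v := 3) (by decide) (by decide)),
    if_neg (h (Or.inr rfl) (u := 1) (v := 2) (by decide) (by decide))]
  ring

/-- Comparison of the determinants in the 1-loop invariants. -/
theorem det_eq_or_neg [Fintype ι] [DecidableEq ι] {κ : Type*} {α : T.CurveSystem κ}
    {α' : T'.CurveSystem κ}
    (hα : ∀ i, SameClass (α.curve i).toNormalCurve (α'.curve i).toNormalCurve)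
    {z : ι → ℂ} {z' : ι ⊕ Fin 2 → ℂ} (hz' : z' ∈ T'.gluingVariety)
    (hzz' : ∀ t, z t = z' (Sum.inl t)) (c : T.Choice κ) (c' : T'.Choice κ)
    (hc : (T.GeneratesEdgeEquations c.edges ∧ T'.GeneratesEdgeEquations c'.edges) ∨
      SameOmittedEdges c.edges c'.edges) :
    ∃ ε : ℂ, (ε = 1 ∨ ε = -1) ∧
    (Matrix.of fun i => Sum.elim (fun e : c'.edges => T'.edgeLoopRow z' e)
      (fun a => curveLoopRow z' (α'.curve a).toNormalCurve) (c'.row i)).det =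
    ε * (shapeWeight (z' (Sum.inr 0)) (M.newType 0 0 1) *
      shapeWeight (z' (Sum.inr 1)) (M.newType 1 0 1)) *
    (Matrix.of fun i => Sum.elim (fun e : c.edges => T.edgeLoopRow z e)
      (fun a => curveLoopRow z (α.curve a).toNormalCurve) (c.row i)).det := by
  obtain ⟨l, hl0, hl⟩ := M.exists_weight_ratio hz'
  have h0 := shapeWeight_ne_zero (hz'.1 (Sum.inr 0)).1 (hz'.1 (Sum.inr 0)).2 (M.newType 0 0 1)
  obtain ⟨j, lift, hlift, hne, hS, hS'⟩ := M.exists_lifts hc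
  have hκ : Finite κ := Finite.of_injective (fun i : κ => c.row.symm (Sum.inr i))
    (c.row.symm.injective.comp Sum.inr_injective)
  -- An intermediate matrix for the new triangulation, built from lifts of the old edges and from
  -- the new curves, with `CD` and one copy of `AB` as additional rows.
  let A : Matrix (ι ⊕ Fin 2) (ι ⊕ Fin 2) ℂ := Matrix.of (Sum.elim
    (fun i => Sum.elim (fun e : c.edges => T'.edgeLoopRow z' (lift e))
      (fun a => curveLoopRow z' (α'.curve a).toNormalCurve) (c.row i))
    ![T'.edgeLoopRow z' M.edgeCD, T'.edgeLoopRow z' (M.edgeAB j)])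
  have hA : T'.edgeLoopRow z' '' insert M.edgeCD (insert (M.edgeAB j) (lift '' c.edges)) ⊆
      Set.range A := by
    rintro _ ⟨_, rfl | rfl | ⟨e, he, rfl⟩, rfl⟩
    · exact ⟨Sum.inr 0, rfl⟩
    · exact ⟨Sum.inr 1, rfl⟩
    · exact ⟨Sum.inl (c.row.symm (Sum.inl ⟨e, he⟩)), Equiv.sumElim_symm_inl c.row _ _ _⟩
  have hdet : A.det = shapeWeight (z' (Sum.inr 0)) (M.newType 0 0 1) *
      (l * shapeWeight (z' (Sum.inr 0)) (M.newType 0 0 1) * (-1) ^ (j.1 + 1)) *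
      (Matrix.of fun i => Sum.elim (fun e : c.edges => T.edgeLoopRow z e)
        (fun a => M.reduceRow z' l j (curveLoopRow z' (α'.curve a).toNormalCurve)) (c.row i)).det := by
    rw [det_eq_mul_det_of_two_rows A (l := l) (mul_ne_zero (mul_ne_zero hl0 h0)
      (pow_ne_zero (j.1 + 1) (neg_ne_zero.2 (one_ne_zero (α := ℂ)))))
      (M.edgeLoopRow_edgeCD_inl z') (M.edgeLoopRow_edgeCD_inr z' 0)
      ((M.edgeLoopRow_edgeCD_inr z' 1).trans (hl 0 1 (by decide))) (M.edgeLoopRow_edgeAB_sub hl j)]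
    congr 2
    ext i t
    rw [← M.edgeLoopRow_edgeAB_sub hl j]
    simp only [Matrix.of_apply]
    show M.reduceRow z' l j (Sum.elim (fun e : c.edges => T'.edgeLoopRow z' (lift e))
      (fun a => curveLoopRow z' (α'.curve a).toNormalCurve) (c.row i)) t = _
    rcases c.row i with e | a
    · exact congrFun (M.reduceRow_edgeLoopRow hzz' hl0 hl h0 (hlift e) (hne e)) t
    · rfl
  rw [det_eq_of_sub_mem_span c.row (fun e : c.edges => T.edgeLoopRow z e)
    (fun a => curveLoopRow z (α.curve a).toNormalCurve) _ (fun a => by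
      have := M.reduceRow_curveLoopRow_sub_mem α c hzz' hl0 hl h0 j (hα a)
      rwa [Set.image_eq_range] at this)] at hdet
  have hspan := det_eq_or_neg_of_span (A := Matrix.of fun i => Sum.elim
      (fun e : c'.edges => T'.edgeLoopRow z' e)
      (fun a => curveLoopRow z' (α'.curve a).toNormalCurve) (c'.row i)) (B := A) (fun i => by
    show Sum.elim _ _ (c'.row i) ∈ _
    rcases c'.row i with e | a
    · exact Submodule.span_mono hA (T'.edgeLoopRow_mem_span_int z' (hS e.1 e.2))
    · exact Submodule.subset_span ⟨Sum.inl (c.row.symm (Sum.inr a)),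
        Equiv.sumElim_symm_inr c.row _ _ _⟩) (fun i => by
    have hC : T'.edgeLoopRow z' '' c'.edges ⊆ Set.range (Matrix.of fun i => Sum.elim
        (fun e : c'.edges => T'.edgeLoopRow z' e)
        (fun a => curveLoopRow z' (α'.curve a).toNormalCurve) (c'.row i)) := by
      rintro _ ⟨e, he, rfl⟩
      exact ⟨c'.row.symm (Sum.inl ⟨e, he⟩), Equiv.sumElim_symm_inl c'.row _ _ _⟩
    have hE (e) (he : e ∈ insert M.edgeCD (insert (M.edgeAB j) (lift '' c.edges))) :=
      Submodule.span_mono hC (T'.edgeLoopRow_mem_span_int z' (hS' e he))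
    rcases i with i | i
    · show Sum.elim _ _ (c.row i) ∈ _
      rcases c.row i with e | a
      · exact hE _ (Or.inr (Or.inr ⟨e.1, e.2, rfl⟩))
      · exact Submodule.subset_span ⟨c'.row.symm (Sum.inr a), Equiv.sumElim_symm_inr c'.row _ _ _⟩
    · fin_cases i
      · exact hE _ (Or.inl rfl)
      · exact hE _ (Or.inr (Or.inl rfl)))
  rw [hl 0 1 (by decide)]
  rcases hspan with h | h <;> rw [h, hdet] <;> rcases (by omega : j = 0 ∨ j = 1) with rfl | rfl
  · exact ⟨-1, Or.inr rfl, by simp⟩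
  · exact ⟨1, Or.inl rfl, by simp⟩
  · exact ⟨1, Or.inl rfl, by simp⟩
  · exact ⟨-1, Or.inr rfl, by simp⟩

end ZeroTwoMove

end IdealTriangulation

namespace IdealTriangulation

namespace ZeroTwoMove

variable {ι : Type*} {T : IdealTriangulation ι} {T' : IdealTriangulation (ι ⊕ Fin 2)}
  (M : ZeroTwoMove T T')

/-! ### Lifts of curves -/

/-- The vertex of the link at the edge `uv` of the new tetrahedron `j`, near `u`. -/
def newLinkVertex (j : Fin 2) (u v : Fin 4) : Quot T'.LinkStep :=
  T'.linkVertex (Sum.inr j) (M.lab j u) (M.lab j v)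

theorem linkVertex_across {ι : Type*} (T : IdealTriangulation ι) (x : ι × Equiv.Perm (Fin 4))
    {k u v : Fin 4} (hu : u ≠ k) (hv : v ≠ k) :
    T.linkVertex (T.across x k).1 ((T.across x k).2 u) ((T.across x k).2 v) =
      T.linkVertex x.1 (x.2 u) (x.2 v) :=
  (Quot.sound (GluedTetrahedra.LinkStep.glue x.1 (x.2 k) (x.2 u) (x.2 v) (by simpa using hu)
    (by simpa using hv))).symm

theorem newLinkVertex_succ (j : Fin 2) {k u v : Fin 4} (hk : k = 0 ∨ k = 1) (hu : u ≠ k)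
    (hv : v ≠ k) : M.newLinkVertex (j + 1) u v = M.newLinkVertex j u v := by
  have h := linkVertex_across T' (Sum.inr j, M.lab j) hu hv
  rw [M.across_inr_inner j hk] at h
  exact h

theorem linkVertex_inl_opened (j : Fin 2) {k u v : Fin 4} (hk : k = 2 ∨ k = 3) (hu : u ≠ k)
    (hv : v ≠ k) :
    T'.linkVertex (Sum.inl (M.opened j k).1) ((M.opened j k).2 u) ((M.opened j k).2 v) =
      M.newLinkVertex j u v := by
  have h := linkVertex_across T' (Sum.inl (M.opened j k).1, (M.opened j k).2) hu hv
  rw [M.across_inl_opened j hk] at h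
  exact h.symm

theorem newLinkVertex_one {u v : Fin 4} (h : ¬ (u = 0 ∧ v = 1)) (h' : ¬ (u = 1 ∧ v = 0)) :
    M.newLinkVertex 1 u v = M.newLinkVertex 0 u v := by
  have key : ∀ u v : Fin 4, ¬ (u = 0 ∧ v = 1) → ¬ (u = 1 ∧ v = 0) →
      (u ≠ 0 ∧ v ≠ 0) ∨ (u ≠ 1 ∧ v ≠ 1) := by decide
  rcases key u v h h' with ⟨hu, hv⟩ | ⟨hu, hv⟩
  · exact M.newLinkVertex_succ 0 (Or.inl rfl) hu hv
  · exact M.newLinkVertex_succ 0 (Or.inr rfl) hu hv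

theorem exists_link_descent {N : Type*} (p' : Quot T'.LinkStep → N)
    (h : p' (M.newLinkVertex 1 0 1) = p' (M.newLinkVertex 0 0 1))
    (h' : p' (M.newLinkVertex 1 1 0) = p' (M.newLinkVertex 0 1 0)) :
    ∃ p : Quot T.LinkStep → N, ∀ t a b, p (T.linkVertex t a b) = p' (T'.linkVertex (Sum.inl t) a b) := by
  refine ⟨Quot.lift (fun x => p' (T'.linkVertex (Sum.inl x.1) x.2.1 x.2.2)) ?_, fun _ _ _ => rfl⟩
  have h1 (u v : Fin 4) : p' (M.newLinkVertex 1 u v) = p' (M.newLinkVertex 0 u v) := by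
    by_cases h1 : u = 0 ∧ v = 1
    · rw [h1.1, h1.2, h]
    · by_cases h2 : u = 1 ∧ v = 0
      · rw [h2.1, h2.2, h']
      · rw [M.newLinkVertex_one h1 h2]
  have h01 (u v : Fin 4) (j : Fin 2) : p' (M.newLinkVertex (j + 1) u v) =
      p' (M.newLinkVertex j u v) := by
    rcases (by omega : j = 0 ∨ j = 1) with rfl | rfl
    · exact h1 u v
    · exact (h1 u v).symm
  rintro _ _ ⟨t, f, a, b, ha, hb⟩
  show p' (T'.linkVertex (Sum.inl t) a b) =
    p' (T'.linkVertex (Sum.inl (T.nbr t f)) (T.perm t f a) (T.perm t f b))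
  rcases M.opened_or_old t f with ⟨j, k, hk, rfl, rfl⟩ | ⟨h1, h2⟩
  · obtain ⟨u, rfl⟩ := (M.opened j k).2.surjective a
    obtain ⟨v, rfl⟩ := (M.opened j k).2.surjective b
    have hu : u ≠ k := fun h => ha (by rw [h])
    have hv : v ≠ k := fun h => hb (by rw [h])
    rw [M.nbr_opened j hk, M.perm_opened j hk, M.perm_opened j hk, M.linkVertex_inl_opened j hk hu hv,
      M.linkVertex_inl_opened (j + 1) hk hu hv, h01]
  · rw [← h1, ← h2]
    exact congrArg p' (Quot.sound (GluedTetrahedra.LinkStep.glue (Sum.inl t) f a b ha hb))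

/-- A curve is trivial if it agrees with a trivial curve outside the pillow. -/
theorem isTrivial_of_lift (M : ZeroTwoMove T T') {γ : NormalCurve T} {γ' : NormalCurve T'}
    (hc : ∀ t v f, γ'.crossing (Sum.inl t) v f = γ.crossing t v f) (h : γ'.IsTrivial) :
    γ.IsTrivial := by
  obtain ⟨p', hp⟩ := h
  have hflow (t : ι ⊕ Fin 2) (v f : Fin 4) : γ'.crossing t v f = T'.boundaryFlow p' t v f := by
    by_cases hvf : v = f
    · rw [hvf, NormalCurve.crossing_self, boundaryFlow_self]
    obtain ⟨σ, rfl, rfl, hs⟩ := exists_perm_pair hvf 1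
    rw [hp (t, σ) hs, boundaryFlow_even _ _ _ _ hs]
  have hr (v : Fin 4) : T'.boundaryFlow p' (Sum.inr 1) (M.lab 1 v) (M.lab 1 2) =
      -T'.boundaryFlow p' (Sum.inr 0) (M.lab 0 v) (M.lab 0 2) := by
    have h1 (j : Fin 2) : γ.crossing (M.opened j 2).1 ((M.opened j 2).2 v) ((M.opened j 2).2 2) =
        -T'.boundaryFlow p' (Sum.inr j) (M.lab j v) (M.lab j 2) := by
      have h1 := T'.boundaryFlow_glue p' (Sum.inr j) (M.lab j v) (M.lab j 2)
      rwa [M.nbr_inr_outer j (Or.inl rfl), M.perm_inr_outer j (Or.inl rfl),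
        M.perm_inr_outer j (Or.inl rfl), ← hflow, hc] at h1
    have h2 := γ.crossing_glue (M.opened 0 2).1 ((M.opened 0 2).2 v) ((M.opened 0 2).2 2)
    rw [M.nbr_opened 0 (Or.inl rfl), M.perm_opened 0 (Or.inl rfl), M.perm_opened 0 (Or.inl rfl),
      zero_add, h1, h1] at h2
    linarith
  -- On the side in the face `ABD` of the triangle at `A` or `B`, the flows of both new tetrahedra
  -- correspond and the corner towards `D` is common to both; hence `p'` also agrees at the two
  -- corners on `AB`.
  have hab (σ : Equiv.Perm (Fin 4)) (h2 : σ 1 = 2) (h3 : σ 3 = 3) :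
      p' (M.newLinkVertex 1 (σ 0) (σ 2)) = p' (M.newLinkVertex 0 (σ 0) (σ 2)) := by
    have h4 := hr (σ 0)
    have e (j) := T'.boundaryFlow_perm p' (Sum.inr j) (M.lab j * σ)
    simp only [Equiv.Perm.mul_apply, h2, Equiv.Perm.sign_mul] at e
    rw [e, e, M.sign_lab] at h4
    have h5 : p' (M.newLinkVertex 1 (σ 0) (σ 3)) = p' (M.newLinkVertex 0 (σ 0) (σ 3)) := by
      rw [h3, M.newLinkVertex_one (by simp) (by simp)]
    simp only [newLinkVertex] at h5 ⊢
    rw [h5] at h4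
    rcases Int.units_eq_one_or (Equiv.Perm.sign (M.lab 0)) with hs | hs <;>
      rcases Int.units_eq_one_or (Equiv.Perm.sign σ) with hs' | hs' <;> rw [hs, hs'] at h4 <;>
      push_cast at h4 <;> linarith
  obtain ⟨p, hp'⟩ := M.exists_link_descent p'
    (hab (Equiv.swap 1 2) (by decide) (by decide))
    (hab (Equiv.swap 0 2 * Equiv.swap 0 1) (by decide) (by decide))
  refine ⟨p, fun x hx => ?_⟩
  rw [← hc, hp (Sum.inl x.1, x.2) hx, boundaryCrossing, boundaryCrossing, hp', hp']

end ZeroTwoMove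

end IdealTriangulation

/-! ### Construction of the lifted curve. -/

namespace IdealTriangulation

namespace ZeroTwoMove

variable {ι : Type*} {T : IdealTriangulation ι} {T' : IdealTriangulation (ι ⊕ Fin 2)}
  (M : ZeroTwoMove T T')

/-- Provides the route through the pillow: entry through the outer face `k` near the vertex `v`,
then passage to the other new tetrahedron through an inner face that contains `v`. -/
theorem exists_middle (v k : Fin 4) (hk : k = 2 ∨ k = 3) (hv : v ≠ k) :
    ∃ μ : Equiv.Perm (Fin 4), μ 0 = v ∧ μ 1 = k ∧ (μ 2 = 0 ∨ μ 2 = 1) := by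
  rcases hk with rfl | rfl <;> revert v <;> decide

/-- The arcs in which a curve leaves a triangle through an opened face. -/
def IsOpened (x : ι × Equiv.Perm (Fin 4)) : Prop :=
  ∃ j k, (k = 2 ∨ k = 3) ∧ x.1 = (M.opened j k).1 ∧ x.2 2 = (M.opened j k).2 k

/-- The data at a passage of a curve through an opened face. -/
structure Passage (x : ι × Equiv.Perm (Fin 4)) where
  j : Fin 2
  k : Fin 4
  hk : k = 2 ∨ k = 3
  τ : Equiv.Perm (Fin 4)
  hτ : τ 2 = k
  hx : x = ((M.opened j k).1, (M.opened j k).2 * τ)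
  μ : Equiv.Perm (Fin 4)
  hμ0 : μ 0 = τ 0
  hμ1 : μ 1 = k
  hμ2 : μ 2 = 0 ∨ μ 2 = 1

theorem IsOpened.nonempty {x : ι × Equiv.Perm (Fin 4)} (h : M.IsOpened x) :
    Nonempty (M.Passage x) := by
  obtain ⟨j, k, hk, h1, h2⟩ := h
  let τ := (M.opened j k).2⁻¹ * x.2
  have hτ : τ 2 = k := by
    simp only [τ, Equiv.Perm.mul_apply, h2]
    exact Equiv.symm_apply_apply _ _
  obtain ⟨μ, h3, h4, h5⟩ := exists_middle (τ 0) k hk (by rw [← hτ]; simp)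
  exact ⟨⟨j, k, hk, τ, hτ, Prod.ext h1 (by simp [τ]), μ, h3, h4, h5⟩⟩

/-- The arcs of the lift of a curve. -/
abbrev LiftArc (γ : NormalCurve T) : Type :=
  Fin (γ.m + 1) ⊕ ({i : Fin (γ.m + 1) // M.IsOpened (γ.arc i)} × Fin 2)

open Classical in
/-- The cyclic order of the arcs of the lift of a curve. -/
def liftNext (γ : NormalCurve T) : M.LiftArc γ → M.LiftArc γ
  | Sum.inl i => if h : M.IsOpened (γ.arc i) then Sum.inr (⟨i, h⟩, 0) else Sum.inl (i + 1)
  | Sum.inr (o, e) => if e = 0 then Sum.inr (o, 1) else Sum.inl (o.1 + 1)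

theorem liftNext_inl_of_isOpened (γ : NormalCurve T) {i : Fin (γ.m + 1)} (h : M.IsOpened (γ.arc i)) :
    M.liftNext γ (Sum.inl i) = Sum.inr (⟨i, h⟩, 0) := dif_pos h

theorem liftNext_inl_of_not_isOpened (γ : NormalCurve T) {i : Fin (γ.m + 1)}
    (h : ¬ M.IsOpened (γ.arc i)) : M.liftNext γ (Sum.inl i) = Sum.inl (i + 1) := dif_neg h

theorem liftNext_inr_zero (γ : NormalCurve T) (o : {i : Fin (γ.m + 1) // M.IsOpened (γ.arc i)}) :
    M.liftNext γ (Sum.inr (o, 0)) = Sum.inr (o, 1) := rfl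

theorem liftNext_inr_one (γ : NormalCurve T) (o : {i : Fin (γ.m + 1) // M.IsOpened (γ.arc i)}) :
    M.liftNext γ (Sum.inr (o, 1)) = Sum.inl (o.1 + 1) := rfl

theorem exists_iterate_liftNext (γ : NormalCurve T) (i : Fin (γ.m + 1)) :
    ∃ n > 0, (M.liftNext γ)^[n] (Sum.inl i) = Sum.inl (i + 1) := by
  by_cases h : M.IsOpened (γ.arc i)
  · exact ⟨3, by norm_num, by
      show M.liftNext γ (M.liftNext γ (M.liftNext γ _)) = _
      rw [M.liftNext_inl_of_isOpened γ h, liftNext_inr_zero, liftNext_inr_one]⟩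
  · exact ⟨1, by norm_num, M.liftNext_inl_of_not_isOpened γ h⟩

theorem exists_iterate_liftNext_inl (γ : NormalCurve T) (i : Fin (γ.m + 1)) :
    ∃ n, (M.liftNext γ)^[n] (Sum.inl 0) = Sum.inl i := by
  induction i using Fin.induction with
  | zero => exact ⟨0, rfl⟩
  | succ i ih =>
    obtain ⟨n, hn⟩ := ih
    obtain ⟨k, -, hk⟩ := M.exists_iterate_liftNext γ i.castSucc
    exact ⟨k + n, by rw [Function.iterate_add_apply, hn, hk, Fin.coeSucc_eq_succ]⟩

theorem liftNext_periodic (γ : NormalCurve T) :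
    ∃ n > 0, (M.liftNext γ)^[n] (Sum.inl 0) = Sum.inl 0 := by
  obtain ⟨n, hn⟩ := M.exists_iterate_liftNext_inl γ (Fin.last γ.m)
  obtain ⟨k, hk0, hk⟩ := M.exists_iterate_liftNext γ (Fin.last γ.m)
  exact ⟨k + n, by omega, by rw [Function.iterate_add_apply, hn, hk, Fin.last_add_one]⟩

theorem liftNext_reach (γ : NormalCurve T) (s : M.LiftArc γ) :
    ∃ n, (M.liftNext γ)^[n] (Sum.inl 0) = s := by
  rcases s with i | ⟨⟨i, hi⟩, e⟩
  · exact M.exists_iterate_liftNext_inl γ i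
  · obtain ⟨n, hn⟩ := M.exists_iterate_liftNext_inl γ i
    rcases (by omega : e = 0 ∨ e = 1) with rfl | rfl
    · exact ⟨n + 1, by
        rw [Function.iterate_succ_apply', hn, M.liftNext_inl_of_isOpened γ hi]⟩
    · exact ⟨n + 2, by
        rw [Function.iterate_succ_apply', Function.iterate_succ_apply', hn,
          M.liftNext_inl_of_isOpened γ hi, liftNext_inr_zero]⟩

/-- A passage through each opened face. -/
def passage {x : ι × Equiv.Perm (Fin 4)} (h : M.IsOpened x) : M.Passage x := h.nonempty.some

/-- The flags of the arcs of the lift of a curve. -/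
def liftFlag (γ : NormalCurve T) : M.LiftArc γ → (ι ⊕ Fin 2) × Equiv.Perm (Fin 4)
  | Sum.inl i => (Sum.inl (γ.arc i).1, (γ.arc i).2)
  | Sum.inr (o, e) =>
    if e = 0 then (Sum.inr (M.passage o.2).j, M.lab (M.passage o.2).j * (M.passage o.2).μ)
    else (Sum.inr ((M.passage o.2).j + 1),
      M.lab ((M.passage o.2).j + 1) * ((M.passage o.2).μ * Equiv.swap 1 2))

/-- The initial points of the arcs of the lift of a curve. -/
def liftPoint (γ : NormalCurve T) : M.LiftArc γ → Fin 4 → ℝ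
  | Sum.inl i => sideMidpoint ((γ.arc i).2 0) ((γ.arc i).2 1)
  | Sum.inr (o, e) =>
    if e = 0 then fun w => sideMidpoint ((M.passage o.2).μ 0) (M.passage o.2).k
      ((M.lab (M.passage o.2).j).symm w)
    -- The inner face is crossed off-centre, nearer to the corner cut off. At `A` and `B`, passages
    -- entering through different faces then stay on different sides of the line where the
    -- coordinates of `C` and `D` agree.
    else fun w => (Pi.single ((M.passage o.2).μ 3) (2 / 3) + Pi.single (M.passage o.2).k (1 / 3) :
      Fin 4 → ℝ) ((M.lab ((M.passage o.2).j + 1)).symm w)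

theorem swap_one_two_apply : (Equiv.swap 1 2 : Equiv.Perm (Fin 4)) 0 = 0 ∧
    (Equiv.swap 1 2 : Equiv.Perm (Fin 4)) 1 = 2 ∧ (Equiv.swap 1 2 : Equiv.Perm (Fin 4)) 2 = 1 ∧
    (Equiv.swap 1 2 : Equiv.Perm (Fin 4)) 3 = 3 := by decide

theorem liftFlag_next (γ : NormalCurve T) (s : M.LiftArc γ) :
    (M.liftFlag γ (M.liftNext γ s)).1 = (T'.across (M.liftFlag γ s) 2).1 ∧
    (M.liftFlag γ (M.liftNext γ s)).2 0 = (T'.across (M.liftFlag γ s) 2).2 0 ∧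
    (M.liftFlag γ (M.liftNext γ s)).2 1 = (T'.across (M.liftFlag γ s) 2).2 2 := by
  obtain ⟨e0, e1, e2, e3⟩ := swap_one_two_apply
  rcases s with i | ⟨⟨i, hi⟩, e⟩
  · by_cases h : M.IsOpened (γ.arc i)
    · rw [M.liftNext_inl_of_isOpened γ h]
      rcases hp : M.passage h with ⟨j, k, hk, τ, hτ, hx, μ, h0, h1, h2⟩
      simp only [liftFlag, hp]
      rw [hx]
      simp only [T'.across_mul, hτ, M.across_inl_opened j hk, if_true]
      simp [h0, h1, hτ]
    · rw [M.liftNext_inl_of_not_isOpened γ h]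
      rcases M.opened_or_old (γ.arc i).1 ((γ.arc i).2 2) with h' | ⟨h1, h2⟩
      · exact absurd h' h
      · simp only [liftFlag, GluedTetrahedra.across, h1, h2, γ.tet_succ, γ.vertex_succ, γ.side_succ,
          and_self]
  · rcases (by omega : e = 0 ∨ e = 1) with rfl | rfl
    · rw [liftNext_inr_zero]
      rcases hp : M.passage hi with ⟨j, k, hk, τ, hτ, hx, μ, h0, h1, h2⟩
      simp only [liftFlag, hp, if_true, if_neg (one_ne_zero (α := Fin 2))]
      simp only [T'.across_mul, M.across_inr_inner j h2]
      simp [e0, e1]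
    · rw [liftNext_inr_one]
      rcases hp : M.passage hi with ⟨j, k, hk, τ, hτ, hx, μ, h0, h1, h2⟩
      simp only [liftFlag, hp, if_neg (one_ne_zero (α := Fin 2)), γ.tet_succ, γ.vertex_succ,
        γ.side_succ]
      rw [hx]
      simp only [T'.across_mul, T.across_mul, hτ, Equiv.Perm.mul_apply, e2, h1,
        M.across_inr_outer (j + 1) hk, M.across_opened j hk, e0, h0, and_self]

theorem liftPoint_spec (γ : NormalCurve T) (s : M.LiftArc γ) :
    M.liftPoint γ s ((M.liftFlag γ s).2 0) = 0 ∧ M.liftPoint γ s ((M.liftFlag γ s).2 1) = 0 ∧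
    (0 < M.liftPoint γ s ((M.liftFlag γ s).2 2) ∧ 0 < M.liftPoint γ s ((M.liftFlag γ s).2 3)) ∧
    ∑ w, M.liftPoint γ s w = 1 := by
  obtain ⟨e0, e1, e2, e3⟩ := swap_one_two_apply
  rcases s with i | ⟨⟨i, hi⟩, e⟩
  · exact ⟨by simp [liftPoint, liftFlag, sideMidpoint], by simp [liftPoint, liftFlag, sideMidpoint],
      by simp [liftPoint, liftFlag, sideMidpoint], sum_sideMidpoint (by simp)⟩
  · rcases (by omega : e = 0 ∨ e = 1) with rfl | rfl
    · rcases hp : M.passage hi with ⟨j, k, hk, τ, hτ, hx, μ, h0, rfl, h2⟩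
      simp only [liftFlag, liftPoint, hp, if_true, Equiv.Perm.mul_apply, Equiv.symm_apply_apply]
      refine ⟨by simp [sideMidpoint], by simp [sideMidpoint], by simp [sideMidpoint], ?_⟩
      rw [Equiv.sum_comp (M.lab j).symm, sum_sideMidpoint (by simp)]
    · rcases hp : M.passage hi with ⟨j, k, hk, τ, hτ, hx, μ, h0, rfl, h2⟩
      simp only [liftFlag, liftPoint, hp, if_neg (one_ne_zero (α := Fin 2)), Equiv.Perm.mul_apply,
        Equiv.symm_apply_apply, e0, e1, e2, e3]
      refine ⟨by simp, by simp, by simp, ?_⟩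
      rw [Equiv.sum_comp (M.lab (j + 1)).symm
        (Pi.single (μ 3) (2 / 3) + Pi.single (μ 1) (1 / 3) : Fin 4 → ℝ)]
      simp [Finset.sum_add_distrib]
      norm_num

/-- The lift of a curve to the new triangulation, up to the choice of its numbering. -/
theorem exists_lift_curve (γ : NormalCurve T) :
    ∃ (γ' : NormalCurve T') (e : Fin (γ'.m + 1) ≃ M.LiftArc γ),
      (∀ i, e (i + 1) = M.liftNext γ (e i)) ∧ (∀ i, γ'.arc i = M.liftFlag γ (e i)) ∧
        ∀ i, γ'.pt i = M.liftPoint γ (e i) :=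
  T'.exists_normalCurve (M.liftNext γ) (Sum.inl 0) (M.liftNext_periodic γ) (M.liftNext_reach γ)
    (M.liftFlag γ) (M.liftPoint γ) (fun s => (M.liftFlag_next γ s).1)
    (fun s => (M.liftFlag_next γ s).2.1) (fun s => (M.liftFlag_next γ s).2.2)
    (fun s => (M.liftPoint_spec γ s).1) (fun s => (M.liftPoint_spec γ s).2.1)
    (fun s => (M.liftPoint_spec γ s).2.2.1) (fun s => (M.liftPoint_spec γ s).2.2.2)

end ZeroTwoMove

end IdealTriangulation

/-! ### Turning numbers, simplicity and nontriviality of the lifted curve. -/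

namespace IdealTriangulation

namespace ZeroTwoMove

variable {ι : Type*} {T : IdealTriangulation ι} {T' : IdealTriangulation (ι ⊕ Fin 2)}
  {M : ZeroTwoMove T T'}

theorem crossing_lift {γ : NormalCurve T} {γ' : NormalCurve T'} (e : Fin (γ'.m + 1) ≃ M.LiftArc γ)
    (harc : ∀ i, γ'.arc i = M.liftFlag γ (e i)) (t : ι) (v f : Fin 4) :
    γ'.crossing (Sum.inl t) v f = γ.crossing t v f := by
  classical
  simp only [NormalCurve.crossing, harc]
  rw [Equiv.sum_comp e (fun s : M.LiftArc γ =>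
    (if (M.liftFlag γ s).1 = Sum.inl t ∧ (M.liftFlag γ s).2 0 = v ∧ (M.liftFlag γ s).2 2 = f
      then (1 : ℤ) else 0) -
    (if (M.liftFlag γ s).1 = Sum.inl t ∧ (M.liftFlag γ s).2 0 = v ∧ (M.liftFlag γ s).2 1 = f
      then (1 : ℤ) else 0)), Fintype.sum_sum_type]
  rw [Finset.sum_eq_zero (s := (Finset.univ : Finset (_ × Fin 2))), add_zero]
  · simp only [liftFlag, Sum.inl.injEq]
  · rintro ⟨o, i⟩ -
    rcases (by omega : i = 0 ∨ i = 1) with rfl | rfl <;> simp [liftFlag]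

theorem newType_middle (j : Fin 2) (μ : Equiv.Perm (Fin 4)) :
    quadType (M.lab j (μ 0)) (M.lab j (μ 3)) = M.newType j (μ 1) (μ 2) := by
  have key : ∀ σ : Equiv.Perm (Fin 4), quadType (σ 0) (σ 3) = quadType (σ 1) (σ 2) := by decide
  exact key (M.lab j * μ)

/-- The two arcs inserted at a passage cut off corresponding corners in the two new tetrahedra.
Their signs agree, since both the orientation and the order of entry and exit are reversed, so the
hypothesis on `G` cancels their contributions. -/
theorem sum_turning_lift [Fintype ι] {γ : NormalCurve T} {γ' : NormalCurve T'}
    (e : Fin (γ'.m + 1) ≃ M.LiftArc γ) (harc : ∀ i, γ'.arc i = M.liftFlag γ (e i))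
    (G : ι ⊕ Fin 2 → Fin 3 → ℤ) (hG : ∀ k u, k = 2 ∨ k = 3 → u = 0 ∨ u = 1 →
      G (Sum.inr 0) (M.newType 0 k u) + G (Sum.inr 1) (M.newType 1 k u) = 0) :
    ∑ t, ∑ q, γ'.turning t q * G t q = ∑ t, ∑ q, γ.turning t q * G (Sum.inl t) q := by
  classical
  obtain ⟨e0, e1, e2, e3⟩ := swap_one_two_apply
  have h1 := γ'.sum_sum_turning G
  have h2 := γ.sum_sum_turning (fun t => G (Sum.inl t))
  simp only [Int.cast_id] at h1 h2
  rw [h1, h2]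
  simp only [harc]
  rw [Equiv.sum_comp e (fun s : M.LiftArc γ => (Equiv.Perm.sign (M.liftFlag γ s).2 : ℤ) *
    G (M.liftFlag γ s).1 (quadType ((M.liftFlag γ s).2 0) ((M.liftFlag γ s).2 3))),
    Fintype.sum_sum_type, Fintype.sum_prod_type]
  simp only [liftFlag]
  rw [add_eq_left]
  refine Finset.sum_eq_zero fun o _ => ?_
  rw [Fin.sum_univ_two]
  generalize M.passage o.2 = P
  have hs : ∀ j : Fin 2, Equiv.Perm.sign (M.lab (j + 1)) = -Equiv.Perm.sign (M.lab j) := by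
    intro j
    rcases (by omega : j = 0 ∨ j = 1) with rfl | rfl
    · exact M.sign_lab
    · show Equiv.Perm.sign (M.lab 0) = _
      rw [M.sign_lab, neg_neg]
  have hG' : G (Sum.inr P.j) (M.newType P.j (P.μ 1) (P.μ 2)) +
      G (Sum.inr (P.j + 1)) (M.newType (P.j + 1) (P.μ 1) (P.μ 2)) = 0 := by
    have h := hG (P.μ 1) (P.μ 2) (by rw [P.hμ1]; exact P.hk) P.hμ2
    generalize P.j = j
    rcases (by omega : j = 0 ∨ j = 1) with rfl | rfl
    · exact h
    · rw [← h, add_comm]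
      rfl
  simp only [if_true, if_neg (one_ne_zero (α := Fin 2)), Equiv.Perm.mul_apply, e0, e3,
    newType_middle, Equiv.Perm.sign_mul, hs, Equiv.Perm.sign_swap (by decide : (1 : Fin 4) ≠ 2)]
  rw [eq_neg_of_add_eq_zero_right hG']
  push_cast
  ring

theorem arc_succ_of_passage (γ : NormalCurve T) {i : Fin (γ.m + 1)} (P : M.Passage (γ.arc i)) :
    (γ.arc (i + 1)).1 = (M.opened (P.j + 1) P.k).1 ∧
    (γ.arc (i + 1)).2 0 = (M.opened (P.j + 1) P.k).2 (P.μ 0) ∧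
    (γ.arc (i + 1)).2 1 = (M.opened (P.j + 1) P.k).2 P.k := by
  have h : T.across (γ.arc i) 2 = ((M.opened (P.j + 1) P.k).1, (M.opened (P.j + 1) P.k).2 * P.τ) := by
    refine (congrArg (fun x => T.across x 2) P.hx).trans ?_
    simp only [T.across_mul, P.hτ, M.across_opened P.j P.hk]
  rw [γ.tet_succ, γ.vertex_succ, γ.side_succ, h]
  simp only [P.hτ, Equiv.Perm.mul_apply, P.hμ0, and_self]

/-- The passages of a curve through the pillow are determined by their positions. -/
theorem liftArc_eq_of_position {γ : NormalCurve T} (hγ : γ.VisitsOnce)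
    (o o' : {i : Fin (γ.m + 1) // M.IsOpened (γ.arc i)}) (ε ε' : Fin 2)
    (hj : (M.passage o.2).j + ε = (M.passage o'.2).j + ε')
    (hv : (M.passage o.2).μ 0 = (M.passage o'.2).μ 0) (hk : (M.passage o.2).k = (M.passage o'.2).k) :
    (o, ε) = (o', ε') := by
  -- Passages in opposite directions at the same place cannot occur: the arc after `o'` would be the
  -- arc `o`, which would enter and leave its triangle through the same side.
  have key (o o' : {i : Fin (γ.m + 1) // M.IsOpened (γ.arc i)})
      (hj : (M.passage o.2).j = (M.passage o'.2).j + 1)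
      (hv : (M.passage o.2).μ 0 = (M.passage o'.2).μ 0)
      (hk : (M.passage o.2).k = (M.passage o'.2).k) : False := by
    obtain ⟨h1, h2, h3⟩ := arc_succ_of_passage γ (M.passage o'.2)
    rw [← hj, ← hk] at h1 h2 h3
    have h4 := (M.passage o.2).hx
    have h4' := congrArg (fun x => x.2 2) h4
    have h4'' := congrArg (fun x => x.2 0) h4
    simp only [Equiv.Perm.mul_apply, (M.passage o.2).hτ, ← (M.passage o.2).hμ0] at h4' h4''
    have h5 := hγ (o'.1 + 1) o.1 (h1.trans (congrArg Prod.fst h4).symm)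
      (h2.trans (by rw [h4'', hv]))
    rw [h5, ← h4'] at h3
    exact absurd ((γ.arc o.1).2.injective h3) (by decide)
  rcases (by omega : ε = ε' ∨ (ε = 0 ∧ ε' = 1) ∨ (ε = 1 ∧ ε' = 0)) with rfl | ⟨rfl, rfl⟩ | ⟨rfl, rfl⟩
  · have hj' := add_right_cancel hj
    have h4 := (M.passage o.2).hx
    have h5 := (M.passage o'.2).hx
    rw [hj', hk] at h4
    have h6 := hγ o.1 o'.1 ((congrArg Prod.fst h4).trans (congrArg Prod.fst h5).symm) (by
      have h4' := congrArg (fun x => x.2 0) h4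
      have h5' := congrArg (fun x => x.2 0) h5
      simp only [Equiv.Perm.mul_apply, ← (M.passage o.2).hμ0, ← (M.passage o'.2).hμ0] at h4' h5'
      rw [h4', h5', hv])
    rw [Subtype.ext h6]
  · exact (key o o' (by simpa using hj) hv hk).elim
  · exact (key o' o (by simpa using hj.symm) hv.symm hk.symm).elim

/-- The end points of the inserted arcs. -/
theorem endpoints_inserted {γ : NormalCurve T} {γ' : NormalCurve T'}
    (e : Fin (γ'.m + 1) ≃ M.LiftArc γ) (hsucc : ∀ i, e (i + 1) = M.liftNext γ (e i))
    (harc : ∀ i, γ'.arc i = M.liftFlag γ (e i)) (hpt : ∀ i, γ'.pt i = M.liftPoint γ (e i))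
    {i : Fin (γ'.m + 1)} {o : {i : Fin (γ.m + 1) // M.IsOpened (γ.arc i)}} {ε : Fin 2}
    (hi : e i = Sum.inr (o, ε)) :
    ∀ p, (p = γ'.pt i ∨ p = γ'.exitPt i) →
    (∀ u, p (M.lab ((M.passage o.2).j + ε) u) =
      sideMidpoint ((M.passage o.2).μ 0) (M.passage o.2).k u) ∨
    ∀ u, p (M.lab ((M.passage o.2).j + ε) u) =
      (Pi.single ((M.passage o.2).μ 3) (2 / 3) + Pi.single (M.passage o.2).k (1 / 3) : Fin 4 → ℝ) u := by
  have hex : γ'.exitPt i = fun w => M.liftPoint γ (M.liftNext γ (Sum.inr (o, ε)))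
      (T'.perm (M.liftFlag γ (Sum.inr (o, ε))).1 ((M.liftFlag γ (Sum.inr (o, ε))).2 2) w) := by
    rw [← hi, ← hsucc, ← hpt, ← harc]
    rfl
  rcases (by omega : ε = 0 ∨ ε = 1) with rfl | rfl
  · rintro p (rfl | rfl)
    · left
      intro u
      rw [hpt, hi]
      simp [liftPoint]
    · right
      intro u
      rw [hex, liftNext_inr_zero]
      simp only [liftFlag, liftPoint, if_true, if_neg (one_ne_zero (α := Fin 2)), add_zero,
        Equiv.Perm.mul_apply, M.perm_inr_inner _ (M.passage o.2).hμ2, Equiv.symm_apply_apply]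
  · rintro p (rfl | rfl)
    · right
      intro u
      rw [hpt, hi]
      simp [liftPoint]
    · left
      intro u
      obtain ⟨h1, h2, h3⟩ := arc_succ_of_passage γ (M.passage o.2)
      rw [hex, liftNext_inr_one]
      simp only [liftFlag, liftPoint, if_neg (one_ne_zero (α := Fin 2)),
        Equiv.Perm.mul_apply, swap_one_two_apply.2.2.1, (M.passage o.2).hμ1, h2, h3,
        M.perm_inr_outer _ (M.passage o.2).hk]
      simp [sideMidpoint]

theorem middle_three {μ : Equiv.Perm (Fin 4)} (h0 : μ 0 = 0 ∨ μ 0 = 1) (h2 : μ 2 = 0 ∨ μ 2 = 1) :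
    (μ 1 = 3 → μ 3 = 2) ∧ (μ 1 = 2 → μ 3 = 3) := by
  revert μ; decide

/-- The inserted arcs that enter the pillow through different faces are separated. -/
theorem segment_inserted {γ : NormalCurve T} {γ' : NormalCurve T'}
    (e : Fin (γ'.m + 1) ≃ M.LiftArc γ) (hsucc : ∀ i, e (i + 1) = M.liftNext γ (e i))
    (harc : ∀ i, γ'.arc i = M.liftFlag γ (e i)) (hpt : ∀ i, γ'.pt i = M.liftPoint γ (e i))
    {i : Fin (γ'.m + 1)} {o : {i : Fin (γ.m + 1) // M.IsOpened (γ.arc i)}} {ε : Fin 2}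
    (hi : e i = Sum.inr (o, ε)) (hv : (M.passage o.2).μ 0 = 0 ∨ (M.passage o.2).μ 0 = 1)
    {p : Fin 4 → ℝ} (hp : p ∈ segment ℝ (γ'.pt i) (γ'.exitPt i)) :
    ((M.passage o.2).k = 3 → p (M.lab ((M.passage o.2).j + ε) 3) <
      p (M.lab ((M.passage o.2).j + ε) 2)) ∧
    ((M.passage o.2).k = 2 → p (M.lab ((M.passage o.2).j + ε) 2) <
      p (M.lab ((M.passage o.2).j + ε) 3)) := by
  have h := endpoints_inserted e hsucc harc hpt hi
  obtain ⟨h3, h2⟩ := middle_three hv (M.passage o.2).hμ2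
  rw [(M.passage o.2).hμ1] at h3 h2
  have key (p) (hp : p = γ'.pt i ∨ p = γ'.exitPt i) :
      ((M.passage o.2).k = 3 → p (M.lab ((M.passage o.2).j + ε) 3) <
        p (M.lab ((M.passage o.2).j + ε) 2)) ∧
      ((M.passage o.2).k = 2 → p (M.lab ((M.passage o.2).j + ε) 2) <
        p (M.lab ((M.passage o.2).j + ε) 3)) := by
    rcases h p hp with h | h <;> rw [h, h] <;> refine ⟨fun hk => ?_, fun hk => ?_⟩
    · rcases hv with hv | hv <;> simp [hv, hk, sideMidpoint]
    · rcases hv with hv | hv <;> simp [hv, hk, sideMidpoint]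
    · rw [h3 hk, hk]
      simp
      norm_num
    · rw [h2 hk, hk]
      simp
      norm_num
  obtain ⟨a, b, ha, hb, hab, rfl⟩ := hp
  have k1 := key _ (Or.inl rfl)
  have k2 := key _ (Or.inr rfl)
  simp only [Pi.add_apply, Pi.smul_apply, smul_eq_mul]
  have comb {x y x' y' : ℝ} (h1 : x < y) (h2 : x' < y') : a * x + b * x' < a * y + b * y' := by
    rcases ha.eq_or_lt with rfl | ha
    · rw [zero_add] at hab
      rw [hab]
      linarith
    · have := mul_lt_mul_of_pos_left h1 ha
      have := mul_le_mul_of_nonneg_left h2.le hb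
      linarith
  exact ⟨fun hk => comb (k1.1 hk) (k2.1 hk), fun hk => comb (k1.2 hk) (k2.2 hk)⟩

/-- Two arcs in one new triangle must come from passages through different faces. This is possible
only at `A` or `B`, as `C` and `D` each lie on just one of the faces, and there the coordinates of
`C` and `D` compare oppositely along the two segments. -/
theorem isSimple_lift {γ : NormalCurve T} {γ' : NormalCurve T'} (hγ : γ.VisitsOnce)
    (e : Fin (γ'.m + 1) ≃ M.LiftArc γ) (hsucc : ∀ i, e (i + 1) = M.liftNext γ (e i))
    (harc : ∀ i, γ'.arc i = M.liftFlag γ (e i)) (hpt : ∀ i, γ'.pt i = M.liftPoint γ (e i)) :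
    γ'.IsSimple := by
  intro i i' hii h1 h2
  rw [harc, harc] at h1 h2
  have hne : e i ≠ e i' := e.injective.ne hii
  rcases hi : e i with a | ⟨o, ε⟩ <;> rcases hi' : e i' with a' | ⟨o', ε'⟩ <;>
    rw [hi, hi'] at h1 h2 hne
  · exact absurd (congrArg _ (hγ a a' (Sum.inl_injective h1) h2)) hne
  · rcases (by omega : ε' = 0 ∨ ε' = 1) with rfl | rfl <;> simp [liftFlag] at h1
  · rcases (by omega : ε = 0 ∨ ε = 1) with rfl | rfl <;> simp [liftFlag] at h1
  · have hf (o : {i : Fin (γ.m + 1) // M.IsOpened (γ.arc i)}) (ε : Fin 2) :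
        (M.liftFlag γ (Sum.inr (o, ε))).1 = Sum.inr ((M.passage o.2).j + ε) ∧
        (M.liftFlag γ (Sum.inr (o, ε))).2 0 =
          M.lab ((M.passage o.2).j + ε) ((M.passage o.2).μ 0) := by
      rcases (by omega : ε = 0 ∨ ε = 1) with rfl | rfl
      · simp [liftFlag]
      · simp [liftFlag, swap_one_two_apply.1]
    rw [(hf o ε).1, (hf o' ε').1] at h1
    have hj := Sum.inr_injective h1
    rw [(hf o ε).2, (hf o' ε').2, hj] at h2
    have hv := (M.lab _).injective h2
    have hk : (M.passage o.2).k ≠ (M.passage o'.2).k := fun hk =>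
      hne (congrArg Sum.inr (liftArc_eq_of_position hγ o o' ε ε' hj hv hk))
    have hvk (o : {i : Fin (γ.m + 1) // M.IsOpened (γ.arc i)}) :
        (M.passage o.2).μ 0 ≠ (M.passage o.2).k := by
      rw [← (M.passage o.2).hμ1]
      simp
    have hvk1 := hvk o
    have hvk2 := hvk o'
    rw [← hv] at hvk2
    have hk1 := (M.passage o.2).hk
    have hk2 := (M.passage o'.2).hk
    have hv01 : (M.passage o.2).μ 0 = 0 ∨ (M.passage o.2).μ 0 = 1 := by omega
    rw [Set.disjoint_left]
    intro p hp hp'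
    obtain ⟨a1, a2⟩ := segment_inserted e hsucc harc hpt hi hv01 hp
    obtain ⟨b1, b2⟩ := segment_inserted e hsucc harc hpt hi' (hv ▸ hv01) hp'
    rw [← hj] at b1 b2
    rcases hk1 with hk1 | hk1 <;> rcases hk2 with hk2 | hk2
    · exact hk (hk1.trans hk2.symm)
    · exact absurd (a2 hk1) (b1 hk2).not_gt
    · exact absurd (a1 hk1) (b2 hk2).not_gt
    · exact hk (hk1.trans hk2.symm)

/-- A flattening of the new triangulation with the right sums over the new tetrahedra is orthogonal to
the nontrivial curves of the old one. -/
theorem sum_turning_inl_eq_zero [Fintype ι] (M : ZeroTwoMove T T') {γ : NormalCurve T}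
    (hγ : γ.VisitsOnce) (hnt : ¬ γ.IsTrivial) (G : ι ⊕ Fin 2 → Fin 3 → ℤ)
    (hG : ∀ k u, k = 2 ∨ k = 3 → u = 0 ∨ u = 1 →
      G (Sum.inr 0) (M.newType 0 k u) + G (Sum.inr 1) (M.newType 1 k u) = 0)
    (hc : ∀ γ' : SimpleClosedCurve T', ∑ t, ∑ q, γ'.turning t q * G t q = 0) :
    ∑ t, ∑ q, γ.turning t q * G (Sum.inl t) q = 0 := by
  obtain ⟨γ', e, hsucc, harc, hpt⟩ := M.exists_lift_curve γ
  rw [← sum_turning_lift e harc G hG]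
  exact hc ⟨γ', isSimple_lift hγ e hsucc harc hpt, fun h => hnt (M.isTrivial_of_lift
    (crossing_lift e harc) h)⟩

end ZeroTwoMove

end IdealTriangulation

/-! ### The monomial on the pillow and the normalization of flattenings. -/

theorem shape_succ (z : ℂ) (h0 : z ≠ 0) (h1 : z ≠ 1) (q : Fin 3) :
    shape z (q + 2) = 1 - (shape z q)⁻¹ := by
  have h2 : 1 - z ≠ 0 := sub_ne_zero.2 h1.symm
  have h3 : z - 1 ≠ 0 := sub_ne_zero.2 h1
  have h4 : z * (1 - z⁻¹) = z - 1 := by field_simp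
  have h5 : 1 - z⁻¹ ≠ 0 := fun h => h3 (by rw [← h4, h, mul_zero])
  fin_cases q
  · simp [shape]
  · simp [shape]
  · simp [shape]
    field_simp
    rw [← h4]
    field_simp
    ring

/-- For `q = 0` this is the definition; the other cases follow from `z z' z'' = -1` and the sum of
`f`. The weight absorbs the asymmetry of the monomial, up to a sign that squaring removes. -/
theorem shapeWeight_mul_shapeMonomial_sq {z : ℂ} (h0 : z ≠ 0) (h1 : z ≠ 1) {f : Fin 3 → ℤ}
    (hf : ∑ q, f q = 1) (q : Fin 3) :
    (shapeWeight z q * shapeMonomial z f) ^ 2 =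
      (shape z q ^ f (q + 2) * shape z (q + 2) ^ (1 - f q)) ^ 2 := by
  rw [Fin.sum_univ_three] at hf
  have h2 := shape_ne_zero h0 h1 2
  have e0 : shape z 0 = z := rfl
  have sq (n : ℤ) : ((-1 : ℂ) ^ n) ^ 2 = 1 := by
    rw [← zpow_natCast, ← zpow_mul, mul_comm, zpow_mul]
    norm_num
  fin_cases q
  · have e : shapeWeight z 0 = shape z 2 := rfl
    show (shapeWeight z 0 * shapeMonomial z f) ^ 2 = (shape z 0 ^ f 2 * shape z 2 ^ (1 - f 0)) ^ 2
    rw [e, e0, shapeMonomial, sub_eq_add_neg 1, zpow_add₀ h2, zpow_one]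
    ring
  · have e : shapeWeight z 1 = -1 := rfl
    show (shapeWeight z 1 * shapeMonomial z f) ^ 2 = (shape z 1 ^ f 0 * shape z 0 ^ (1 - f 1)) ^ 2
    rw [e, e0, prod_shape h0 h1, shapeMonomial, show f 2 = (1 - f 1) + -f 0 by linarith,
      zpow_add₀ h0, neg_eq_neg_one_mul (z⁻¹ * _), mul_zpow, mul_zpow, inv_zpow', inv_zpow']
    linear_combination -(z ^ (1 - f 1) * z ^ (-f 0) * shape z 2 ^ (-f 0)) ^ 2 * sq (f 0)
  · have e : shapeWeight z 2 = z⁻¹ := rfl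
    show (shapeWeight z 2 * shapeMonomial z f) ^ 2 = (shape z 2 ^ f 1 * shape z 1 ^ (1 - f 2)) ^ 2
    rw [e, prod_shape h0 h1, shapeMonomial, neg_eq_neg_one_mul (z⁻¹ * _), mul_zpow, mul_zpow,
      inv_zpow', inv_zpow', neg_sub, show -f 0 = f 1 + (f 2 - 1) by linarith, zpow_add₀ h2,
      zpow_sub_one₀ h0]
    linear_combination -(shape z 2 ^ f 1 * (z ^ f 2 * z⁻¹ * shape z 2 ^ (f 2 - 1))) ^ 2 * sq (1 - f 2)

/-- The contribution of two tetrahedra glued along two faces. -/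
theorem pillow_sq {a b : ℂ} (ha0 : a ≠ 0) (ha1 : a ≠ 1) (hb0 : b ≠ 0) (hb1 : b ≠ 1)
    {f g : Fin 3 → ℤ} (hf : ∑ q, f q = 1) (hg : ∑ q, g q = 1) {q r : Fin 3}
    (h : shape a q * shape b r = 1) (h1 : f q + g r = 2) (h2 : f (q + 1) + g (r + 2) = 0) :
    (shapeWeight a q * shapeMonomial a f * (shapeWeight b r * shapeMonomial b g)) ^ 2 = 1 := by
  rw [mul_pow, shapeWeight_mul_shapeMonomial_sq ha0 ha1 hf q,
    shapeWeight_mul_shapeMonomial_sq hb0 hb1 hg r, ← mul_pow]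
  have hs := shape_ne_zero ha0 ha1 q
  have hs2 := shape_ne_zero ha0 ha1 (q + 2)
  have e1 : shape b r = (shape a q)⁻¹ := eq_inv_of_mul_eq_one_right h
  have e2 : shape b (r + 2) = -1 * (shape a q * shape a (q + 2)) := by
    rw [shape_succ b hb0 hb1, shape_succ a ha0 ha1, e1]
    field_simp
    ring
  have e3 : f q + f (q + 1) + f (q + 2) = 1 := by
    rw [← hf, Fin.sum_univ_three]
    fin_cases q
    · rfl
    · show f 1 + f 2 + f 0 = _
      ring
    · show f 2 + f 0 + f 1 = _
      ring
  have e4 : 1 - g r = -(1 - f q) := by linarith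
  have e5 : g (r + 2) = -f (q + 1) := by linarith
  have sq (n : ℤ) : ((-1 : ℂ) ^ n) ^ 2 = 1 := by
    rw [← zpow_natCast, ← zpow_mul, mul_comm, zpow_mul]
    norm_num
  -- Both tetrahedra are expressed through two shapes of `a`. By the flattening equations the
  -- exponent of each is zero, and only a sign survives.
  have e6 : shape a q ^ f (q + 2) * shape a (q + 2) ^ (1 - f q) *
      (shape b r ^ g (r + 2) * shape b (r + 2) ^ (1 - g r)) = (-1) ^ (-(1 - f q)) := by
    rw [e1, e2, e4, e5, inv_zpow', neg_neg, mul_zpow, mul_zpow, zpow_neg (shape a (q + 2))]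
    have e7 : shape a q ^ f (q + 2) * shape a q ^ f (q + 1) * shape a q ^ (-(1 - f q)) = 1 := by
      rw [← zpow_add₀ hs, ← zpow_add₀ hs, show f (q + 2) + f (q + 1) + -(1 - f q) = 0 by linarith,
        zpow_zero]
    have e8 : shape a (q + 2) ^ (1 - f q) * (shape a (q + 2) ^ (1 - f q))⁻¹ = 1 :=
      mul_inv_cancel₀ (zpow_ne_zero _ hs2)
    linear_combination (-1) ^ (-(1 - f q)) * (shape a (q + 2) ^ (1 - f q) *
      (shape a (q + 2) ^ (1 - f q))⁻¹) * e7 + (-1) ^ (-(1 - f q)) * e8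
  rw [e6, sq]

namespace IdealTriangulation

theorem sum_incidence_mul {ι : Type*} [Fintype ι] (T : IdealTriangulation ι)
    (c : Quot T.EdgeStep → ℤ) {g : ι → Fin 3 → ℤ}
    (h : ∀ e : T.Edge, ∑ t, ∑ q, (T.incidence e t q : ℤ) * g t q = 0) :
    ∑ t, ∑ q, T.typeSum c t q * g t q = 0 := by
  have := Fintype.ofFinite T.Edge
  simp only [← T.sum_mul_incidence (fun e => c e.1) c (fun _ => rfl), Finset.sum_mul, mul_assoc]
  rw [Finset.sum_congr rfl fun t _ => Finset.sum_comm, Finset.sum_comm]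
  refine Finset.sum_eq_zero fun e _ => ?_
  have h1 := h e
  simp only [← Finset.mul_sum] at h1 ⊢
  rw [h1, mul_zero]

/-- Edge rows are symplectically orthogonal to all edge rows and all curve rows, so their duals
solve the homogeneous equations. -/
theorem IsStrongFlattening.add_edgeDual {ι : Type*} [Fintype ι] {T : IdealTriangulation ι}
    {f : ι → Fin 3 → ℤ} (hf : T.IsStrongFlattening f) (c : Quot T.EdgeStep → ℤ) :
    T.IsStrongFlattening fun t q => f t q + T.edgeDual c t q where
  tet t := by rw [Finset.sum_add_distrib, hf.tet, T.sum_edgeDual, add_zero]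
  edge e := by
    classical
    simp only [mul_add, Finset.sum_add_distrib, hf.edge]
    have h := T.sum_typeSum_mul_edgeDual e.1 c
    rw [add_eq_left, ← h]
    refine Finset.sum_congr rfl fun t _ => Finset.sum_congr rfl fun q _ => ?_
    rw [incidence_eq_typeSum]
  curve γ := by
    simp only [mul_add, Finset.sum_add_distrib, hf.curve, γ.toNormalCurve.sum_turning_edgeDual,
      add_zero]

namespace ZeroTwoMove

variable {ι : Type*} {T : IdealTriangulation ι} {T' : IdealTriangulation (ι ⊕ Fin 2)}
  (M : ZeroTwoMove T T')

theorem typeSum_inr {N : Type*} [AddCommMonoid N] (c : Quot T'.EdgeStep → N) (j : Fin 2) :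
    T'.typeSum c (Sum.inr j) (M.newType j 0 1) = c (M.newEdge j 0 1) + c (M.newEdge j 2 3) ∧
    T'.typeSum c (Sum.inr j) (M.newType j 0 2) = c (M.newEdge j 0 2) + c (M.newEdge j 1 3) ∧
    T'.typeSum c (Sum.inr j) (M.newType j 0 3) = c (M.newEdge j 0 3) + c (M.newEdge j 1 2) :=
  ⟨T'.typeSum_perm c _ (M.lab j), T'.typeSum_perm_two c _ (M.lab j),
    T'.typeSum_perm_three c _ (M.lab j)⟩

theorem typeSum_inr_one {N : Type*} [AddCommMonoid N] (c : Quot T'.EdgeStep → N) :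
    T'.typeSum c (Sum.inr 1) (M.newType 1 0 2) = T'.typeSum c (Sum.inr 0) (M.newType 0 0 2) ∧
    T'.typeSum c (Sum.inr 1) (M.newType 1 0 3) = T'.typeSum c (Sum.inr 0) (M.newType 0 0 3) := by
  rw [(M.typeSum_inr c 0).2.1, (M.typeSum_inr c 0).2.2, (M.typeSum_inr c 1).2.1,
    (M.typeSum_inr c 1).2.2, M.newEdge_one (u := 0) (v := 2) (by decide) (by decide),
    M.newEdge_one (u := 1) (v := 3) (by decide) (by decide),
    M.newEdge_one (u := 0) (v := 3) (by decide) (by decide),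
    M.newEdge_one (u := 1) (v := 2) (by decide) (by decide)]
  exact ⟨rfl, rfl⟩

theorem newType_eq (j : Fin 2) :
    (Equiv.Perm.sign (M.lab j) = 1 ∧ M.newType j 0 2 = M.newType j 0 1 + 1 ∧
      M.newType j 0 3 = M.newType j 0 1 + 2) ∨
    (Equiv.Perm.sign (M.lab j) = -1 ∧ M.newType j 0 2 = M.newType j 0 1 + 2 ∧
      M.newType j 0 3 = M.newType j 0 1 + 1) := by
  have e : ∀ q : Fin 3, q + 1 + 1 = q + 2 ∧ q + 1 + 2 = q ∧ q + 2 + 1 = q ∧ q + 2 + 2 = q + 1 := by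
    decide
  simp only [newType]
  rcases quadType_perm (M.lab j) with ⟨h, h1, h2⟩ | ⟨h, h1, h2⟩
  · left
    rw [h1, h2, (e _).1, (e _).2.1]
    exact ⟨h, rfl, rfl⟩
  · right
    rw [h1, h2, (e _).2.2.1, (e _).2.2.2]
    exact ⟨h, rfl, rfl⟩

/-- The orientations are opposite, so all shared edges cancel and only the difference at the two
copies of `AB` remains. One copy of `AB` can thus adjust the sum over `AC` by any integer. -/
theorem edgeDual_AC (c : Quot T'.EdgeStep → ℤ) :
    T'.edgeDual c (Sum.inr 0) (M.newType 0 0 2) + T'.edgeDual c (Sum.inr 1) (M.newType 1 0 2) =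
      (Equiv.Perm.sign (M.lab 0) : ℤ) * (c (M.edgeAB 1).1 - c (M.edgeAB 0).1) := by
  have e : ∀ q : Fin 3, q + 1 + 1 = q + 2 ∧ q + 1 + 2 = q ∧ q + 2 + 1 = q ∧ q + 2 + 2 = q + 1 := by
    decide
  have hs := M.sign_lab
  obtain ⟨a2, a3⟩ := M.typeSum_inr_one c
  have b0 := (M.typeSum_inr c 0).1
  have b1 := (M.typeSum_inr c 1).1
  rw [M.newEdge_one (u := 2) (v := 3) (by decide) (by decide)] at b1
  simp only [edgeAB, GluedTetrahedra.edgeDual]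
  rcases M.newType_eq 0 with ⟨s0, c1, c2⟩ | ⟨s0, c1, c2⟩ <;>
    rcases M.newType_eq 1 with ⟨s1, d1, d2⟩ | ⟨s1, d1, d2⟩ <;> rw [s0, s1] at hs
  · exact absurd hs (by decide)
  · rw [c1, d1] at a2 ⊢
    rw [c2, d2] at a3
    simp only [e]
    rw [a3, b0, b1, s0]
    push_cast
    ring
  · rw [c1, d1] at a2 ⊢
    rw [c2, d2] at a3
    simp only [e]
    rw [a3, b0, b1, s0]
    push_cast
    ring
  · exact absurd hs (by decide)

/-- A strong flattening can be normalized on the new tetrahedra. -/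
theorem exists_normalized_flattening [Fintype ι] {z' : ι ⊕ Fin 2 → ℂ} (hz' : z' ∈ T'.gluingVariety)
    {f : ι ⊕ Fin 2 → Fin 3 → ℤ} (hf : T'.IsStrongFlattening f) :
    ∃ g, T'.IsStrongFlattening g ∧
      g (Sum.inr 0) (M.newType 0 0 2) + g (Sum.inr 1) (M.newType 1 0 2) = 0 ∧
      (∏ t, shapeMonomial (z' t) (g t)) ^ 2 = (∏ t, shapeMonomial (z' t) (f t)) ^ 2 := by
  classical
  -- The multiple of `AB` for which `edgeDual_AC` yields exactly minus the defect; the two signs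
  -- multiply to `1`.
  let c : Quot T'.EdgeStep → ℤ := fun x => (Equiv.Perm.sign (M.lab 0) : ℤ) *
    (f (Sum.inr 0) (M.newType 0 0 2) + f (Sum.inr 1) (M.newType 1 0 2)) *
    if x = (M.edgeAB 0).1 then 1 else 0
  refine ⟨_, hf.add_edgeDual c, ?_, ?_⟩
  · have h := M.edgeDual_AC c
    have h1 : (M.edgeAB 1).1 ≠ (M.edgeAB 0).1 := fun h => M.edgeAB_ne (Subtype.ext h.symm)
    have h2 : c (M.edgeAB 1).1 = 0 := by simp only [c, if_neg h1, mul_zero]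
    have h3 : c (M.edgeAB 0).1 = (Equiv.Perm.sign (M.lab 0) : ℤ) *
        (f (Sum.inr 0) (M.newType 0 0 2) + f (Sum.inr 1) (M.newType 1 0 2)) := by
      simp only [c, if_true, mul_one]
    rw [h2, h3] at h
    rcases Int.units_eq_one_or (Equiv.Perm.sign (M.lab 0)) with hs | hs <;> rw [hs] at h <;>
      push_cast at h <;> linarith
  · have h (t) := shapeMonomial_add (hz'.1 t).1 (hz'.1 t).2 (f t) (T'.edgeDual c t)
    simp only [h, Finset.prod_mul_distrib]
    rw [T'.prod_shapeMonomial_edgeDual hz' c, mul_pow, ← zpow_natCast ((-1 : ℂ) ^ _), ← zpow_mul,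
      mul_comm _ ((2 : ℕ) : ℤ), zpow_mul]
    norm_num

/-- The sums of a normalized flattening over the edges of the new tetrahedra. -/
theorem flattening_inr [Fintype ι] {g : ι ⊕ Fin 2 → Fin 3 → ℤ} (hg : T'.IsStrongFlattening g)
    (h : g (Sum.inr 0) (M.newType 0 0 2) + g (Sum.inr 1) (M.newType 1 0 2) = 0) :
    g (Sum.inr 0) (M.newType 0 0 1) + g (Sum.inr 1) (M.newType 1 0 1) = 2 ∧
    g (Sum.inr 0) (M.newType 0 0 3) + g (Sum.inr 1) (M.newType 1 0 3) = 0 := by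
  classical
  have hCD := hg.edge M.edgeCD
  simp only [incidence_eq_typeSum] at hCD
  have hpb (x : T'.Edge) : (if x.1 = M.edgeCD.1 then (1 : ℤ) else 0) =
      M.pullback (fun _ => (0 : ℤ)) 1 x.1 := by
    by_cases hx : x = M.edgeCD
    · rw [hx, if_pos rfl, pullback, M.proj_edgeCD, Option.elim]
    · obtain ⟨e, he⟩ := M.exists_proj hx
      rw [if_neg (fun h => hx (Subtype.ext h)), pullback, he, Option.elim]
  simp only [T'.typeSum_congr (c := fun x => if x = M.edgeCD.1 then (1 : ℤ) else 0) hpb] at hCD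
  rw [Fintype.sum_sum_type, Finset.sum_eq_zero, zero_add, Fin.sum_univ_two] at hCD
  · have h1 (j : Fin 2) : ∑ q, T'.typeSum (M.pullback (fun _ => (0 : ℤ)) 1) (Sum.inr j) q *
        g (Sum.inr j) q = g (Sum.inr j) (M.newType j 0 1) := by
      obtain ⟨e1, e2, e3⟩ := M.typeSum_inr (M.pullback (fun _ => (0 : ℤ)) 1) j
      rw [M.pullback_newEdge_CD, M.pullback_newEdge _ _ _ (Or.inr rfl) (by decide) (by decide)] at e1
      rw [M.pullback_newEdge _ _ _ (Or.inr rfl) (by decide) (by decide),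
        M.pullback_newEdge _ _ _ (Or.inl rfl) (by decide) (by decide)] at e2
      rw [M.pullback_newEdge _ _ _ (Or.inl rfl) (by decide) (by decide),
        M.pullback_newEdge _ _ _ (Or.inr rfl) (by decide) (by decide)] at e3
      rw [sum_quadType_perm _ (M.lab j)]
      simp only [newType] at e1 e2 e3 ⊢
      rw [e1, e2, e3]
      ring
    rw [h1, h1] at hCD
    refine ⟨hCD, ?_⟩
    have t0 := hg.tet (Sum.inr 0)
    have t1 := hg.tet (Sum.inr 1)
    rw [sum_quadType_perm _ (M.lab 0)] at t0
    rw [sum_quadType_perm _ (M.lab 1)] at t1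
    simp only [newType] at *
    linarith
  · intro t _
    refine Finset.sum_eq_zero fun q _ => ?_
    rw [typeSum_inl (T := T) (c := fun _ => (0 : ℤ)) (fun t a b => rfl)]
    simp [GluedTetrahedra.typeSum]

/-- A normalized flattening satisfies the edge equations of the old triangulation. -/
theorem sum_incidence_inl [Fintype ι] {g : ι ⊕ Fin 2 → Fin 3 → ℤ} (hg : T'.IsStrongFlattening g)
    (h : g (Sum.inr 0) (M.newType 0 0 2) + g (Sum.inr 1) (M.newType 1 0 2) = 0) (e : T.Edge) :
    ∑ t, ∑ q, (T.incidence e t q : ℤ) * g (Sum.inl t) q = 2 := by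
  classical
  obtain ⟨h01, h03⟩ := M.flattening_inr hg h
  obtain ⟨e', he', hne⟩ := M.exists_lift e 0
  -- The sum of all edges arising from `e`. If `e` is `AB`, there are two of them and `κ = 1`: the
  -- total is then `4`, of which the new tetrahedra contribute `2` through the type of `AB`.
  let c' := M.pullback (fun x => if x = e.1 then (1 : ℤ) else 0) 0
  let κ : ℤ := if (M.edgeAB (0 + 1)).1 = e'.1 then 1 else 0
  have hc (x : T'.Edge) : c' x.1 = (if x.1 = e'.1 then (1 : ℤ) else 0) +
      κ * if x.1 = (M.edgeAB 0).1 then 1 else 0 := by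
    rw [M.indicator_proj he' hne x]
    by_cases hx : x = M.edgeCD
    · simp only [c', pullback]
      rw [hx, M.proj_edgeCD, Option.elim, if_neg (by simp)]
    · obtain ⟨f, hf⟩ := M.exists_proj hx
      simp only [c', pullback]
      rw [hf, Option.elim]
      simp
  have h1 : ∑ t, ∑ q, T'.typeSum c' t q * g t q = 2 + κ * 2 := by
    have a1 := hg.edge e'
    have a2 := hg.edge (M.edgeAB 0)
    simp only [incidence_eq_typeSum] at a1 a2
    simp only [T'.typeSum_congr (d := fun x => (if x = e'.1 then (1 : ℤ) else 0) +
      κ * if x = (M.edgeAB 0).1 then 1 else 0) hc, T'.typeSum_add, T'.typeSum_mul, add_mul, mul_assoc,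
      Finset.sum_add_distrib, ← Finset.mul_sum, a1, a2]
  have hκ : c' (M.newEdge 0 0 1) = κ ∧ c' (M.newEdge 1 0 1) = κ := by
    have a0 : c' (M.edgeAB 0).1 = _ := hc (M.edgeAB 0)
    have h2 : (M.edgeAB 0).1 ≠ e'.1 := fun h => hne (Subtype.ext h.symm)
    rw [if_neg h2, if_pos rfl, zero_add, mul_one] at a0
    refine ⟨a0, ?_⟩
    rw [← a0]
    show (M.proj (M.edgeAB 1).1).elim 0 _ = (M.proj (M.edgeAB 0).1).elim 0 _
    rw [proj_edgeAB, proj_edgeAB]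
  rw [Fintype.sum_sum_type, Fin.sum_univ_two] at h1
  have hl (t : ι) (q : Fin 3) : T'.typeSum c' (Sum.inl t) q = (T.incidence e t q : ℤ) := by
    rw [incidence_eq_typeSum]
    exact typeSum_inl (T := T) (fun t a b => rfl) t q
  simp only [hl] at h1
  obtain ⟨a2, a3⟩ := M.typeSum_inr_one c'
  have b0 := (M.typeSum_inr c' 0).1
  have b1 := (M.typeSum_inr c' 1).1
  have hcd (j) : c' (M.newEdge j 2 3) = 0 := M.pullback_newEdge_CD _ _ j
  rw [hκ.1, hcd] at b0
  rw [hκ.2, hcd] at b1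
  rw [sum_quadType_perm _ (M.lab 0), sum_quadType_perm _ (M.lab 1)] at h1
  simp only [newType] at *
  rw [a2, a3, b0, b1] at h1
  linear_combination h1 - κ * h01 - T'.typeSum c' (Sum.inr 0) (quadType (M.lab 0 0) (M.lab 0 2)) * h -
    T'.typeSum c' (Sum.inr 0) (quadType (M.lab 0 0) (M.lab 0 3)) * h03

/-- Comparison of the monomials in the 1-loop invariants on the old tetrahedra. -/
theorem prod_shapeMonomial_inl_sq [Fintype ι] {z : ι → ℂ} (hz : z ∈ T.gluingVariety)
    {f : ι → Fin 3 → ℤ} (hf : T.IsStrongFlattening f)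
    {g : ι ⊕ Fin 2 → Fin 3 → ℤ} (hg : T'.IsStrongFlattening g)
    (h : g (Sum.inr 0) (M.newType 0 0 2) + g (Sum.inr 1) (M.newType 1 0 2) = 0) :
    (∏ t, shapeMonomial (z t) (f t)) ^ 2 = (∏ t, shapeMonomial (z t) (g (Sum.inl t))) ^ 2 := by
  obtain ⟨h01, h03⟩ := M.flattening_inr hg h
  let d : ι → Fin 3 → ℤ := fun t q => f t q - g (Sum.inl t) q
  have htet (t) : ∑ q, d t q = 0 := by
    simp only [d, Finset.sum_sub_distrib, hf.tet, hg.tet, sub_self]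
  have hedge (e : T.Edge) : ∑ t, ∑ q, (T.incidence e t q : ℤ) * d t q = 0 := by
    simp only [d, mul_sub, Finset.sum_sub_distrib, hf.edge, M.sum_incidence_inl hg h, sub_self]
  have h1 := T.prod_shapeMonomial_sq hz d htet fun γ hγ => by
    -- Strong flattenings control only nontrivial curves. For trivial ones the edge equations
    -- suffice; nontrivial ones are lifted through the pillow.
    by_cases hnt : γ.IsTrivial
    · obtain ⟨c, hc⟩ := hnt.sum_turning
      rw [Finset.sum_congr rfl fun t _ => hc t (d t) (htet t)]
      exact T.sum_incidence_mul c hedge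
    · have hG : ∀ k u : Fin 4, k = 2 ∨ k = 3 → u = 0 ∨ u = 1 →
          g (Sum.inr 0) (M.newType 0 k u) + g (Sum.inr 1) (M.newType 1 k u) = 0 := by
        have key : ∀ τ : Equiv.Perm (Fin 4), quadType (τ 2) (τ 0) = quadType (τ 0) (τ 2) ∧
            quadType (τ 3) (τ 1) = quadType (τ 0) (τ 2) ∧
            quadType (τ 3) (τ 0) = quadType (τ 0) (τ 3) ∧
            quadType (τ 2) (τ 1) = quadType (τ 0) (τ 3) := by decide
        simp only [newType] at *
        rintro k u (rfl | rfl) (rfl | rfl)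
        · rwa [(key _).1, (key _).1]
        · rwa [(key _).2.2.2, (key _).2.2.2]
        · rwa [(key _).2.2.1, (key _).2.2.1]
        · rwa [(key _).2.1, (key _).2.1]
      have h2 := sum_turning_inl_eq_zero M hγ hnt g hG hg.curve
      have h3 := hf.curve ⟨γ, hγ.isSimple, hnt⟩
      simp only [d, mul_sub, Finset.sum_sub_distrib]
      rw [h2]
      exact (sub_zero _).trans h3
  have h2 (t : ι) : shapeMonomial (z t) (f t) =
      shapeMonomial (z t) (d t) * shapeMonomial (z t) (g (Sum.inl t)) := by
    rw [← shapeMonomial_add (hz.1 t).1 (hz.1 t).2]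
    simp only [d, sub_add_cancel]
  simp only [h2, Finset.prod_mul_distrib]
  rw [mul_pow, h1, one_mul]

/-- The contribution of the new tetrahedra. -/
theorem new_tetrahedra_sq [Fintype ι] {z' : ι ⊕ Fin 2 → ℂ} (hz' : z' ∈ T'.gluingVariety)
    {g : ι ⊕ Fin 2 → Fin 3 → ℤ} (hg : T'.IsStrongFlattening g)
    (h : g (Sum.inr 0) (M.newType 0 0 2) + g (Sum.inr 1) (M.newType 1 0 2) = 0) :
    (shapeWeight (z' (Sum.inr 0)) (M.newType 0 0 1) * shapeMonomial (z' (Sum.inr 0)) (g (Sum.inr 0)) *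
      (shapeWeight (z' (Sum.inr 1)) (M.newType 1 0 1) *
        shapeMonomial (z' (Sum.inr 1)) (g (Sum.inr 1)))) ^ 2 = 1 := by
  obtain ⟨h01, h03⟩ := M.flattening_inr hg h
  refine pillow_sq (hz'.1 _).1 (hz'.1 _).2 (hz'.1 _).1 (hz'.1 _).2 (hg.tet _) (hg.tet _)
    (M.shape_mul_shape hz') h01 ?_
  have hs := M.sign_lab
  rcases M.newType_eq 0 with ⟨s0, c1, c2⟩ | ⟨s0, c1, c2⟩ <;>
    rcases M.newType_eq 1 with ⟨s1, d1, d2⟩ | ⟨s1, d1, d2⟩ <;> rw [s0, s1] at hs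
  · exact absurd hs (by decide)
  · rwa [← c1, ← d1]
  · rwa [← c2, ← d2]
  · exact absurd hs (by decide)

end ZeroTwoMove

end IdealTriangulation

end

/-! ### Comparison of the two invariants. -/

theorem proposition4 {ι κ : Type*} [Fintype ι] [DecidableEq ι]
    (T : IdealTriangulation ι) (T' : IdealTriangulation (ι ⊕ Fin 2))
    (move : IdealTriangulation.ZeroTwoMove T T')
    (α : T.CurveSystem κ) (α' : T'.CurveSystem κ)
    (hα : ∀ i, IdealTriangulation.SameClass (α.curve i).toNormalCurve (α'.curve i).toNormalCurve)
    (z : ι → ℂ) (hz : z ∈ T.gluingVariety)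
    (z' : ι ⊕ Fin 2 → ℂ) (hz' : z' ∈ T'.gluingVariety)
    (hzz' : ∀ t, z t = z' (Sum.inl t))
    (c : T.Choice κ) (c' : T'.Choice κ)
    (hc : (T.GeneratesEdgeEquations c.edges ∧ T'.GeneratesEdgeEquations c'.edges) ∨
      IdealTriangulation.SameOmittedEdges c.edges c'.edges) :
    T.oneLoop α c z = T'.oneLoop α' c' z' ∨ T.oneLoop α c z = -T'.oneLoop α' c' z' := by
  rw [← sq_eq_sq_iff_eq_or_eq_neg, T.oneLoop_eq, T'.oneLoop_eq]
  obtain ⟨ε, hε, hdet⟩ := move.det_eq_or_neg hα hz' hzz' c c' hc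
  obtain ⟨g, hg, h0, hgf⟩ := move.exists_normalized_flattening hz' c'.isStrongFlattening
  have h1 := move.prod_shapeMonomial_inl_sq hz c.isStrongFlattening hg h0
  have h2 := move.new_tetrahedra_sq hz' hg h0
  have hε2 : ε ^ 2 = 1 := by rcases hε with rfl | rfl <;> norm_num
  rw [Fintype.prod_sum_type, Fin.prod_univ_two] at hgf
  simp only [← hzz'] at hgf
  have hdet' := hdet
  generalize (Matrix.of fun i => Sum.elim (fun e : c'.edges => T'.edgeLoopRow z' e)
      (fun a => IdealTriangulation.curveLoopRow z' (α'.curve a).toNormalCurve) (c'.row i)).det = D' at *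
  generalize (Matrix.of fun i => Sum.elim (fun e : c.edges => T.edgeLoopRow z e)
      (fun a => IdealTriangulation.curveLoopRow z (α.curve a).toNormalCurve) (c.row i)).det = D at *
  -- After squaring, both flattenings are replaced by the normalized one; the weights from the
  -- determinant then meet the new part of the monomial, whose product with them has square `1` by
  -- `h2`.
  rw [mul_pow _ (∏ t, _), mul_pow _ (∏ t, _), h1, ← hgf, hdet]
  linear_combination -(1 / 2 * D) ^ 2 * (∏ t, shapeMonomial (z t) (g (Sum.inl t))) ^ 2 *
    (h2 * ε ^ 2 + hε2)
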